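/- Let $(M,J,\omega)$ be a Kähler manifold of complex dimension $n$ (so $g=\omega(\cdot,J\cdot)$ is the Kähler metric and $\omega=i\,g_{\alpha\bar\beta}\,dz^\alpha\wedge d\bar z^\beta$ in holomorphic coordinates), let $p\colon P_M\to M$ be a smooth principal $S^1$-bundle, and let $\theta$ be a real-valued principal connection form on $P_M$ (an $S^1$-invariant smooth $1$-form with value $1$ on the vector field $\frac{d}{dt}\big|_{t=0}(e^{it}\cdot q)$) such that $d\theta/2\pi=p^*\omega$. (Such a pair $(P_M,\theta)$ exists exactly when $[\omega]$ is an integral class, i.e. when $(M,J,\omega)$ is a Hodge manifold, and then $-[\omega]$ is the real Euler class of $P_M$.) Put $H=\operatorname{Ker}\theta$; the differential $p_*$ maps each $H_q$ isomorphically onto $T_{p(q)}M$, and $p^*J\colon H\to H$ denotes the lift of $J$, i.e. $p_*\circ p^*J=J\circ p_*$ on $H$. Then: 1. $(P_M,H,p^*J)$ is a strongly pseudoconvex CR manifold: $p^*J$ is a smooth almost complex structure on the smooth codimension-one subbundle $H$, the sections of $T^{1,0}P_M=\{v-i(p^*J)v : v\in H\}$ are closed under the Lie bracket, and the Levi forms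 $d\theta(\cdot,p^*J\,\cdot)$ and $\frac{1}{2\pi}d\theta(\cdot,p^*J\,\cdot)$ on $H$ are positive definite. In particular $\theta/2\pi$ has a unique Reeb vector field $T$, and $(P_M,H,p^*J,\theta/2\pi)$ is a pseudohermitian manifold. 2. The Tanaka–Webster connection $\nabla$ of $(P_M,H,p^*J,\theta/2\pi)$ is the pullback of the Levi-Civita connection $\nabla^M$ of $g$: one has $\nabla T=0$, and, identifying $H$ with $p^*TM$ by $p_*$, $\nabla_v(Y^H)=\big(\nabla^M_{p_*v}Y\big)^H$ for every vector field $Y$ on $M$ and every tangent vector $v$ of $P_M$, where $(\cdot)^H$ is the horizontal lift. 3. The pseudohermitian scalar curvature of $(P_M,H,p^*J,\theta/2\pi)$, that is $h^{\rho\bar\sigma}R_\alpha{}^\alpha{}_{\rho\bar\sigma}$, where $R_\alpha{}^\beta{}_{\rho\bar\sigma}\theta^\rho\wedge\theta^{\bar\sigma}$ is the $(1,1)$-part of the curvature forms of $\nabla$ in an admissible coframe $(\theta^\alpha)$ with $d\theta/2\pi=i\,h_{\alpha\bar\beta}\theta^\alpha\wedge\theta^{\bar\beta}$, equals $p^*S(\omega)$,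 where $S(\omega)=g^{\rho\bar\sigma}\mathrm{Ric}_{\rho\bar\sigma}$ is the scalar curvature of $(M,J,\omega)$ (half of the Riemannian scalar curvature of $g$). -/

import Mathlib

open Set Bundle
open scoped Manifold ContDiff Topology

noncomputable section

/-! ### Vector fields and differential forms on a smooth manifold without boundary -/

section Forms

variable {E : Type*} [NormedAddCommGroup E] [NormedSpace ℝ E]
  {M : Type*} [TopologicalSpace M] [ChartedSpace E M]

/-- The vector field `X` is smooth on the set `U`. -/
def SmoothFieldOn [IsManifold 𝓘(ℝ, E) ∞ M] (X : ∀ x : M, TangentSpace 𝓘(ℝ, E) x) (U : Set M) : Prop :=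
  ContMDiffOn 𝓘(ℝ, E) 𝓘(ℝ, E).tangent ∞
    (fun x => (⟨x, X x⟩ : TangentBundle 𝓘(ℝ, E) M)) U

/-- The vector field `X` is differentiable at the point `x`. -/
def DiffFieldAt [IsManifold 𝓘(ℝ, E) ∞ M] (X : ∀ x : M, TangentSpace 𝓘(ℝ, E) x) (x : M) : Prop :=
  MDifferentiableAt 𝓘(ℝ, E) 𝓘(ℝ, E).tangent
    (fun y => (⟨y, X y⟩ : TangentBundle 𝓘(ℝ, E) M)) x

variable (E M) in
/-- Real differential forms of degree `k` (without regularity). -/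
abbrev DiffForm (k : ℕ) : Type _ := ∀ x : M, TangentSpace 𝓘(ℝ, E) x [⋀^Fin k]→L[ℝ] ℝ

variable (E M) in
/-- Real differential forms of degree one, as fields of covectors (without regularity). -/
abbrev OneForm : Type _ := ∀ x : M, TangentSpace 𝓘(ℝ, E) x →L[ℝ] ℝ

/-- A field of covectors as a form of degree one. -/
def OneForm.toDiffForm (θ : OneForm E M) : DiffForm E M 1 :=
  fun x => ContinuousAlternatingMap.ofSubsingleton ℝ (TangentSpace 𝓘(ℝ, E) x) ℝ (0 : Fin 1) (θ x)

/-- The form `α` read in the preferred chart at `c`: its pullback under the inverse chart. -/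
def DiffForm.inChart {k : ℕ} (α : DiffForm E M k) (c : M) (y : E) : E [⋀^Fin k]→L[ℝ] ℝ :=
  (α ((extChartAt 𝓘(ℝ, E) c).symm y)).compContinuousLinearMap
    ((mfderiv 𝓘(ℝ, E) 𝓘(ℝ, E) (extChartAt 𝓘(ℝ, E) c).symm y).comp
      ((NormedSpace.fromTangentSpace (𝕜 := ℝ) y).symm : E →L[ℝ] TangentSpace 𝓘(ℝ, E) y))

/-- The form `α` is smooth on the set `U`. -/
def DiffForm.SmoothOn {k : ℕ} (α : DiffForm E M k) (U : Set M) : Prop :=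
  ∀ c : M, ContDiffOn ℝ ∞ (α.inChart c)
    ((extChartAt 𝓘(ℝ, E) c).target ∩ (extChartAt 𝓘(ℝ, E) c).symm ⁻¹' U)

/-- The exterior derivative, computed at `x` in the preferred chart at `x`, with the convention
`dθ(X, Y) = X θ(Y) - Y θ(X) - θ([X, Y])` in degree one. -/
def DiffForm.d {k : ℕ} (α : DiffForm E M k) : DiffForm E M (k + 1) := fun x =>
  (extDeriv (α.inChart x) (extChartAt 𝓘(ℝ, E) x x)).compContinuousLinearMap
    (mvfderiv 𝓘(ℝ, E) (extChartAt 𝓘(ℝ, E) x) x)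

/-- The exterior derivative `dθ` of a field of covectors, as a form of degree two. -/
def OneForm.d (θ : OneForm E M) : DiffForm E M 2 := θ.toDiffForm.d

end Forms

/-! ### Linear connections on a manifold: Levi-Civita connection, curvature -/

section Connections

variable {E : Type*} [NormedAddCommGroup E] [NormedSpace ℝ E]
  {M : Type*} [TopologicalSpace M] [ChartedSpace E M] [IsManifold 𝓘(ℝ, E) ∞ M]

variable (E M) in
/-- Linear connections on the manifold `M`; `nabla Y x u` is `∇_u Y` at `x`. -/
abbrev LinearConnection : Type _ :=
  CovariantDerivative 𝓘(ℝ, E) E (fun x : M => TangentSpace 𝓘(ℝ, E) x)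

/-- The curvature `R(u, v) w = ∇_U ∇_V W - ∇_V ∇_U W - ∇_{[U, V]} W` at `x`, where `U, V, W` are
local extensions of `u, v, w`. -/
def curvature (nabla : LinearConnection E M) (x : M) (u v w : TangentSpace 𝓘(ℝ, E) x) :
    TangentSpace 𝓘(ℝ, E) x :=
  let U : ∀ y : M, TangentSpace 𝓘(ℝ, E) y := FiberBundle.extend E u
  let V : ∀ y : M, TangentSpace 𝓘(ℝ, E) y := FiberBundle.extend E v
  let W : ∀ y : M, TangentSpace 𝓘(ℝ, E) y := FiberBundle.extend E w
  nabla (fun y => nabla W y (V y)) x u - nabla (fun y => nabla W y (U y)) x v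
    - nabla W x (VectorField.mlieBracket 𝓘(ℝ, E) U V x)

variable [FiniteDimensional ℝ E] [CompleteSpace E]

/-- `nabla` is the Levi-Civita connection of the metric `g`: smooth, torsion-free and metric. -/
structure IsLeviCivita (g : ∀ x : M, TangentSpace 𝓘(ℝ, E) x → TangentSpace 𝓘(ℝ, E) x → ℝ)
    (nabla : LinearConnection E M) : Prop where
  smooth : CovariantDerivative.ContMDiffCovariantDerivative nabla ∞
  torsion_free : nabla.torsion = 0
  metric : ∀ (Y Z : ∀ x : M, TangentSpace 𝓘(ℝ, E) x) (x : M), DiffFieldAt Y x → DiffFieldAt Z x →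
    ∀ u : TangentSpace 𝓘(ℝ, E) x,
      mvfderiv 𝓘(ℝ, E) (fun y => g y (Y y) (Z y)) x u
        = g x (nabla Y x u) (Z x) + g x (Y x) (nabla Z x u)

/-- The basis of the tangent space at `x` given by a fixed basis of the model space. -/
def tangentBasis (x : M) :
    Module.Basis (Fin (Module.finrank ℝ E)) ℝ (TangentSpace 𝓘(ℝ, E) x) :=
  Module.finBasis ℝ E

/-- The Ricci tensor `Ric(u, v) = tr (w ↦ R(w, u) v)`. -/
def ricci (nabla : LinearConnection E M) (x : M) (u v : TangentSpace 𝓘(ℝ, E) x) : ℝ :=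
  ∑ a, (tangentBasis x).repr (curvature nabla x (tangentBasis x a) u v) a

/-- The metric contraction `g^{ab} Ric_{ab}` over a real basis (the Riemannian scalar curvature). -/
def riemannianScalarCurvature
    (g : ∀ x : M, TangentSpace 𝓘(ℝ, E) x → TangentSpace 𝓘(ℝ, E) x → ℝ)
    (nabla : LinearConnection E M) (x : M) : ℝ :=
  Matrix.trace
    ((Matrix.of fun a b => g x (tangentBasis x a) (tangentBasis x b))⁻¹ *
      (Matrix.of fun a b => ricci nabla x (tangentBasis x a) (tangentBasis x b)))

end Connections

/-! ### Kähler manifolds -/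

section Kahler

variable {E : Type*} [NormedAddCommGroup E] [NormedSpace ℝ E]
  {M : Type*} [TopologicalSpace M] [ChartedSpace E M] [IsManifold 𝓘(ℝ, E) ∞ M]

/-- `J` is an integrable complex structure on `M`: a smooth field of endomorphisms with `J² = -1`
and vanishing Nijenhuis tensor. -/
structure IsComplexStructure
    (J : ∀ x : M, TangentSpace 𝓘(ℝ, E) x →L[ℝ] TangentSpace 𝓘(ℝ, E) x) : Prop where
  smooth : ∀ U : Set M, IsOpen U → ∀ X : ∀ x : M, TangentSpace 𝓘(ℝ, E) x,
    SmoothFieldOn X U → SmoothFieldOn (fun x => J x (X x)) U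
  sq : ∀ (x : M) (u : TangentSpace 𝓘(ℝ, E) x), J x (J x u) = -u
  nijenhuis : ∀ U : Set M, IsOpen U → ∀ X Y : ∀ x : M, TangentSpace 𝓘(ℝ, E) x,
    SmoothFieldOn X U → SmoothFieldOn Y U → ∀ x ∈ U,
      VectorField.mlieBracket 𝓘(ℝ, E) (fun y => J y (X y)) (fun y => J y (Y y)) x
        = VectorField.mlieBracket 𝓘(ℝ, E) X Y x
          + J x (VectorField.mlieBracket 𝓘(ℝ, E) (fun y => J y (X y)) Y x
            + VectorField.mlieBracket 𝓘(ℝ, E) X (fun y => J y (Y y)) x)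

/-- `(M, J, omega)` is a Kähler manifold with Kähler form `omega`: the form `omega` is smooth, closed and
`J`-invariant, and `omega(·, J ·)` is positive definite. -/
structure IsKahler
    (J : ∀ x : M, TangentSpace 𝓘(ℝ, E) x →L[ℝ] TangentSpace 𝓘(ℝ, E) x)
    (omega : DiffForm E M 2) : Prop where
  complex : IsComplexStructure J
  smooth : omega.SmoothOn univ
  closed : omega.d = 0
  invariant : ∀ (x : M) (u v : TangentSpace 𝓘(ℝ, E) x), omega x ![J x u, J x v] = omega x ![u, v]
  pos : ∀ (x : M) (u : TangentSpace 𝓘(ℝ, E) x), u ≠ 0 → 0 < omega x ![u, J x u]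

/-- The Kähler metric `g = omega(·, J ·)`; in holomorphic coordinates `omega = i g_{αβ̄} dz^α ∧ dz̄^β`. -/
def kahlerMetric (J : ∀ x : M, TangentSpace 𝓘(ℝ, E) x →L[ℝ] TangentSpace 𝓘(ℝ, E) x)
    (omega : DiffForm E M 2) (x : M) (u v : TangentSpace 𝓘(ℝ, E) x) : ℝ :=
  omega x ![u, J x v]

/-- The scalar curvature `S(omega) = g^{ρσ̄} Ric_{ρσ̄}` of a Kähler manifold whose Levi-Civita connection
is `nabla`. The contraction over a frame of type `(1, 0)` is half the contraction over a real
frame: for `Z = (e - i J e) / √2` one has `Ric(Z, Z̄) = (Ric(e, e) + Ric(J e, J e)) / 2`. -/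
def kahlerScalarCurvature [FiniteDimensional ℝ E]
    (J : ∀ x : M, TangentSpace 𝓘(ℝ, E) x →L[ℝ] TangentSpace 𝓘(ℝ, E) x)
    (omega : DiffForm E M 2) (nabla : LinearConnection E M) (x : M) : ℝ :=
  riemannianScalarCurvature (kahlerMetric J omega) nabla x / 2

end Kahler

/-! ### CR structures and pseudohermitian manifolds -/

section CR

variable {F : Type*} [NormedAddCommGroup F] [NormedSpace ℝ F]
  {X : Type*} [TopologicalSpace X] [ChartedSpace F X]

variable (F X) in
/-- A field of linear subspaces of the tangent spaces. -/
abbrev TangentDistribution : Type _ := ∀ q : X, Submodule ℝ (TangentSpace 𝓘(ℝ, F) q)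

/-- A field of endomorphisms of the distribution `H`. -/
abbrev EndField (H : TangentDistribution F X) : Type _ := ∀ q : X, H q →L[ℝ] H q

/-- The complex tangent vectors `T^{1,0} = {v - i J v | v ∈ H}` at `q`; a complex tangent vector `a + i b` is written
as the pair `(a, b)`. -/
def T10 (H : TangentDistribution F X) (J : EndField H) (q : X) :
    Set (TangentSpace 𝓘(ℝ, F) q × TangentSpace 𝓘(ℝ, F) q) :=
  {z | ∃ v : H q, z = ((v : TangentSpace 𝓘(ℝ, F) q), -(J q v : TangentSpace 𝓘(ℝ, F) q))}

/-- The complex bilinear extension of the Lie bracket to complex vector fields `A + i B`. -/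
def complexBracket
    (Z W : ∀ q : X, TangentSpace 𝓘(ℝ, F) q × TangentSpace 𝓘(ℝ, F) q) (q : X) :
    TangentSpace 𝓘(ℝ, F) q × TangentSpace 𝓘(ℝ, F) q :=
  (VectorField.mlieBracket 𝓘(ℝ, F) (fun y => (Z y).1) (fun y => (W y).1) q
      - VectorField.mlieBracket 𝓘(ℝ, F) (fun y => (Z y).2) (fun y => (W y).2) q,
    VectorField.mlieBracket 𝓘(ℝ, F) (fun y => (Z y).1) (fun y => (W y).2) q
      + VectorField.mlieBracket 𝓘(ℝ, F) (fun y => (Z y).2) (fun y => (W y).1) q)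

/-- `(H, J)` is a CR structure: `H` is a smooth subbundle of codimension one, `J` is a smooth almost
complex structure on `H`, and the sections of `T^{1,0}` are closed under the Lie bracket. -/
structure IsCRStructure [IsManifold 𝓘(ℝ, F) ∞ X] (H : TangentDistribution F X) (J : EndField H) : Prop where
  smooth_subbundle : ∀ q : X, ∃ U : Set X, IsOpen U ∧ q ∈ U ∧ ∃ α : OneForm F X,
    α.toDiffForm.SmoothOn U ∧ ∀ y ∈ U, α y ≠ 0 ∧ H y = (α y).ker
  smooth_J : ∀ U : Set X, IsOpen U → ∀ V : ∀ q : X, H q,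
    SmoothFieldOn (fun q => (V q : TangentSpace 𝓘(ℝ, F) q)) U →
      SmoothFieldOn (fun q => (J q (V q) : TangentSpace 𝓘(ℝ, F) q)) U
  sq : ∀ (q : X) (v : H q), J q (J q v) = -v
  integrable : ∀ U : Set X, IsOpen U →
    ∀ Z W : ∀ q : X, TangentSpace 𝓘(ℝ, F) q × TangentSpace 𝓘(ℝ, F) q,
      SmoothFieldOn (fun q => (Z q).1) U → SmoothFieldOn (fun q => (Z q).2) U →
      SmoothFieldOn (fun q => (W q).1) U → SmoothFieldOn (fun q => (W q).2) U →
      (∀ q ∈ U, Z q ∈ T10 H J q) → (∀ q ∈ U, W q ∈ T10 H J q) →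
        ∀ q ∈ U, complexBracket Z W q ∈ T10 H J q

/-- The Levi form `L_η = dη(·, J ·)` on `H`. -/
def leviForm (H : TangentDistribution F X) (J : EndField H) (η : OneForm F X) (q : X) (v w : H q) : ℝ :=
  η.d q ![(v : TangentSpace 𝓘(ℝ, F) q), (J q w : TangentSpace 𝓘(ℝ, F) q)]

/-- `(X, H, J, η)` is a pseudohermitian manifold: `(H, J)` is a CR structure and `η` is a smooth real
one-form annihilating exactly `H` whose Levi form is positive definite. -/
structure IsPseudohermitian [IsManifold 𝓘(ℝ, F) ∞ X] (H : TangentDistribution F X) (J : EndField H) (η : OneForm F X) : Prop where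
  cr : IsCRStructure H J
  smooth : η.toDiffForm.SmoothOn univ
  ne_zero : ∀ q : X, η q ≠ 0
  ker : ∀ q : X, (η q).ker = H q
  pos : ∀ (q : X) (v : H q), v ≠ 0 → 0 < leviForm H J η q v v

/-- `(X, H, J)` is a strongly pseudoconvex CR manifold: the Levi form is definite for some
one-form annihilating exactly `H`. (A form whose Levi form is negative definite may be replaced by
its negative.) -/
def IsStronglyPseudoconvexCR [IsManifold 𝓘(ℝ, F) ∞ X] (H : TangentDistribution F X) (J : EndField H) : Prop :=
  IsCRStructure H J ∧ ∃ η : OneForm F X, IsPseudohermitian H J η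

/-- `T` is the Reeb vector field of `η`: `η(T) = 1` and `dη(T, ·) = 0`. -/
structure IsReebField [IsManifold 𝓘(ℝ, F) ∞ X] (η : OneForm F X) (T : ∀ q : X, TangentSpace 𝓘(ℝ, F) q) : Prop where
  smooth : SmoothFieldOn T univ
  apply_self : ∀ q : X, η q (T q) = 1
  contract : ∀ (q : X) (v : TangentSpace 𝓘(ℝ, F) q), η.d q ![T q, v] = 0

/-- `nabla` is the Tanaka-Webster connection of the pseudohermitian manifold `(X, H, J, η)` with
Reeb field `T`. With `∇ Z_α = ω_α^β ⊗ Z_β`, `∇ T = 0` for a frame `Z_α` of `T^{1,0}` dual to an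
admissible coframe `θ^α`, the condition `d h_{αβ̄} = ω_{αβ̄} + ω_{β̄α}` is `metric`, and the relations
`dη = i h_{αβ̄} θ^α ∧ θ^β̄`, `dθ^β = θ^α ∧ ω_α^β + η ∧ τ^β` with `τ^β` of type `(0, 1)` say that the
torsion tensor is `dη ⊗ T` on `H` and that `Tor(T, ·)` maps `H` to `H` and anticommutes with `J`. -/
structure IsTanakaWebster [IsManifold 𝓘(ℝ, F) ∞ X] [FiniteDimensional ℝ F] [CompleteSpace F]
    (H : TangentDistribution F X) (J : EndField H) (η : OneForm F X)
    (T : ∀ q : X, TangentSpace 𝓘(ℝ, F) q) (nabla : LinearConnection F X) : Prop where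
  smooth : CovariantDerivative.ContMDiffCovariantDerivative nabla ∞
  preserves : ∀ (Y : ∀ q : X, H q) (q : X),
    DiffFieldAt (fun y => (Y y : TangentSpace 𝓘(ℝ, F) y)) q →
      ∀ u : TangentSpace 𝓘(ℝ, F) q, nabla (fun y => (Y y : TangentSpace 𝓘(ℝ, F) y)) q u ∈ H q
  parallel_J : ∀ (Y : ∀ q : X, H q) (q : X)
    (hY : DiffFieldAt (fun y => (Y y : TangentSpace 𝓘(ℝ, F) y)) q)
    (u : TangentSpace 𝓘(ℝ, F) q),
      nabla (fun y => (J y (Y y) : TangentSpace 𝓘(ℝ, F) y)) q u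
        = J q ⟨nabla (fun y => (Y y : TangentSpace 𝓘(ℝ, F) y)) q u, preserves Y q hY u⟩
  parallel_T : ∀ (q : X) (u : TangentSpace 𝓘(ℝ, F) q), nabla T q u = 0
  metric : ∀ (Y Z : ∀ q : X, H q) (q : X)
    (hY : DiffFieldAt (fun y => (Y y : TangentSpace 𝓘(ℝ, F) y)) q)
    (hZ : DiffFieldAt (fun y => (Z y : TangentSpace 𝓘(ℝ, F) y)) q)
    (u : TangentSpace 𝓘(ℝ, F) q),
      mvfderiv 𝓘(ℝ, F) (fun y => leviForm H J η y (Y y) (Z y)) q u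
        = leviForm H J η q ⟨nabla (fun y => (Y y : TangentSpace 𝓘(ℝ, F) y)) q u,
              preserves Y q hY u⟩ (Z q)
          + leviForm H J η q (Y q) ⟨nabla (fun y => (Z y : TangentSpace 𝓘(ℝ, F) y)) q u,
              preserves Z q hZ u⟩
  torsion_H : ∀ (q : X) (u v : H q),
    nabla.torsion q (u : TangentSpace 𝓘(ℝ, F) q) (v : TangentSpace 𝓘(ℝ, F) q)
      = η.d q ![(u : TangentSpace 𝓘(ℝ, F) q), (v : TangentSpace 𝓘(ℝ, F) q)] • T q
  torsion_T : ∀ (q : X) (u : H q),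
    ∃ h : nabla.torsion q (T q) (u : TangentSpace 𝓘(ℝ, F) q) ∈ H q,
      nabla.torsion q (T q) (J q u : TangentSpace 𝓘(ℝ, F) q)
        = -(J q ⟨nabla.torsion q (T q) (u : TangentSpace 𝓘(ℝ, F) q), h⟩ :
            TangentSpace 𝓘(ℝ, F) q)

/-- The complex bilinear extension of a real bilinear `B`, evaluated at `z.1 + i z.2` and
`w.1 + i w.2`. -/
def complexExtend {V : Type*} (B : V → V → ℂ) (z w : V × V) : ℂ :=
  B z.1 w.1 - B z.2 w.2 + Complex.I * (B z.1 w.2 + B z.2 w.1)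

/-- An admissible coframe `(θ^α)` at the point `q`, as a real linear map to `ℂⁿ`, together with the
vectors `e_α` of `H` for which the frame `Z_α = (e_α - i J e_α) / 2` of `T^{1,0}` is dual to it: each
`θ^α` is of type `(1, 0)`, vanishes on `T`, and `(θ^α)` restricts to a basis on `T^{1,0}`. -/
structure IsAdmissibleCoframeAt {n : ℕ} (H : TangentDistribution F X) (J : EndField H)
    (T : ∀ q : X, TangentSpace 𝓘(ℝ, F) q) (q : X) (e : Fin n → H q)
    (coframe : TangentSpace 𝓘(ℝ, F) q →ₗ[ℝ] (Fin n → ℂ)) : Prop where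
  map_T : coframe (T q) = 0
  map_J : ∀ v : H q, coframe (J q v : TangentSpace 𝓘(ℝ, F) q)
    = Complex.I • coframe (v : TangentSpace 𝓘(ℝ, F) q)
  injective : ∀ v : H q, coframe (v : TangentSpace 𝓘(ℝ, F) q) = 0 → v = 0
  dual : ∀ α : Fin n, coframe (e α : TangentSpace 𝓘(ℝ, F) q) = Pi.single α 1

/-- The vector `Z_α = (e_α - i J e_α) / 2` of `T^{1,0}`, as a pair (real part, imaginary part). -/
def frameZ {n : ℕ} {H : TangentDistribution F X} (J : EndField H) {q : X} (e : Fin n → H q)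
    (α : Fin n) : H q × H q :=
  ((1 / 2 : ℝ) • e α, -((1 / 2 : ℝ) • J q (e α)))

/-- The complex conjugate `Z_ᾱ = (e_α + i J e_α) / 2` of `Z_α`. -/
def frameZbar {n : ℕ} {H : TangentDistribution F X} (J : EndField H) {q : X} (e : Fin n → H q)
    (α : Fin n) : H q × H q :=
  ((1 / 2 : ℝ) • e α, (1 / 2 : ℝ) • J q (e α))

/-- The matrix `h_{αβ̄} = L_η(Z_α, Z_β̄)`, so that `dη = i h_{αβ̄} θ^α ∧ θ^β̄`. -/
def leviMatrix {n : ℕ} (H : TangentDistribution F X) (J : EndField H) (η : OneForm F X) {q : X}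
    (e : Fin n → H q) : Matrix (Fin n) (Fin n) ℂ :=
  Matrix.of fun α β =>
    complexExtend (fun v w => (leviForm H J η q v w : ℂ)) (frameZ J e α) (frameZbar J e β)

/-- The value `Ω_α^β(u, v)` of the curvature forms on real vectors: the `β`-th component of
`R(u, v) Z_α`. -/
def curvatureForm [IsManifold 𝓘(ℝ, F) ∞ X] {n : ℕ} {H : TangentDistribution F X} (J : EndField H) (nabla : LinearConnection F X)
    {q : X} (e : Fin n → H q) (coframe : TangentSpace 𝓘(ℝ, F) q →ₗ[ℝ] (Fin n → ℂ))
    (α β : Fin n) (u v : TangentSpace 𝓘(ℝ, F) q) : ℂ :=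
  coframe (curvature nabla q u v ((frameZ J e α).1 : TangentSpace 𝓘(ℝ, F) q)) β
    + Complex.I * coframe (curvature nabla q u v ((frameZ J e α).2 : TangentSpace 𝓘(ℝ, F) q)) β

/-- The pseudohermitian Ricci tensor `R_{ρσ̄} = R_α^α_{ρσ̄}`, where
`R_α^β_{ρσ̄} = Ω_α^β(Z_ρ, Z_σ̄)` are the coefficients of the `(1, 1)`-part of the curvature forms. -/
def pseudohermitianRicci [IsManifold 𝓘(ℝ, F) ∞ X] {n : ℕ} {H : TangentDistribution F X} (J : EndField H)
    (nabla : LinearConnection F X) {q : X} (e : Fin n → H q)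
    (coframe : TangentSpace 𝓘(ℝ, F) q →ₗ[ℝ] (Fin n → ℂ)) : Matrix (Fin n) (Fin n) ℂ :=
  Matrix.of fun ρ σ => ∑ α, complexExtend
    (fun v w : H q => curvatureForm J nabla e coframe α α
      (v : TangentSpace 𝓘(ℝ, F) q) (w : TangentSpace 𝓘(ℝ, F) q))
    (frameZ J e ρ) (frameZbar J e σ)

/-- `s` is the pseudohermitian scalar curvature `R_ρ^ρ = h^{ρσ̄} R_{ρσ̄}` at `q` of
`(X, H, J, η)`, with Reeb field `T` and Tanaka-Webster connection `nabla`: admissible coframes with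
`n` members exist at `q`, and the contraction has the value `s` in each of them. -/
def IsPseudohermitianScalarCurvatureAt [IsManifold 𝓘(ℝ, F) ∞ X] (n : ℕ) (H : TangentDistribution F X) (J : EndField H)
    (η : OneForm F X) (T : ∀ q : X, TangentSpace 𝓘(ℝ, F) q) (nabla : LinearConnection F X)
    (q : X) (s : ℝ) : Prop :=
  (∃ (e : Fin n → H q) (coframe : TangentSpace 𝓘(ℝ, F) q →ₗ[ℝ] (Fin n → ℂ)),
    IsAdmissibleCoframeAt H J T q e coframe) ∧
  ∀ (e : Fin n → H q) (coframe : TangentSpace 𝓘(ℝ, F) q →ₗ[ℝ] (Fin n → ℂ)),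
    IsAdmissibleCoframeAt H J T q e coframe →
      ∑ ρ, ∑ σ, (leviMatrix H J η e)⁻¹ σ ρ * pseudohermitianRicci J nabla e coframe ρ σ = (s : ℂ)

end CR

/-! ### Principal circle bundles -/

section CircleBundle

variable {E : Type*} [NormedAddCommGroup E] [NormedSpace ℝ E]
  {M : Type*} [TopologicalSpace M] [ChartedSpace E M]
  {F : Type*} [NormedAddCommGroup F] [NormedSpace ℝ F]
  {P : Type*} [TopologicalSpace P] [ChartedSpace F P] [MulAction Circle P]

/-- `p : P → M` is a smooth principal circle bundle. -/
structure IsPrincipalCircleBundle (p : P → M) : Prop where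
  smooth_action : ContMDiff ((𝓡 1).prod 𝓘(ℝ, F)) 𝓘(ℝ, F) ∞ (fun a : Circle × P => a.1 • a.2)
  smooth_proj : ContMDiff 𝓘(ℝ, F) 𝓘(ℝ, E) ∞ p
  proj_smul : ∀ (z : Circle) (q : P), p (z • q) = p q
  locally_trivial : ∀ x : M, ∃ t : Bundle.Trivialization Circle p, x ∈ t.baseSet ∧
    ContMDiffOn 𝓘(ℝ, F) (𝓘(ℝ, E).prod (𝓡 1)) ∞ t t.source ∧
    ContMDiffOn (𝓘(ℝ, E).prod (𝓡 1)) 𝓘(ℝ, F) ∞ t.toOpenPartialHomeomorph.symm t.target ∧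
    ∀ (z : Circle) (q : P), q ∈ t.source → t (z • q) = (p q, z * (t q).2)

/-- `θ` is a real-valued principal connection: a smooth invariant one-form with value `1` on the
fundamental vector field `d/dt (exp(it) • q)`. -/
structure IsPrincipalConnection (θ : OneForm F P) : Prop where
  smooth : θ.toDiffForm.SmoothOn univ
  invariant : ∀ (z : Circle) (q : P) (v : TangentSpace 𝓘(ℝ, F) q),
    θ (z • q) (mfderiv 𝓘(ℝ, F) 𝓘(ℝ, F) (fun y : P => z • y) q v) = θ q v
  fundamental : ∀ q : P,
    θ (Circle.exp 0 • q)
      (mfderiv 𝓘(ℝ, ℝ) 𝓘(ℝ, F) (fun t : ℝ => Circle.exp t • q) 0 (1 : ℝ)) = 1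

/-- The horizontal distribution `H = Ker θ`. -/
def horizontal (θ : OneForm F P) : TangentDistribution F P := fun q => (θ q).ker

variable (E) in
/-- The restriction of the differential of `p` to `H = Ker θ`. -/
def horizontalProj (p : P → M) (θ : OneForm F P) (q : P) :
    horizontal θ q →L[ℝ] TangentSpace 𝓘(ℝ, E) (p q) :=
  (mfderiv 𝓘(ℝ, F) 𝓘(ℝ, E) p q).comp (horizontal θ q).subtypeL

/-- The horizontal lift of tangent vectors, inverse to `horizontalProj`. -/
def horizontalLift (p : P → M) (θ : OneForm F P) (q : P) :
    TangentSpace 𝓘(ℝ, E) (p q) →L[ℝ] horizontal θ q :=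
  (horizontalProj E p θ q).inverse

/-- The lifted almost complex structure `p^* J : H → H`. -/
def liftedJ (p : P → M) (θ : OneForm F P)
    (J : ∀ x : M, TangentSpace 𝓘(ℝ, E) x →L[ℝ] TangentSpace 𝓘(ℝ, E) x) :
    EndField (horizontal θ) := fun q =>
  (horizontalLift p θ q).comp ((J (p q)).comp (horizontalProj E p θ q))

/-- On `H = Ker θ`, identified with the pullback bundle `p^* TM` by the differential of `p`, the
connection `nabla` is the pullback of the connection `nablaM` of `M`: one has
`∇_v (Y ∘ p) = ∇^M_{p_* v} Y` for all vector fields `Y` on `M` and all tangent vectors `v`. -/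
def IsPullbackConnection [IsManifold 𝓘(ℝ, E) ∞ M] [IsManifold 𝓘(ℝ, F) ∞ P]
    (p : P → M) (θ : OneForm F P)
    (nablaM : LinearConnection E M) (nabla : LinearConnection F P) : Prop :=
  ∀ (Y : ∀ x : M, TangentSpace 𝓘(ℝ, E) x) (q : P), DiffFieldAt Y (p q) →
    ∀ v : TangentSpace 𝓘(ℝ, F) q,
      nabla (fun y => (horizontalLift p θ y (Y (p y)) : TangentSpace 𝓘(ℝ, F) y)) q v
        = (horizontalLift p θ q (nablaM Y (p q) (mfderiv 𝓘(ℝ, F) 𝓘(ℝ, E) p q v)) :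
            TangentSpace 𝓘(ℝ, F) q)

end CircleBundle

end

/-! Put `η = θ/2π`. The curvature hypothesis becomes `dη = p^*ω`, so everything on `P` is pulled
back from `M` except one vertical direction. The pair `(p_*, η)` identifies each tangent space of
`P` with `T_{p(q)}M ⊕ ℝ`; `IsSplitting` records this, with the horizontal lift and the vertical
field `T` normalised by `η(T) = 1`. The later geometry uses the bundle only through this splitting
and `dη = p^*ω`. Brackets on `P` are controlled by two facts: related fields have related brackets
(`mfderiv_mlieBracket_of_related`), and `η([X, Y]) = -dη(X, Y)` when `η(X)` and `η(Y)` are locally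
constant (`IsSplitting.form_mlieBracket`).

CR structure. The Levi form of `η` is the Kähler metric read through `p_*`, hence positive. The
Nijenhuis tensor of the lifted `J` projects to that of `J`, which is zero, and its vertical part is
accounted for by the `J`-invariance of `ω` (`IsSplitting.nijenhuisTensor_liftEnd`). The field `T` is
the Reeb field because `p^*ω` kills vertical vectors, and it is the only one because `ω` is
nondegenerate.

Tanaka-Webster connection. Pull the Levi-Civita connection back to `H` and declare `T` parallel. The
result is metric and preserves the lifted `J` because the Levi-Civita connection of a Kähler metric
preserves `J`; this is derived from `dω = 0` and integrability (`nablaJ_eq_zero`). Its torsion is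
`dη ⊗ T` on `H`, and `Tor(T, ·)` vanishes there. Uniqueness on horizontal lifts
(`IsHorizontalCR.apply_lift`) is a Koszul-type argument for the difference tensor, plus the remark
that an endomorphism which both commutes and anticommutes with `J` is zero.

Scalar curvature. On horizontal vectors the curvature of the connection is the lift of the curvature
of `M` (`IsSplitting.curvature_lift`), so the claim becomes linear algebra of Kähler curvature
tensors (`IsKahlerCurvature.contraction`). The complex trace of `R(u, v)` is `i Ric(u, J v)`, so
raising an index of `R_{ρσ̄}` gives the complex matrix of the Ricci endomorphism, whose complex
trace is half of its real trace. -/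

set_option linter.unusedSectionVars false

noncomputable section

/-! ### Calculus in the preferred chart -/

section ChartCalculus

open VectorField

variable {E : Type*} [NormedAddCommGroup E] [NormedSpace ℝ E]
  {M : Type*} [TopologicalSpace M] [ChartedSpace E M]

/-- The derivative of the inverse of the preferred chart at `c`. -/
def chartSymmDeriv (c : M) (y : E) :
    E →L[ℝ] TangentSpace 𝓘(ℝ, E) ((extChartAt 𝓘(ℝ, E) c).symm y) :=
  (mfderiv 𝓘(ℝ, E) 𝓘(ℝ, E) (extChartAt 𝓘(ℝ, E) c).symm y).comp
    ((NormedSpace.fromTangentSpace (𝕜 := ℝ) y).symm : E →L[ℝ] TangentSpace 𝓘(ℝ, E) y)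

/-- The vector field `X` read in the preferred chart at `c`. -/
def fieldInChart (c : M) (X : ∀ x : M, TangentSpace 𝓘(ℝ, E) x) (y : E) : E :=
  (chartSymmDeriv c y).inverse (X ((extChartAt 𝓘(ℝ, E) c).symm y))

lemma chart_symm_chart (x : M) : (extChartAt 𝓘(ℝ, E) x).symm (extChartAt 𝓘(ℝ, E) x x) = x :=
  extChartAt_to_inv x

lemma eventually_mem_chart_target (x : M) :
    ∀ᶠ y in 𝓝 (extChartAt 𝓘(ℝ, E) x x), y ∈ (extChartAt 𝓘(ℝ, E) x).target :=
  extChartAt_target_mem_nhds x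

lemma tendsto_chart_symm (x : M) :
    Filter.Tendsto (extChartAt 𝓘(ℝ, E) x).symm (𝓝 (extChartAt 𝓘(ℝ, E) x x)) (𝓝 x) := by
  have := (continuousAt_extChartAt_symm (I := 𝓘(ℝ, E)) x).tendsto
  rwa [chart_symm_chart] at this

variable [IsManifold 𝓘(ℝ, E) ∞ M]

lemma isInvertible_chartSymmDeriv {c : M} {y : E} (hy : y ∈ (extChartAt 𝓘(ℝ, E) c).target) :
    (chartSymmDeriv c y).IsInvertible := by
  have := isInvertible_mfderivWithin_extChartAt_symm (I := 𝓘(ℝ, E)) (x := c) hy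
  simp only [modelWithCornersSelf_coe, range_id, mfderivWithin_univ] at this
  exact this

lemma mdifferentiableAt_chart_symm {c : M} {y : E} (hy : y ∈ (extChartAt 𝓘(ℝ, E) c).target) :
    MDifferentiableAt 𝓘(ℝ, E) 𝓘(ℝ, E) (extChartAt 𝓘(ℝ, E) c).symm y :=
  ((contMDiffOn_extChartAt_symm (n := 1) c).contMDiffAt
    ((isOpen_extChartAt_target c).mem_nhds hy)).mdifferentiableAt one_ne_zero

lemma chartSymmDeriv_fieldInChart {c : M} {y : E} (hy : y ∈ (extChartAt 𝓘(ℝ, E) c).target)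
    (X : ∀ x : M, TangentSpace 𝓘(ℝ, E) x) :
    chartSymmDeriv c y (fieldInChart c X y) = X ((extChartAt 𝓘(ℝ, E) c).symm y) :=
  (isInvertible_chartSymmDeriv hy).self_apply_inverse _

lemma differentiableAt_fieldInChart [CompleteSpace E] {x : M}
    {X : ∀ x : M, TangentSpace 𝓘(ℝ, E) x} (hX : DiffFieldAt X x) :
    DifferentiableAt ℝ (fieldInChart x X) (extChartAt 𝓘(ℝ, E) x x) := by
  have h := MDifferentiableWithinAt.differentiableWithinAt_mpullbackWithin_vectorField
    (s := univ) (I := 𝓘(ℝ, E)) (x := x) (V := X) hX.mdifferentiableWithinAt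
  simp only [preimage_univ, modelWithCornersSelf_coe, range_id, inter_self,
    mpullbackWithin_univ] at h
  exact (differentiableWithinAt_univ (𝕜 := ℝ)).1 h

/-- The bracket on a manifold is by definition the bracket of the chart readings, carried back by
the inverse of the derivative of the chart; applying that derivative undoes the last step. -/
lemma mvfderiv_chart_mlieBracket (X Y : ∀ x : M, TangentSpace 𝓘(ℝ, E) x) (x : M) :
    mvfderiv 𝓘(ℝ, E) (extChartAt 𝓘(ℝ, E) x) x (mlieBracket 𝓘(ℝ, E) X Y x)
      = lieBracket ℝ (fieldInChart x X) (fieldInChart x Y) (extChartAt 𝓘(ℝ, E) x x) := by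
  let w : E := lieBracket ℝ (fieldInChart x X) (fieldInChart x Y) (extChartAt 𝓘(ℝ, E) x x)
  have h1 := (isInvertible_mfderiv_extChartAt (I := 𝓘(ℝ, E))
    (mem_extChartAt_source (I := 𝓘(ℝ, E)) x)).self_apply_inverse w
  have h2 : mlieBracket 𝓘(ℝ, E) X Y x
      = (mfderiv 𝓘(ℝ, E) 𝓘(ℝ, E) (extChartAt 𝓘(ℝ, E) x) x).inverse w := by
    rw [← mlieBracketWithin_univ, mlieBracketWithin_apply]
    simp only [preimage_univ, modelWithCornersSelf_coe, range_id, inter_self,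
      mpullbackWithin_univ]
    have h3 : lieBracketWithin ℝ (fieldInChart x X) (fieldInChart x Y) univ
        (extChartAt 𝓘(ℝ, E) x x) = w := by rw [lieBracketWithin_univ]
    rw [← h3]
    rfl
  rw [h2]
  exact h1

lemma fieldInChart_chart (x : M) (X : ∀ x : M, TangentSpace 𝓘(ℝ, E) x) :
    fieldInChart x X (extChartAt 𝓘(ℝ, E) x x)
      = mvfderiv 𝓘(ℝ, E) (extChartAt 𝓘(ℝ, E) x) x (X x) := by
  have hy := mem_extChartAt_target (I := 𝓘(ℝ, E)) x
  have h1 := chartSymmDeriv_fieldInChart hy X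
  have h2 := mfderivWithin_extChartAt_symm_comp_mfderiv_extChartAt' (I := 𝓘(ℝ, E))
    (mem_extChartAt_source (I := 𝓘(ℝ, E)) x)
  simp only [modelWithCornersSelf_coe, range_id, mfderivWithin_univ] at h2
  have h3 := congr($h2 (X x))
  have hinj := (isInvertible_chartSymmDeriv hy).injective
  apply hinj
  rw [h1]
  -- The point obtained by going through the chart and back equals `x` only propositionally. The
  -- cast between the two tangent spaces is harmless because both are the model space.
  have h4 : ∀ z (hz : z = x), X z = cast (by rw [hz]) (X x) := by
    rintro z rfl; rfl
  refine Eq.trans ?_ h3.symm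
  simp only [ContinuousLinearMap.id_apply]
  rw [h4 _ (chart_symm_chart x)]
  exact eq_of_heq (cast_heq _ _)

variable {G : Type*} [NormedAddCommGroup G] [NormedSpace ℝ G]

/-- The chain rule for the inverse chart, whose derivative carries the chart reading of a field to
the field. It turns every derivative `X f` into a Fréchet derivative on the model space. -/
lemma fderiv_comp_chart_symm {c : M} {y : E} (hy : y ∈ (extChartAt 𝓘(ℝ, E) c).target) {f : M → G}
    (hf : MDifferentiableAt 𝓘(ℝ, E) 𝓘(ℝ, G) f ((extChartAt 𝓘(ℝ, E) c).symm y))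
    (X : ∀ x : M, TangentSpace 𝓘(ℝ, E) x) :
    fderiv ℝ (f ∘ (extChartAt 𝓘(ℝ, E) c).symm) y (fieldInChart c X y)
      = mvfderiv 𝓘(ℝ, E) f ((extChartAt 𝓘(ℝ, E) c).symm y)
          (X ((extChartAt 𝓘(ℝ, E) c).symm y)) := by
  rw [← chartSymmDeriv_fieldInChart hy X]
  have h1 := congr($(mfderiv_comp y hf (mdifferentiableAt_chart_symm hy))
    ((NormedSpace.fromTangentSpace (𝕜 := ℝ) y).symm (fieldInChart c X y)))
  rw [mfderiv_eq_fderiv] at h1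
  exact h1

lemma fderiv_comp_chart_symm_self {x : M} {f : M → G}
    (hf : MDifferentiableAt 𝓘(ℝ, E) 𝓘(ℝ, G) f x) (X : ∀ x : M, TangentSpace 𝓘(ℝ, E) x) :
    fderiv ℝ (f ∘ (extChartAt 𝓘(ℝ, E) x).symm) (extChartAt 𝓘(ℝ, E) x x)
      (fieldInChart x X (extChartAt 𝓘(ℝ, E) x x)) = mvfderiv 𝓘(ℝ, E) f x (X x) := by
  have := fderiv_comp_chart_symm (mem_extChartAt_target (I := 𝓘(ℝ, E)) x) (f := f)
    (by rwa [chart_symm_chart]) X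
  rw [this, chart_symm_chart]

lemma mdifferentiableAt_of_comp_chart_symm {x : M} {f : M → G} {f' : E → G}
    (hf' : DifferentiableAt ℝ f' (extChartAt 𝓘(ℝ, E) x x))
    (h : f ∘ (extChartAt 𝓘(ℝ, E) x).symm =ᶠ[𝓝 (extChartAt 𝓘(ℝ, E) x x)] f') :
    MDifferentiableAt 𝓘(ℝ, E) 𝓘(ℝ, G) f x := by
  have h2 := hf'.congr_of_eventuallyEq h
  have h3 : MDifferentiableAt 𝓘(ℝ, E) 𝓘(ℝ, G)
      ((f ∘ (extChartAt 𝓘(ℝ, E) x).symm) ∘ (extChartAt 𝓘(ℝ, E) x)) x :=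
    MDifferentiableAt.comp x h2.mdifferentiableAt
      (mdifferentiableAt_extChartAt (mem_chart_source E x))
  refine h3.congr_of_eventuallyEq ?_
  filter_upwards [extChartAt_source_mem_nhds (I := 𝓘(ℝ, E)) x] with y hy
  simp only [Function.comp_apply]
  rw [(extChartAt 𝓘(ℝ, E) x).left_inv hy]

lemma ContMDiffAt.eventually_mdifferentiableAt {x : M} {f : M → G}
    (hf : ContMDiffAt 𝓘(ℝ, E) 𝓘(ℝ, G) 1 f x) :
    ∀ᶠ y in 𝓝 x, MDifferentiableAt 𝓘(ℝ, E) 𝓘(ℝ, G) f y := by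
  filter_upwards [(contMDiffAt_iff_contMDiffAt_nhds (by simp)).1 hf] with y hy
  exact hy.mdifferentiableAt one_ne_zero

/-- The Lie bracket acts on functions as the commutator of derivations. -/
lemma mvfderiv_mlieBracket [CompleteSpace E] {x : M} {X Y : ∀ x : M, TangentSpace 𝓘(ℝ, E) x}
    (hX : DiffFieldAt X x) (hY : DiffFieldAt Y x) {f : M → G}
    (hf : ContMDiffAt 𝓘(ℝ, E) 𝓘(ℝ, G) 2 f x) :
    mvfderiv 𝓘(ℝ, E) f x (mlieBracket 𝓘(ℝ, E) X Y x)
      = mvfderiv 𝓘(ℝ, E) (fun y => mvfderiv 𝓘(ℝ, E) f y (Y y)) x (X x)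
        - mvfderiv 𝓘(ℝ, E) (fun y => mvfderiv 𝓘(ℝ, E) f y (X y)) x (Y x) := by
  set φ := extChartAt 𝓘(ℝ, E) x
  set f' : E → G := f ∘ φ.symm
  have hf' : ContDiffAt ℝ 2 f' (φ x) := by
    rw [← contMDiffAt_iff_contDiffAt]
    refine ContMDiffAt.comp (φ x) (I' := 𝓘(ℝ, E)) (g := f) ?_
      ((contMDiffOn_extChartAt_symm (n := 2) x).contMDiffAt
        (extChartAt_target_mem_nhds x))
    rwa [chart_symm_chart]
  have hd : DifferentiableAt ℝ (fderiv ℝ f') (φ x) :=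
    (hf'.fderiv_right (m := 1) (by norm_num)).differentiableAt one_ne_zero
  have hsymm := hf'.isSymmSndFDerivAt (by simp)
  have hev := (hf.of_le one_le_two).eventually_mdifferentiableAt
  have key : ∀ Z : ∀ x : M, TangentSpace 𝓘(ℝ, E) x, DiffFieldAt Z x →
      ((fun y => mvfderiv 𝓘(ℝ, E) f y (Z y)) ∘ φ.symm)
        =ᶠ[𝓝 (φ x)] fun y => fderiv ℝ f' y (fieldInChart x Z y) := by
    intro Z hZ
    filter_upwards [eventually_mem_chart_target x, (tendsto_chart_symm x).eventually hev]
      with y hy hfy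
    rw [fderiv_comp_chart_symm hy hfy Z]
    rfl
  have keyd : ∀ Z : ∀ x : M, TangentSpace 𝓘(ℝ, E) x, DiffFieldAt Z x →
      MDifferentiableAt 𝓘(ℝ, E) 𝓘(ℝ, G) (fun y => mvfderiv 𝓘(ℝ, E) f y (Z y)) x := fun Z hZ =>
    mdifferentiableAt_of_comp_chart_symm (hd.clm_apply (differentiableAt_fieldInChart hZ))
      (key Z hZ)
  -- In the chart, `W (Z f)` is a Hessian term plus `f'` applied to the derivative of `Z` along `W`.
  -- The Hessian terms cancel in the commutator by symmetry, and what is left is `f'` of the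
  -- bracket.
  have key2 : ∀ Z W : ∀ x : M, TangentSpace 𝓘(ℝ, E) x, DiffFieldAt Z x → DiffFieldAt W x →
      mvfderiv 𝓘(ℝ, E) (fun y => mvfderiv 𝓘(ℝ, E) f y (Z y)) x (W x)
        = fderiv ℝ f' (φ x)
            (fderiv ℝ (fieldInChart x Z) (φ x) (fieldInChart x W (φ x))) +
          fderiv ℝ (fderiv ℝ f') (φ x) (fieldInChart x W (φ x)) (fieldInChart x Z (φ x)) := by
    intro Z W hZ hW
    rw [← fderiv_comp_chart_symm_self (keyd Z hZ), (key Z hZ).fderiv_eq,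
      fderiv_clm_apply hd (differentiableAt_fieldInChart hZ)]
    rfl
  have key3 : mvfderiv 𝓘(ℝ, E) f x (mlieBracket 𝓘(ℝ, E) X Y x)
      = fderiv ℝ f' (φ x) (lieBracket ℝ (fieldInChart x X) (fieldInChart x Y) (φ x)) := by
    rw [← fderiv_comp_chart_symm_self (hf.mdifferentiableAt two_ne_zero), fieldInChart_chart,
      mvfderiv_chart_mlieBracket]
  rw [key2 Y X hY hX, key2 X Y hX hY, key3, hsymm]
  simp only [lieBracket, map_sub]
  abel

end ChartCalculus

lemma two_le_smooth : (2 : WithTop ℕ∞) ≤ ∞ :=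
  WithTop.coe_le_coe.2 (le_top : (2 : ℕ∞) ≤ ⊤)

/-- Evaluation is linear in the form and multilinear in the vectors, so it is one continuous
multilinear map with an extra slot for the form. Such maps are smooth. -/
lemma ContDiffAt.continuousAlternatingMap_apply {E F G ι : Type*} [NormedAddCommGroup E]
    [NormedSpace ℝ E] [NormedAddCommGroup F] [NormedSpace ℝ F] [NormedAddCommGroup G]
    [NormedSpace ℝ G] [Fintype ι] {m : WithTop ℕ∞} {f : E → F [⋀^ι]→L[ℝ] G} {g : ι → E → F} {x : E}
    (hf : ContDiffAt ℝ m f x) (hg : ∀ i, ContDiffAt ℝ m (g i) x) :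
    ContDiffAt ℝ m (fun y => f y (fun i => g i y)) x := by
  let L := ContinuousAlternatingMap.toContinuousMultilinearMapCLM (𝕜 := ℝ) (E := F) (F := G)
    (ι := ι) ℝ
  let B := L.continuousMultilinearMapOption
  have hB : ∀ y, f y (fun i => g i y) = B (fun _ => (f y, fun i => g i y)) := fun y =>
    (L.continuousMultilinearMapOption_apply_eq_self (f y) fun i => g i y).symm
  simp only [hB]
  exact B.contDiff.contDiffAt.comp x
    (contDiffAt_pi.2 fun _ => hf.prodMk (contDiffAt_pi.2 hg))

/-! ### Related vector fields and the exterior derivative evaluated on vector fields -/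

section FormCalculus

open VectorField

variable {E : Type*} [NormedAddCommGroup E] [NormedSpace ℝ E]
  {M : Type*} [TopologicalSpace M] [ChartedSpace E M] [IsManifold 𝓘(ℝ, E) ∞ M]
  {F : Type*} [NormedAddCommGroup F] [NormedSpace ℝ F]
  {P : Type*} [TopologicalSpace P] [ChartedSpace F P] [IsManifold 𝓘(ℝ, F) ∞ P]
  {G : Type*} [NormedAddCommGroup G] [NormedSpace ℝ G]

/-- The preferred trivialization of the tangent bundle is the derivative of the preferred chart.
This converts smoothness of a section, formulated in the trivialization, into smoothness of its
chart reading. -/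
lemma fieldInChart_chart_of_mem {c z : M} (hz : z ∈ (extChartAt 𝓘(ℝ, E) c).source)
    (X : ∀ x : M, TangentSpace 𝓘(ℝ, E) x) :
    fieldInChart c X (extChartAt 𝓘(ℝ, E) c z)
      = (trivializationAt E (TangentSpace 𝓘(ℝ, E)) c ⟨z, X z⟩).2 := by
  have hz' : z ∈ (chartAt E c).source := by simpa using hz
  have hy := (extChartAt 𝓘(ℝ, E) c).map_source hz
  have h1 := chartSymmDeriv_fieldInChart hy X
  have h2 := mfderivWithin_extChartAt_symm_comp_mfderiv_extChartAt' (I := 𝓘(ℝ, E)) hz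
  simp only [modelWithCornersSelf_coe, range_id, mfderivWithin_univ] at h2
  have h3 := congr($h2 (X z))
  have h5 := TangentBundle.continuousLinearMapAt_trivializationAt (I := 𝓘(ℝ, E)) hz'
  have h6 : (trivializationAt E (TangentSpace 𝓘(ℝ, E)) c ⟨z, X z⟩).2
      = Trivialization.continuousLinearMapAt ℝ
        (trivializationAt E (TangentSpace 𝓘(ℝ, E)) c) z (X z) := by
    rw [Trivialization.continuousLinearMapAt_apply, Trivialization.linearMapAt_apply, if_pos]
    exact hz'
  rw [h6, h5]
  apply (isInvertible_chartSymmDeriv hy).injective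
  rw [h1]
  have h4 : ∀ w (hw : w = z), X w = cast (by rw [hw]) (X z) := by
    rintro w rfl; rfl
  refine Eq.trans ?_ h3.symm
  simp only [ContinuousLinearMap.id_apply]
  rw [h4 _ ((extChartAt 𝓘(ℝ, E) c).left_inv hz)]
  exact eq_of_heq (cast_heq _ _)

lemma contDiffAt_fieldInChart {x : M} {X : ∀ x : M, TangentSpace 𝓘(ℝ, E) x} {k : ℕ∞}
    (hX : ContMDiffAt 𝓘(ℝ, E) 𝓘(ℝ, E).tangent k
      (fun y => (⟨y, X y⟩ : TangentBundle 𝓘(ℝ, E) M)) x) :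
    ContDiffAt ℝ k (fieldInChart x X) (extChartAt 𝓘(ℝ, E) x x) := by
  have h1 := (contMDiffAt_section x).1 hX
  rw [← contMDiffAt_iff_contDiffAt]
  have : IsManifold 𝓘(ℝ, E) k M := IsManifold.of_le (n := ∞) (mod_cast le_top)
  have h2 : ContMDiffAt 𝓘(ℝ, E) 𝓘(ℝ, E) k
      ((fun z => (trivializationAt E (TangentSpace 𝓘(ℝ, E)) x ⟨z, X z⟩).2) ∘
        (extChartAt 𝓘(ℝ, E) x).symm) (extChartAt 𝓘(ℝ, E) x x) := by
    refine ContMDiffAt.comp (extChartAt 𝓘(ℝ, E) x x) (I' := 𝓘(ℝ, E)) ?_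
      ((contMDiffOn_extChartAt_symm (n := k) x).contMDiffAt
        (extChartAt_target_mem_nhds x))
    rwa [chart_symm_chart]
  refine h2.congr_of_eventuallyEq ?_
  filter_upwards [eventually_mem_chart_target x] with y hy
  simp only [Function.comp_apply]
  rw [← fieldInChart_chart_of_mem ((extChartAt 𝓘(ℝ, E) x).map_target hy),
    (extChartAt 𝓘(ℝ, E) x).right_inv hy]

lemma contMDiffAt_of_comp_chart_symm {x : M} {f : M → G} {f' : E → G} {k : ℕ∞}
    (hf' : ContDiffAt ℝ k f' (extChartAt 𝓘(ℝ, E) x x))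
    (h : f ∘ (extChartAt 𝓘(ℝ, E) x).symm =ᶠ[𝓝 (extChartAt 𝓘(ℝ, E) x x)] f') :
    ContMDiffAt 𝓘(ℝ, E) 𝓘(ℝ, G) k f x := by
  have : IsManifold 𝓘(ℝ, E) k M := IsManifold.of_le (n := ∞) (mod_cast le_top)
  have h2 := hf'.congr_of_eventuallyEq h
  have h3 : ContMDiffAt 𝓘(ℝ, E) 𝓘(ℝ, G) k
      ((f ∘ (extChartAt 𝓘(ℝ, E) x).symm) ∘ (extChartAt 𝓘(ℝ, E) x)) x :=
    ContMDiffAt.comp x h2.contMDiffAt contMDiffAt_extChartAt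
  refine h3.congr_of_eventuallyEq ?_
  filter_upwards [extChartAt_source_mem_nhds (I := 𝓘(ℝ, E)) x] with y hy
  simp only [Function.comp_apply]
  rw [(extChartAt 𝓘(ℝ, E) x).left_inv hy]

lemma mdifferentiableAt_mvfderiv_apply [CompleteSpace E] {x : M}
    {Y : ∀ x : M, TangentSpace 𝓘(ℝ, E) x} (hY : DiffFieldAt Y x) {f : M → G}
    (hf : ContMDiffAt 𝓘(ℝ, E) 𝓘(ℝ, G) 2 f x) :
    MDifferentiableAt 𝓘(ℝ, E) 𝓘(ℝ, G) (fun y => mvfderiv 𝓘(ℝ, E) f y (Y y)) x := by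
  have hf' : ContDiffAt ℝ 2 (f ∘ (extChartAt 𝓘(ℝ, E) x).symm) (extChartAt 𝓘(ℝ, E) x x) := by
    rw [← contMDiffAt_iff_contDiffAt]
    refine ContMDiffAt.comp (extChartAt 𝓘(ℝ, E) x x) (I' := 𝓘(ℝ, E)) (g := f) ?_
      ((contMDiffOn_extChartAt_symm (n := 2) x).contMDiffAt
        (extChartAt_target_mem_nhds x))
    rwa [chart_symm_chart]
  have hd := (hf'.fderiv_right (m := 1) (by norm_num)).differentiableAt one_ne_zero
  refine mdifferentiableAt_of_comp_chart_symm (hd.clm_apply (differentiableAt_fieldInChart hY)) ?_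
  filter_upwards [eventually_mem_chart_target x, (tendsto_chart_symm x).eventually
    (hf.of_le one_le_two).eventually_mdifferentiableAt] with y hy hfy
  rw [fderiv_comp_chart_symm hy hfy Y]
  rfl

lemma mvfderiv_comp' {f : P → M} {h : M → G} {q : P}
    (hh : MDifferentiableAt 𝓘(ℝ, E) 𝓘(ℝ, G) h (f q))
    (hf : MDifferentiableAt 𝓘(ℝ, F) 𝓘(ℝ, E) f q) (v : TangentSpace 𝓘(ℝ, F) q) :
    mvfderiv 𝓘(ℝ, F) (fun y => h (f y)) q v
      = mvfderiv 𝓘(ℝ, E) h (f q) (mfderiv 𝓘(ℝ, F) 𝓘(ℝ, E) f q v) := by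
  have := congr($(mfderiv_comp q hh hf) v)
  exact this

lemma mvfderiv_congr {f g : M → G} {x : M} (h : f =ᶠ[𝓝 x] g) (v : TangentSpace 𝓘(ℝ, E) x) :
    mvfderiv 𝓘(ℝ, E) f x v = mvfderiv 𝓘(ℝ, E) g x v := by
  have := congr($(h.mfderiv_eq (I := 𝓘(ℝ, E)) (I' := 𝓘(ℝ, G))) v)
  exact this

/-- Brackets of related vector fields are related. -/
lemma mfderiv_mlieBracket_of_related [CompleteSpace E] [CompleteSpace F] {f : P → M} {q : P}
    (hf : ContMDiff 𝓘(ℝ, F) 𝓘(ℝ, E) ∞ f)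
    {X Y : ∀ x : M, TangentSpace 𝓘(ℝ, E) x} {X' Y' : ∀ y : P, TangentSpace 𝓘(ℝ, F) y}
    (hX : DiffFieldAt X (f q)) (hY : DiffFieldAt Y (f q))
    (hX' : DiffFieldAt X' q) (hY' : DiffFieldAt Y' q)
    (hXX' : ∀ᶠ y in 𝓝 q, mfderiv 𝓘(ℝ, F) 𝓘(ℝ, E) f y (X' y) = X (f y))
    (hYY' : ∀ᶠ y in 𝓝 q, mfderiv 𝓘(ℝ, F) 𝓘(ℝ, E) f y (Y' y) = Y (f y)) :
    mfderiv 𝓘(ℝ, F) 𝓘(ℝ, E) f q (mlieBracket 𝓘(ℝ, F) X' Y' q)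
      = mlieBracket 𝓘(ℝ, E) X Y (f q) := by
  -- A chart is a vector-valued function with injective derivative, so a tangent vector at `f q` is
  -- determined by its action on `ψ`. Both brackets are compared as commutators of derivations, one
  -- on `ψ` and the other on `ψ ∘ f`.
  set ψ := extChartAt 𝓘(ℝ, E) (f q)
  have hψ2 : ContMDiffAt 𝓘(ℝ, E) 𝓘(ℝ, E) 2 ψ (f q) := contMDiffAt_extChartAt
  have hfd : ∀ y, MDifferentiableAt 𝓘(ℝ, F) 𝓘(ℝ, E) f y := fun y =>
    (hf y).mdifferentiableAt (by simp)
  have hψf : ContMDiffAt 𝓘(ℝ, F) 𝓘(ℝ, E) 2 (fun y => ψ (f y)) q :=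
    hψ2.comp q ((hf q).of_le two_le_smooth)
  have hev : ∀ᶠ y in 𝓝 q, MDifferentiableAt 𝓘(ℝ, E) 𝓘(ℝ, E) ψ (f y) :=
    (hf q).continuousAt.eventually (hψ2.of_le one_le_two).eventually_mdifferentiableAt
  have key : ∀ (Z : ∀ x : M, TangentSpace 𝓘(ℝ, E) x) (Z' : ∀ y : P, TangentSpace 𝓘(ℝ, F) y),
      DiffFieldAt Z (f q) →
      (∀ᶠ y in 𝓝 q, mfderiv 𝓘(ℝ, F) 𝓘(ℝ, E) f y (Z' y) = Z (f y)) →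
      ∀ v, mvfderiv 𝓘(ℝ, F) (fun y => mvfderiv 𝓘(ℝ, F) (fun y => ψ (f y)) y (Z' y)) q v
        = mvfderiv 𝓘(ℝ, E) (fun x => mvfderiv 𝓘(ℝ, E) ψ x (Z x)) (f q)
          (mfderiv 𝓘(ℝ, F) 𝓘(ℝ, E) f q v) := by
    intro Z Z' hZ hZZ' v
    rw [← mvfderiv_comp' (mdifferentiableAt_mvfderiv_apply hZ hψ2) (hfd q)]
    have : (fun y => mvfderiv 𝓘(ℝ, F) (fun y => ψ (f y)) y (Z' y))
        =ᶠ[𝓝 q] fun y => mvfderiv 𝓘(ℝ, E) ψ (f y) (Z (f y)) := by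
      filter_upwards [hev, hZZ'] with y h1 h2
      rw [mvfderiv_comp' h1 (hfd y), h2]
    exact mvfderiv_congr this v
  have hinj : Function.Injective (mvfderiv 𝓘(ℝ, E) ψ (f q)) :=
    (isInvertible_mfderiv_extChartAt (I := 𝓘(ℝ, E)) (mem_extChartAt_source (f q))).injective
  apply hinj
  rw [mvfderiv_mlieBracket hX hY hψ2, ← mvfderiv_comp' hev.self_of_nhds (hfd q),
    mvfderiv_mlieBracket hX' hY' hψf, key Y Y' hY hYY', key X X' hX hXX',
    hXX'.self_of_nhds, hYY'.self_of_nhds]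

lemma DiffForm.inChart_fieldInChart {k : ℕ} (α : DiffForm E M k) {c : M} {y : E}
    (hy : y ∈ (extChartAt 𝓘(ℝ, E) c).target)
    (Z : Fin k → ∀ x : M, TangentSpace 𝓘(ℝ, E) x) :
    α.inChart c y (fun i => fieldInChart c (Z i) y)
      = α ((extChartAt 𝓘(ℝ, E) c).symm y) (fun i => Z i ((extChartAt 𝓘(ℝ, E) c).symm y)) := by
  change α _ (fun i => chartSymmDeriv c y (fieldInChart c (Z i) y)) = _
  simp only [chartSymmDeriv_fieldInChart hy]

lemma DiffForm.SmoothOn.contDiffAt {k : ℕ} {α : DiffForm E M k} (hα : α.SmoothOn univ) (x : M) :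
    ContDiffAt ℝ ∞ (α.inChart x) (extChartAt 𝓘(ℝ, E) x x) := by
  have := hα x
  simp only [preimage_univ, inter_univ] at this
  exact this.contDiffAt (extChartAt_target_mem_nhds x)

lemma DiffForm.apply_comp_chart_symm {k : ℕ} (α : DiffForm E M k) (x : M)
    (Z : Fin k → ∀ x : M, TangentSpace 𝓘(ℝ, E) x) :
    ((fun y => α y (fun i => Z i y)) ∘ (extChartAt 𝓘(ℝ, E) x).symm)
      =ᶠ[𝓝 (extChartAt 𝓘(ℝ, E) x x)]
        fun y => α.inChart x y (fun i => fieldInChart x (Z i) y) := by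
  filter_upwards [eventually_mem_chart_target x] with y hy
  rw [α.inChart_fieldInChart hy]
  rfl

lemma DiffForm.SmoothOn.mdifferentiableAt_apply [CompleteSpace E] {k : ℕ} {α : DiffForm E M k}
    (hα : α.SmoothOn univ) {x : M} {Z : Fin k → ∀ x : M, TangentSpace 𝓘(ℝ, E) x}
    (hZ : ∀ i, DiffFieldAt (Z i) x) :
    MDifferentiableAt 𝓘(ℝ, E) 𝓘(ℝ, ℝ) (fun y => α y (fun i => Z i y)) x := by
  refine mdifferentiableAt_of_comp_chart_symm ?_ (α.apply_comp_chart_symm x Z)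
  exact ((hα.contDiffAt x).differentiableAt (by simp)).continuousAlternatingMap_apply
    fun i => differentiableAt_fieldInChart (hZ i)

lemma DiffForm.SmoothOn.contMDiffAt_apply {k : ℕ} {α : DiffForm E M k}
    (hα : α.SmoothOn univ) {x : M} {Z : Fin k → ∀ x : M, TangentSpace 𝓘(ℝ, E) x} {m : ℕ∞}
    (hZ : ∀ i, ContMDiffAt 𝓘(ℝ, E) 𝓘(ℝ, E).tangent m
      (fun y => (⟨y, Z i y⟩ : TangentBundle 𝓘(ℝ, E) M)) x) :
    ContMDiffAt 𝓘(ℝ, E) 𝓘(ℝ, ℝ) m (fun y => α y (fun i => Z i y)) x := by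
  refine contMDiffAt_of_comp_chart_symm ?_ (α.apply_comp_chart_symm x Z)
  have h1 : ContDiffAt ℝ m (α.inChart x) (extChartAt 𝓘(ℝ, E) x x) :=
    (hα.contDiffAt x).of_le (by exact_mod_cast le_top)
  exact h1.continuousAlternatingMap_apply fun i => contDiffAt_fieldInChart (hZ i)

/-- The exterior derivative in terms of vector fields. -/
lemma DiffForm.SmoothOn.d_apply [CompleteSpace E] {k : ℕ} {α : DiffForm E M (k + 1)}
    (hα : α.SmoothOn univ) {x : M} {V : Fin (k + 2) → ∀ x : M, TangentSpace 𝓘(ℝ, E) x}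
    (hV : ∀ i, DiffFieldAt (V i) x) :
    α.d x (fun i => V i x) =
      (∑ i, (-1) ^ i.val • mvfderiv 𝓘(ℝ, E) (fun y => α y (i.removeNth (fun j => V j y))) x (V i x))
      - ∑ i : Fin (k + 1), ∑ j ≥ i, (-1) ^ (i + j : ℕ) •
          α x (Matrix.vecCons (mlieBracket 𝓘(ℝ, E) (V i.castSucc) (V j.succ) x)
            (j.removeNth <| i.castSucc.removeNth (fun j => V j x))) := by
  have h1 := extDeriv_apply_vectorField
    (V := fun i => fieldInChart x (V i)) ((hα.contDiffAt x).differentiableAt (by simp))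
    fun i => differentiableAt_fieldInChart (hV i)
  have h2 : α.d x (fun i => V i x) = extDeriv (α.inChart x) (extChartAt 𝓘(ℝ, E) x x)
      (fun i => fieldInChart x (V i) (extChartAt 𝓘(ℝ, E) x x)) := by
    simp only [fieldInChart_chart]
    rfl
  rw [h2, h1]
  congr 1
  · refine Finset.sum_congr rfl fun i _ => ?_
    congr 1
    rw [← fderiv_comp_chart_symm_self]
    · congr 1
      exact (Filter.EventuallyEq.fderiv_eq
        (α.apply_comp_chart_symm x (fun j => V (i.succAbove j)))).symm
    · exact hα.mdifferentiableAt_apply fun j => hV (i.succAbove j)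
  · refine Finset.sum_congr rfl fun i _ => Finset.sum_congr rfl fun j _ => ?_
    congr 1
    -- The formula on the model space contains brackets of chart readings; at the centre of the
    -- chart these are the chart readings of the brackets on `M`.
    have h3 := α.inChart_fieldInChart (mem_extChartAt_target (I := 𝓘(ℝ, E)) x)
      (Matrix.vecCons (mlieBracket 𝓘(ℝ, E) (V i.castSucc) (V j.succ))
        (j.removeNth <| i.castSucc.removeNth V))
    rw [chart_symm_chart] at h3
    convert h3 using 2
    · funext l
      refine Fin.cases ?_ (fun l => ?_) l
      · simp only [Matrix.cons_val_zero]
        rw [fieldInChart_chart, mvfderiv_chart_mlieBracket]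
      · rfl
    · funext l
      refine Fin.cases ?_ (fun l => ?_) l <;> rfl

end FormCalculus

/-! ### The exterior derivative of one-forms and two-forms -/

section LowDegree

open VectorField

variable {E : Type*} [NormedAddCommGroup E] [NormedSpace ℝ E]
  {M : Type*} [TopologicalSpace M] [ChartedSpace E M]

variable [IsManifold 𝓘(ℝ, E) ∞ M]

lemma OneForm.mdifferentiableAt_apply [CompleteSpace E] {θ : OneForm E M}
    (hθ : θ.toDiffForm.SmoothOn univ) {x : M} {Y : ∀ x : M, TangentSpace 𝓘(ℝ, E) x}
    (hY : DiffFieldAt Y x) :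
    MDifferentiableAt 𝓘(ℝ, E) 𝓘(ℝ, ℝ) (fun y => θ y (Y y)) x :=
  hθ.mdifferentiableAt_apply (Z := fun _ => Y) fun _ => hY

lemma OneForm.contMDiffAt_apply {θ : OneForm E M}
    (hθ : θ.toDiffForm.SmoothOn univ) {x : M} {Y : ∀ x : M, TangentSpace 𝓘(ℝ, E) x} {m : ℕ∞}
    (hY : ContMDiffAt 𝓘(ℝ, E) 𝓘(ℝ, E).tangent m
      (fun y => (⟨y, Y y⟩ : TangentBundle 𝓘(ℝ, E) M)) x) :
    ContMDiffAt 𝓘(ℝ, E) 𝓘(ℝ, ℝ) m (fun y => θ y (Y y)) x :=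
  hθ.contMDiffAt_apply (Z := fun _ => Y) fun _ => hY

lemma OneForm.d_apply [CompleteSpace E] {θ : OneForm E M}
    (hθ : θ.toDiffForm.SmoothOn univ) {x : M} {X Y : ∀ x : M, TangentSpace 𝓘(ℝ, E) x}
    (hX : DiffFieldAt X x) (hY : DiffFieldAt Y x) :
    θ.d x ![X x, Y x] = mvfderiv 𝓘(ℝ, E) (fun y => θ y (Y y)) x (X x)
      - mvfderiv 𝓘(ℝ, E) (fun y => θ y (X y)) x (Y x) - θ x (mlieBracket 𝓘(ℝ, E) X Y x) := by
  have h := hθ.d_apply (x := x) (V := ![X, Y]) (by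
    intro i; fin_cases i <;> assumption)
  have h0 : (fun i => (![X, Y] : Fin 2 → ∀ x : M, TangentSpace 𝓘(ℝ, E) x) i x) = ![X x, Y x] := by
    funext i; fin_cases i <;> rfl
  rw [h0] at h
  rw [show θ.d x ![X x, Y x] = θ.toDiffForm.d x ![X x, Y x] from rfl, h]
  rw [Fin.sum_univ_two, Fin.sum_univ_one]
  have h1 : Finset.Ici (0 : Fin 1) = {0} := rfl
  rw [h1, Finset.sum_singleton]
  change (-1 : ℤ) ^ 0 • mvfderiv 𝓘(ℝ, E) (fun y => θ y (Y y)) x (X x)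
    + (-1 : ℤ) ^ 1 • mvfderiv 𝓘(ℝ, E) (fun y => θ y (X y)) x (Y x)
    - (-1 : ℤ) ^ (0 + 0) • θ x (mlieBracket 𝓘(ℝ, E) X Y x) = _
  simp [sub_eq_add_neg]

lemma DiffForm.mdifferentiableAt_apply₂ [CompleteSpace E] {α : DiffForm E M 2}
    (hα : α.SmoothOn univ) {x : M} {X Y : ∀ x : M, TangentSpace 𝓘(ℝ, E) x}
    (hX : DiffFieldAt X x) (hY : DiffFieldAt Y x) :
    MDifferentiableAt 𝓘(ℝ, E) 𝓘(ℝ, ℝ) (fun y => α y ![X y, Y y]) x := by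
  have h0 : ∀ x, (fun i => (![X, Y] : Fin 2 → ∀ x : M, TangentSpace 𝓘(ℝ, E) x) i x)
      = ![X x, Y x] := by
    intro x; funext i; fin_cases i <;> rfl
  have := hα.mdifferentiableAt_apply (x := x) (Z := ![X, Y]) (by
    intro i; fin_cases i <;> assumption)
  simpa only [h0] using this

lemma DiffForm.contMDiffAt_apply₂ {α : DiffForm E M 2}
    (hα : α.SmoothOn univ) {x : M} {X Y : ∀ x : M, TangentSpace 𝓘(ℝ, E) x} {m : ℕ∞}
    (hX : ContMDiffAt 𝓘(ℝ, E) 𝓘(ℝ, E).tangent m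
      (fun y => (⟨y, X y⟩ : TangentBundle 𝓘(ℝ, E) M)) x)
    (hY : ContMDiffAt 𝓘(ℝ, E) 𝓘(ℝ, E).tangent m
      (fun y => (⟨y, Y y⟩ : TangentBundle 𝓘(ℝ, E) M)) x) :
    ContMDiffAt 𝓘(ℝ, E) 𝓘(ℝ, ℝ) m (fun y => α y ![X y, Y y]) x := by
  have h0 : ∀ x, (fun i => (![X, Y] : Fin 2 → ∀ x : M, TangentSpace 𝓘(ℝ, E) x) i x)
      = ![X x, Y x] := by
    intro x; funext i; fin_cases i <;> rfl
  have := hα.contMDiffAt_apply (x := x) (Z := ![X, Y]) (by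
    intro i; fin_cases i <;> assumption)
  simpa only [h0] using this

lemma DiffForm.d_apply₃ [CompleteSpace E] {α : DiffForm E M 2}
    (hα : α.SmoothOn univ) {x : M} {X Y Z : ∀ x : M, TangentSpace 𝓘(ℝ, E) x}
    (hX : DiffFieldAt X x) (hY : DiffFieldAt Y x) (hZ : DiffFieldAt Z x) :
    α.d x ![X x, Y x, Z x] =
      mvfderiv 𝓘(ℝ, E) (fun y => α y ![Y y, Z y]) x (X x)
      - mvfderiv 𝓘(ℝ, E) (fun y => α y ![X y, Z y]) x (Y x)
      + mvfderiv 𝓘(ℝ, E) (fun y => α y ![X y, Y y]) x (Z x)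
      - α x ![mlieBracket 𝓘(ℝ, E) X Y x, Z x] + α x ![mlieBracket 𝓘(ℝ, E) X Z x, Y x]
      - α x ![mlieBracket 𝓘(ℝ, E) Y Z x, X x] := by
  have h := hα.d_apply (x := x) (V := ![X, Y, Z]) (by
    intro i; fin_cases i <;> assumption)
  have h0 : (fun i => (![X, Y, Z] : Fin 3 → ∀ x : M, TangentSpace 𝓘(ℝ, E) x) i x)
      = ![X x, Y x, Z x] := by
    funext i; fin_cases i <;> rfl
  -- The general formula lists its arguments by deleting indices from a tuple; `e` and `e'` identify
  -- these lists with explicit pairs.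
  have e : ∀ (U V : ∀ x : M, TangentSpace 𝓘(ℝ, E) x) (W : ∀ y, Fin 2 → TangentSpace 𝓘(ℝ, E) y),
      (∀ y, W y 0 = U y) → (∀ y, W y 1 = V y) → ∀ u : TangentSpace 𝓘(ℝ, E) x,
      mvfderiv 𝓘(ℝ, E) (fun y => α y (W y)) x u
        = mvfderiv 𝓘(ℝ, E) (fun y => α y ![U y, V y]) x u := by
    intro U V W h0 h1 u
    have : ∀ y, W y = ![U y, V y] := by
      intro y; funext i; fin_cases i
      · exact h0 y
      · exact h1 y
    simp only [this]
  have e' : ∀ (u v : TangentSpace 𝓘(ℝ, E) x) (w : Fin 2 → TangentSpace 𝓘(ℝ, E) x),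
      w 0 = u → w 1 = v → α x w = α x ![u, v] := by
    intro u v w h0 h1
    congr 1; funext i; fin_cases i
    · exact h0
    · exact h1
  have i0 : Finset.Ici (0 : Fin 2) = {0, 1} := rfl
  have i1 : Finset.Ici (1 : Fin 2) = {1} := rfl
  rw [h0] at h
  rw [h, Fin.sum_univ_three, Fin.sum_univ_two, i0, i1, Finset.sum_singleton,
    Finset.sum_pair (by decide)]
  have t0 := e Y Z (fun y => Fin.removeNth 0 fun j =>
    (![X, Y, Z] : Fin 3 → ∀ x : M, TangentSpace 𝓘(ℝ, E) x) j y) (fun _ => rfl) (fun _ => rfl) (X x)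
  have t1 := e X Z (fun y => Fin.removeNth 1 fun j =>
    (![X, Y, Z] : Fin 3 → ∀ x : M, TangentSpace 𝓘(ℝ, E) x) j y) (fun _ => rfl) (fun _ => rfl) (Y x)
  have t2 := e X Y (fun y => Fin.removeNth 2 fun j =>
    (![X, Y, Z] : Fin 3 → ∀ x : M, TangentSpace 𝓘(ℝ, E) x) j y) (fun _ => rfl) (fun _ => rfl) (Z x)
  have s0 := e' (mlieBracket 𝓘(ℝ, E) X Y x) (Z x) (Matrix.vecCons (mlieBracket 𝓘(ℝ, E) X Y x)
    (Fin.removeNth (0 : Fin 2) (Fin.removeNth (0 : Fin 3) ![X x, Y x, Z x]))) rfl rfl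
  have s1 := e' (mlieBracket 𝓘(ℝ, E) X Z x) (Y x) (Matrix.vecCons (mlieBracket 𝓘(ℝ, E) X Z x)
    (Fin.removeNth (1 : Fin 2) (Fin.removeNth (0 : Fin 3) ![X x, Y x, Z x]))) rfl rfl
  have s2 := e' (mlieBracket 𝓘(ℝ, E) Y Z x) (X x) (Matrix.vecCons (mlieBracket 𝓘(ℝ, E) Y Z x)
    (Fin.removeNth (1 : Fin 2) (Fin.removeNth (1 : Fin 3) ![X x, Y x, Z x]))) rfl rfl
  rw [← t0, ← t1, ← t2, ← s0, ← s1, ← s2]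
  have fin : ∀ a b c d e f : ℝ, (-1 : ℤ) ^ 0 • a + (-1 : ℤ) ^ 1 • b + (-1 : ℤ) ^ 2 • c
      - ((-1 : ℤ) ^ (0 + 0) • d + (-1 : ℤ) ^ (0 + 1) • e + (-1 : ℤ) ^ (1 + 1) • f)
      = a - b + c - d + e - f := by
    intro a b c d e f
    simp
    ring
  exact fin _ _ _ _ _ _

end LowDegree

/-! ### Smooth families of linear maps between tangent spaces -/

section SmoothHom

open VectorField

variable {E₁ : Type*} [NormedAddCommGroup E₁] [NormedSpace ℝ E₁]
  {M₁ : Type*} [TopologicalSpace M₁] [ChartedSpace E₁ M₁] [IsManifold 𝓘(ℝ, E₁) ∞ M₁]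
  {E₂ : Type*} [NormedAddCommGroup E₂] [NormedSpace ℝ E₂]
  {M₂ : Type*} [TopologicalSpace M₂] [ChartedSpace E₂ M₂] [IsManifold 𝓘(ℝ, E₂) ∞ M₂]
  {F : Type*} [NormedAddCommGroup F] [NormedSpace ℝ F]
  {N : Type*} [TopologicalSpace N] [ChartedSpace F N]
  {F' : Type*} [NormedAddCommGroup F'] [NormedSpace ℝ F']
  {N' : Type*} [TopologicalSpace N'] [ChartedSpace F' N']

variable (F) in
/-- The linear maps `ϕ m : T_{b₁ m} M₁ → T_{b₂ m} M₂` depend smoothly on `m` near `m₀`. -/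
def SmoothHomAt (b₁ : N → M₁) (b₂ : N → M₂)
    (ϕ : ∀ m : N, TangentSpace 𝓘(ℝ, E₁) (b₁ m) →L[ℝ] TangentSpace 𝓘(ℝ, E₂) (b₂ m)) (m₀ : N) :
    Prop :=
  ContMDiffAt 𝓘(ℝ, F) 𝓘(ℝ, E₁ →L[ℝ] E₂) ∞
    (fun m => ContinuousLinearMap.inCoordinates E₁ (TangentSpace 𝓘(ℝ, E₁) : M₁ → Type _) E₂
      (TangentSpace 𝓘(ℝ, E₂) : M₂ → Type _) (b₁ m₀) (b₁ m) (b₂ m₀) (b₂ m) (ϕ m)) m₀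

lemma SmoothHomAt.comp {b₁ : N → M₁} {b₂ : N → M₂}
    {ϕ : ∀ m : N, TangentSpace 𝓘(ℝ, E₁) (b₁ m) →L[ℝ] TangentSpace 𝓘(ℝ, E₂) (b₂ m)}
    {f : N' → N} {m₀ : N'} (hϕ : SmoothHomAt F b₁ b₂ ϕ (f m₀))
    (hf : ContMDiffAt 𝓘(ℝ, F') 𝓘(ℝ, F) ∞ f m₀) :
    SmoothHomAt F' (fun m => b₁ (f m)) (fun m => b₂ (f m)) (fun m => ϕ (f m)) m₀ :=
  ContMDiffAt.comp m₀ hϕ hf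

lemma SmoothHomAt.contMDiffAt_apply {b₁ : N → M₁} {b₂ : N → M₂}
    {ϕ : ∀ m : N, TangentSpace 𝓘(ℝ, E₁) (b₁ m) →L[ℝ] TangentSpace 𝓘(ℝ, E₂) (b₂ m)} {m₀ : N}
    (hϕ : SmoothHomAt F b₁ b₂ ϕ m₀) (hb₂ : ContMDiffAt 𝓘(ℝ, F) 𝓘(ℝ, E₂) ∞ b₂ m₀)
    {v : ∀ m : N, TangentSpace 𝓘(ℝ, E₁) (b₁ m)}
    (hv : ContMDiffAt 𝓘(ℝ, F) 𝓘(ℝ, E₁).tangent ∞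
      (fun m => (⟨b₁ m, v m⟩ : TangentBundle 𝓘(ℝ, E₁) M₁)) m₀) :
    ContMDiffAt 𝓘(ℝ, F) 𝓘(ℝ, E₂).tangent ∞
      (fun m => (⟨b₂ m, ϕ m (v m)⟩ : TangentBundle 𝓘(ℝ, E₂) M₂)) m₀ :=
  ContMDiffAt.clm_apply_of_inCoordinates hϕ hv hb₂

lemma SmoothHomAt.mdifferentiableAt_apply {b₁ : N → M₁} {b₂ : N → M₂}
    {ϕ : ∀ m : N, TangentSpace 𝓘(ℝ, E₁) (b₁ m) →L[ℝ] TangentSpace 𝓘(ℝ, E₂) (b₂ m)} {m₀ : N}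
    (hϕ : SmoothHomAt F b₁ b₂ ϕ m₀) (hb₂ : ContMDiffAt 𝓘(ℝ, F) 𝓘(ℝ, E₂) ∞ b₂ m₀)
    {v : ∀ m : N, TangentSpace 𝓘(ℝ, E₁) (b₁ m)}
    (hv : MDifferentiableAt 𝓘(ℝ, F) 𝓘(ℝ, E₁).tangent
      (fun m => (⟨b₁ m, v m⟩ : TangentBundle 𝓘(ℝ, E₁) M₁)) m₀) :
    MDifferentiableAt 𝓘(ℝ, F) 𝓘(ℝ, E₂).tangent
      (fun m => (⟨b₂ m, ϕ m (v m)⟩ : TangentBundle 𝓘(ℝ, E₂) M₂)) m₀ :=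
  MDifferentiableAt.clm_apply_of_inCoordinates (ContMDiffAt.mdifferentiableAt hϕ (by simp)) hv
    (hb₂.mdifferentiableAt (by simp))

/-- In finite dimension an operator is the sum of the rank-one operators given by the coordinate
functionals and its values on a basis, so smoothness of these finitely many values is enough. -/
lemma contMDiffAt_clm_of_apply {F G : Type*} [NormedAddCommGroup F] [NormedSpace ℝ F]
    [FiniteDimensional ℝ F] [NormedAddCommGroup G] [NormedSpace ℝ G] {A : N → F →L[ℝ] G} {m₀ : N}
    {k : WithTop ℕ∞} {F' : Type*} [NormedAddCommGroup F'] [NormedSpace ℝ F'] [ChartedSpace F' N]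
    (h : ∀ v, ContMDiffAt 𝓘(ℝ, F') 𝓘(ℝ, G) k (fun m => A m v) m₀) :
    ContMDiffAt 𝓘(ℝ, F') 𝓘(ℝ, F →L[ℝ] G) k A m₀ := by
  let b := Module.finBasis ℝ F
  let c : Fin (Module.finrank ℝ F) → F →L[ℝ] ℝ := fun i => LinearMap.toContinuousLinearMap (b.coord i)
  have hA : A = fun m => ∑ i, ContinuousLinearMap.smulRightL ℝ F G (c i) (A m (b i)) := by
    funext m
    ext v
    conv_lhs => rw [← b.sum_repr v, map_sum]
    simp [c, -Module.Basis.sum_repr]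
  rw [hA]
  refine contMDiffAt_finsetSum fun i _ => ?_
  exact (ContinuousLinearMap.contMDiff (ContinuousLinearMap.smulRightL ℝ F G (c i))).contMDiffAt.comp
    m₀ (h (b i))

/-- The local section of `TM` near `c` with constant coordinate `v` in the preferred
trivialization at `c`. -/
def constSection (c : M₁) (v : E₁) (x : M₁) : TangentSpace 𝓘(ℝ, E₁) x :=
  (trivializationAt E₁ (TangentSpace 𝓘(ℝ, E₁)) c).symm x v

lemma contMDiffOn_constSection (c : M₁) (v : E₁) :
    SmoothFieldOn (constSection c v) (chartAt E₁ c).source := by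
  intro x hx
  refine ContMDiffAt.contMDiffWithinAt ?_
  have hb : x ∈ (trivializationAt E₁ (TangentSpace 𝓘(ℝ, E₁)) c).baseSet := hx
  rw [(trivializationAt E₁ (TangentSpace 𝓘(ℝ, E₁)) c).contMDiffAt_section_iff hb]
  have : ContMDiffAt 𝓘(ℝ, E₁) 𝓘(ℝ, E₁) ∞ (fun _ : M₁ => v) x := contMDiffAt_const
  refine this.congr_of_eventuallyEq ?_
  filter_upwards [(chartAt E₁ c).open_source.mem_nhds hx] with y hy
  have hb : y ∈ (trivializationAt E₁ (TangentSpace 𝓘(ℝ, E₁)) c).baseSet := hy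
  have h1 := (trivializationAt E₁ (TangentSpace 𝓘(ℝ, E₁)) c).apply_mk_symm hb v
  exact congrArg Prod.snd h1

/-- A family of linear maps is smooth if it maps the sections with constant coordinates to smooth
maps. -/
lemma SmoothHomAt.of_apply_constSection [FiniteDimensional ℝ E₁] {b₁ : N → M₁} {b₂ : N → M₂}
    {ϕ : ∀ m : N, TangentSpace 𝓘(ℝ, E₁) (b₁ m) →L[ℝ] TangentSpace 𝓘(ℝ, E₂) (b₂ m)} {m₀ : N}
    (hb₁ : ContinuousAt b₁ m₀)
    (h : ∀ v : E₁, ContMDiffAt 𝓘(ℝ, F) 𝓘(ℝ, E₂).tangent ∞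
      (fun m => (⟨b₂ m, ϕ m (constSection (b₁ m₀) v (b₁ m))⟩ : TangentBundle 𝓘(ℝ, E₂) M₂)) m₀) :
    SmoothHomAt F b₁ b₂ ϕ m₀ := by
  refine contMDiffAt_clm_of_apply fun v => ?_
  have h1 := contMDiffAt_totalSpace.1 (h v)
  refine h1.2.congr_of_eventuallyEq ?_
  have e1 : ∀ᶠ m in 𝓝 m₀, b₁ m ∈ (trivializationAt E₁ (TangentSpace 𝓘(ℝ, E₁)) (b₁ m₀)).baseSet :=
    hb₁.eventually ((trivializationAt E₁ (TangentSpace 𝓘(ℝ, E₁)) (b₁ m₀)).open_baseSet.mem_nhds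
      (FiberBundle.mem_baseSet_trivializationAt' _))
  have e2 : ∀ᶠ m in 𝓝 m₀, b₂ m ∈ (trivializationAt E₂ (TangentSpace 𝓘(ℝ, E₂)) (b₂ m₀)).baseSet :=
    h1.1.continuousAt.eventually
      ((trivializationAt E₂ (TangentSpace 𝓘(ℝ, E₂)) (b₂ m₀)).open_baseSet.mem_nhds
      (FiberBundle.mem_baseSet_trivializationAt' _))
  filter_upwards [e1, e2] with m h1 h2
  rw [ContinuousLinearMap.inCoordinates_eq h1 h2]
  simp only [ContinuousLinearMap.comp_apply]
  rfl

end SmoothHom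

/-! ### Horizontal splittings -/

section Splitting

open VectorField

variable {E : Type*} [NormedAddCommGroup E] [NormedSpace ℝ E]
  {M : Type*} [TopologicalSpace M] [ChartedSpace E M] [IsManifold 𝓘(ℝ, E) ∞ M]
  {F : Type*} [NormedAddCommGroup F] [NormedSpace ℝ F]
  {P : Type*} [TopologicalSpace P] [ChartedSpace F P] [IsManifold 𝓘(ℝ, F) ∞ P]

/-- The one-form `η` and the differential of `p` split the tangent spaces of `P`: the maps `lift q`
are the horizontal lifts, and `T` is the vertical vector field with `η(T) = 1`. -/
structure IsSplitting (p : P → M) (η : OneForm F P)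
    (lift : ∀ q : P, TangentSpace 𝓘(ℝ, E) (p q) →L[ℝ] TangentSpace 𝓘(ℝ, F) q)
    (T : ∀ q : P, TangentSpace 𝓘(ℝ, F) q) : Prop where
  smooth_proj : ContMDiff 𝓘(ℝ, F) 𝓘(ℝ, E) ∞ p
  smooth_form : η.toDiffForm.SmoothOn univ
  proj_lift : ∀ (q : P) (u : TangentSpace 𝓘(ℝ, E) (p q)),
    mfderiv 𝓘(ℝ, F) 𝓘(ℝ, E) p q (lift q u) = u
  form_lift : ∀ (q : P) (u : TangentSpace 𝓘(ℝ, E) (p q)), η q (lift q u) = 0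
  proj_T : ∀ q : P, mfderiv 𝓘(ℝ, F) 𝓘(ℝ, E) p q (T q) = 0
  form_T : ∀ q : P, η q (T q) = 1
  ext : ∀ (q : P) (v : TangentSpace 𝓘(ℝ, F) q),
    mfderiv 𝓘(ℝ, F) 𝓘(ℝ, E) p q v = 0 → η q v = 0 → v = 0

lemma smoothHomAt_mfderiv {p : P → M} (hp : ContMDiff 𝓘(ℝ, F) 𝓘(ℝ, E) ∞ p) (q : P) :
    SmoothHomAt F (fun y => y) p (fun y => mfderiv 𝓘(ℝ, F) 𝓘(ℝ, E) p y) q :=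
  ContMDiffAt.mfderiv_const (hp q) (by simp)

namespace IsSplitting

variable {p : P → M} {η : OneForm F P}
  {lift : ∀ q : P, TangentSpace 𝓘(ℝ, E) (p q) →L[ℝ] TangentSpace 𝓘(ℝ, F) q}
  {T : ∀ q : P, TangentSpace 𝓘(ℝ, F) q}

/-- Both sides have the same image under `p_*` and under `η`, and the pair is injective. -/
lemma decomp (h : IsSplitting p η lift T) (q : P) (v : TangentSpace 𝓘(ℝ, F) q) :
    v = lift q (mfderiv 𝓘(ℝ, F) 𝓘(ℝ, E) p q v) + η q v • T q := by
  rw [← sub_eq_zero]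
  apply h.ext
  · simp [h.proj_lift, h.proj_T]
  · simp [h.form_lift, h.form_T]

lemma lift_proj (h : IsSplitting p η lift T) {q : P} {v : TangentSpace 𝓘(ℝ, F) q}
    (hv : η q v = 0) : lift q (mfderiv 𝓘(ℝ, F) 𝓘(ℝ, E) p q v) = v := by
  have := h.decomp q v
  rw [hv, zero_smul, add_zero] at this
  exact this.symm

variable (E) in
/-- The pair `(p_*, η)` read in the preferred trivializations at `q₀`. -/
def coords (p : P → M) (η : OneForm F P) (q₀ q : P) : F →L[ℝ] E × ℝ :=
  (ContinuousLinearMap.inCoordinates F (TangentSpace 𝓘(ℝ, F) : P → Type _) E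
      (TangentSpace 𝓘(ℝ, E) : M → Type _) q₀ q (p q₀) (p q) (mfderiv 𝓘(ℝ, F) 𝓘(ℝ, E) p q)).prod
    ((η q).comp (Trivialization.symmL ℝ (trivializationAt F (TangentSpace 𝓘(ℝ, F)) q₀) q))

lemma contMDiffAt_coords [FiniteDimensional ℝ F] (h : IsSplitting p η lift T) (q₀ : P) :
    ContMDiffAt 𝓘(ℝ, F) 𝓘(ℝ, F →L[ℝ] E × ℝ) ∞ (coords E p η q₀) q₀ := by
  refine contMDiffAt_clm_of_apply fun v => ?_
  refine ContMDiffAt.prodMk_space ?_ ?_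
  · exact ContMDiffAt.clm_apply (smoothHomAt_mfderiv h.smooth_proj q₀) contMDiffAt_const
  · have h1 : ContMDiffAt 𝓘(ℝ, F) 𝓘(ℝ, ℝ) ∞ (fun q => η q (constSection q₀ v q)) q₀ :=
      OneForm.contMDiffAt_apply h.smooth_form (m := ⊤)
        ((contMDiffOn_constSection q₀ v).contMDiffAt
          ((chartAt F q₀).open_source.mem_nhds (mem_chart_source F q₀)))
    refine h1.congr_of_eventuallyEq ?_
    filter_upwards [(trivializationAt F (TangentSpace 𝓘(ℝ, F)) q₀).open_baseSet.mem_nhds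
      (FiberBundle.mem_baseSet_trivializationAt' _)] with q hq
    exact congrArg (η q) (Trivialization.symmL_apply _ hq v)

lemma eventually_mem_baseSet (h : IsSplitting p η lift T) (q₀ : P) :
    ∀ᶠ q in 𝓝 q₀, q ∈ (trivializationAt F (TangentSpace 𝓘(ℝ, F)) q₀).baseSet ∧
      p q ∈ (trivializationAt E (TangentSpace 𝓘(ℝ, E)) (p q₀)).baseSet := by
  refine Filter.Eventually.and ?_ ?_
  · exact (trivializationAt F (TangentSpace 𝓘(ℝ, F)) q₀).open_baseSet.mem_nhds
      (FiberBundle.mem_baseSet_trivializationAt' _)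
  · exact (h.smooth_proj q₀).continuousAt.eventually
      ((trivializationAt E (TangentSpace 𝓘(ℝ, E)) (p q₀)).open_baseSet.mem_nhds
      (FiberBundle.mem_baseSet_trivializationAt' _))

lemma coords_apply {q₀ q : P} (h1 : q ∈ (trivializationAt F (TangentSpace 𝓘(ℝ, F)) q₀).baseSet)
    (h2 : p q ∈ (trivializationAt E (TangentSpace 𝓘(ℝ, E)) (p q₀)).baseSet)
    (v : TangentSpace 𝓘(ℝ, F) q) :
    coords E p η q₀ q (Trivialization.continuousLinearEquivAt ℝ
        (trivializationAt F (TangentSpace 𝓘(ℝ, F)) q₀) q h1 v)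
      = (Trivialization.continuousLinearEquivAt ℝ
          (trivializationAt E (TangentSpace 𝓘(ℝ, E)) (p q₀)) (p q) h2
            (mfderiv 𝓘(ℝ, F) 𝓘(ℝ, E) p q v), η q v) := by
  rw [coords, ContinuousLinearMap.inCoordinates_eq h1 h2]
  have h4 := (Trivialization.continuousLinearEquivAt ℝ
    (trivializationAt F (TangentSpace 𝓘(ℝ, F)) q₀) q h1).symm_apply_apply v
  have h3 := (Trivialization.symmL_apply (R := ℝ)
    (trivializationAt F (TangentSpace 𝓘(ℝ, F)) q₀) h1 _).trans h4
  exact Prod.ext (congrArg (fun w => Trivialization.continuousLinearEquivAt ℝ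
          (trivializationAt E (TangentSpace 𝓘(ℝ, E)) (p q₀)) (p q) h2
            (mfderiv 𝓘(ℝ, F) 𝓘(ℝ, E) p q w)) h4) (congrArg (η q) h3)

/-- Injectivity is the field `ext` of the splitting; the vector with prescribed coordinates is a
horizontal lift plus a multiple of `T`. -/
lemma isInvertible_coords [FiniteDimensional ℝ E] [FiniteDimensional ℝ F]
    (h : IsSplitting p η lift T) {q₀ q : P}
    (h1 : q ∈ (trivializationAt F (TangentSpace 𝓘(ℝ, F)) q₀).baseSet)
    (h2 : p q ∈ (trivializationAt E (TangentSpace 𝓘(ℝ, E)) (p q₀)).baseSet) :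
    (coords E p η q₀ q).IsInvertible := by
  let e₁ := Trivialization.continuousLinearEquivAt ℝ
    (trivializationAt F (TangentSpace 𝓘(ℝ, F)) q₀) q h1
  let e₂ := Trivialization.continuousLinearEquivAt ℝ
    (trivializationAt E (TangentSpace 𝓘(ℝ, E)) (p q₀)) (p q) h2
  have key : ∀ v, coords E p η q₀ q (e₁ v) = (e₂ (mfderiv 𝓘(ℝ, F) 𝓘(ℝ, E) p q v), η q v) :=
    coords_apply h1 h2
  have hbij : Function.Bijective (coords E p η q₀ q : F →ₗ[ℝ] E × ℝ) := by
    constructor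
    · rw [← LinearMap.ker_eq_bot, LinearMap.ker_eq_bot']
      intro w hw
      obtain ⟨v, rfl⟩ := e₁.surjective w
      have h3 := (key v).symm.trans hw
      have h4 := congrArg Prod.fst h3
      have h5 := congrArg Prod.snd h3
      have : v = 0 := h.ext q v (by simpa using h4) h5
      rw [this, map_zero]
    · rintro ⟨w, t⟩
      refine ⟨e₁ (lift q (e₂.symm w) + t • T q), ?_⟩
      refine (key _).trans ?_
      simp [h.proj_lift, h.proj_T, h.form_lift, h.form_T]
  refine ⟨(LinearEquiv.ofBijective _ hbij).toContinuousLinearEquiv, ?_⟩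
  ext v <;> rfl

/-- Inversion of operators is smooth at an invertible one. Smoothness of the lift and of `T` follows
from this, since each has constant coordinates; the splitting itself assumes no regularity of
either. -/
lemma contMDiffAt_coords_inverse [FiniteDimensional ℝ E] [FiniteDimensional ℝ F]
    (h : IsSplitting p η lift T) (q₀ : P) :
    ContMDiffAt 𝓘(ℝ, F) 𝓘(ℝ, E × ℝ →L[ℝ] F) ∞
      (fun q => (coords E p η q₀ q).inverse) q₀ := by
  obtain ⟨h1, h2⟩ := (h.eventually_mem_baseSet q₀).self_of_nhds
  obtain ⟨e, he⟩ := h.isInvertible_coords h1 h2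
  have : CompleteSpace F := FiniteDimensional.complete ℝ F
  have h3 := contDiffAt_map_inverse (n := ∞) e
  rw [he] at h3
  exact h3.contMDiffAt.comp q₀ (h.contMDiffAt_coords q₀)

/-- The horizontal lift is smooth. -/
lemma smoothHomAt_lift [FiniteDimensional ℝ E] [FiniteDimensional ℝ F]
    (h : IsSplitting p η lift T) (q₀ : P) :
    SmoothHomAt F p (fun q => q) lift q₀ := by
  refine contMDiffAt_clm_of_apply fun w => ?_
  have h1 : ContMDiffAt 𝓘(ℝ, F) 𝓘(ℝ, F) ∞ (fun q => (coords E p η q₀ q).inverse (w, (0 : ℝ))) q₀ :=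
    (h.contMDiffAt_coords_inverse q₀).clm_apply contMDiffAt_const
  refine h1.congr_of_eventuallyEq ?_
  filter_upwards [h.eventually_mem_baseSet q₀] with q ⟨h1, h2⟩
  rw [ContinuousLinearMap.inCoordinates_eq h2 h1]
  symm
  -- The lift of a base vector is the unique vector with that projection and zero `η`-component,
  -- that is, with coordinates `(w, 0)`.
  rw [(h.isInvertible_coords h1 h2).inverse_apply_eq]
  refine Eq.trans ?_ (coords_apply h1 h2 _).symm
  symm
  refine Prod.ext ?_ (h.form_lift q _)
  refine (congrArg (Trivialization.continuousLinearEquivAt ℝ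
    (trivializationAt E (TangentSpace 𝓘(ℝ, E)) (p q₀)) (p q) h2) (h.proj_lift q _)).trans ?_
  exact ContinuousLinearEquiv.apply_symm_apply _ w

/-- The vertical field is smooth. -/
lemma contMDiffAt_T [FiniteDimensional ℝ E] [FiniteDimensional ℝ F]
    (h : IsSplitting p η lift T) (q₀ : P) :
    ContMDiffAt 𝓘(ℝ, F) 𝓘(ℝ, F).tangent ∞ (fun q => (⟨q, T q⟩ : TangentBundle 𝓘(ℝ, F) P)) q₀ := by
  rw [contMDiffAt_section]
  have h1 : ContMDiffAt 𝓘(ℝ, F) 𝓘(ℝ, F) ∞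
      (fun q => (coords E p η q₀ q).inverse ((0 : E), (1 : ℝ))) q₀ :=
    (h.contMDiffAt_coords_inverse q₀).clm_apply contMDiffAt_const
  refine h1.congr_of_eventuallyEq ?_
  filter_upwards [h.eventually_mem_baseSet q₀] with q ⟨h1, h2⟩
  symm
  rw [(h.isInvertible_coords h1 h2).inverse_apply_eq]
  refine Eq.trans ?_ (coords_apply h1 h2 (T q)).symm
  simp only [h.proj_T, h.form_T, map_zero]

lemma contMDiffAt_lift [FiniteDimensional ℝ E] [FiniteDimensional ℝ F]
    (h : IsSplitting p η lift T) {q : P} {v : ∀ q : P, TangentSpace 𝓘(ℝ, E) (p q)}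
    (hv : ContMDiffAt 𝓘(ℝ, F) 𝓘(ℝ, E).tangent ∞
      (fun q => (⟨p q, v q⟩ : TangentBundle 𝓘(ℝ, E) M)) q) :
    ContMDiffAt 𝓘(ℝ, F) 𝓘(ℝ, F).tangent ∞
      (fun q => (⟨q, lift q (v q)⟩ : TangentBundle 𝓘(ℝ, F) P)) q :=
  (h.smoothHomAt_lift q).contMDiffAt_apply contMDiffAt_id hv

lemma mdifferentiableAt_lift [FiniteDimensional ℝ E] [FiniteDimensional ℝ F]
    (h : IsSplitting p η lift T) {q : P} {v : ∀ q : P, TangentSpace 𝓘(ℝ, E) (p q)}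
    (hv : MDifferentiableAt 𝓘(ℝ, F) 𝓘(ℝ, E).tangent
      (fun q => (⟨p q, v q⟩ : TangentBundle 𝓘(ℝ, E) M)) q) :
    DiffFieldAt (fun q => lift q (v q)) q :=
  (h.smoothHomAt_lift q).mdifferentiableAt_apply contMDiffAt_id hv

/-- The lift of a vector field on the base. -/
lemma diffFieldAt_lift [FiniteDimensional ℝ E] [FiniteDimensional ℝ F]
    (h : IsSplitting p η lift T) {q : P} {Y : ∀ x : M, TangentSpace 𝓘(ℝ, E) x}
    (hY : DiffFieldAt Y (p q)) : DiffFieldAt (fun q => lift q (Y (p q))) q :=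
  h.mdifferentiableAt_lift (MDifferentiableAt.comp q hY
    ((h.smooth_proj q).mdifferentiableAt (by simp)))

lemma smoothFieldOn_lift [FiniteDimensional ℝ E] [FiniteDimensional ℝ F]
    (h : IsSplitting p η lift T) {U : Set M} (hU : IsOpen U) {Y : ∀ x : M, TangentSpace 𝓘(ℝ, E) x}
    (hY : SmoothFieldOn Y U) : SmoothFieldOn (fun q => lift q (Y (p q))) (p ⁻¹' U) := by
  intro q hq
  refine ContMDiffAt.contMDiffWithinAt (h.contMDiffAt_lift ?_)
  exact ContMDiffAt.comp q (hY.contMDiffAt (hU.mem_nhds hq)) (h.smooth_proj q)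

lemma mdifferentiableAt_proj (h : IsSplitting p η lift T) (q : P) :
    MDifferentiableAt 𝓘(ℝ, F) 𝓘(ℝ, E) p q :=
  (h.smooth_proj q).mdifferentiableAt (by simp)

end IsSplitting

end Splitting

/-! ### Constant multiples of one-forms -/

section OneFormSMul

variable {F : Type*} [NormedAddCommGroup F] [NormedSpace ℝ F]
  {P : Type*} [TopologicalSpace P] [ChartedSpace F P]

lemma OneForm.toDiffForm_smul {θ η : OneForm F P} {c : ℝ} (h : ∀ q, η q = c • θ q) (x : P) :
    η.toDiffForm.inChart x = c • θ.toDiffForm.inChart x := by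
  funext y
  ext v
  change η _ _ = c • θ _ _
  rw [h]
  rfl

lemma OneForm.smoothOn_smul {θ η : OneForm F P} {c : ℝ} (h : ∀ q, η q = c • θ q)
    (hθ : θ.toDiffForm.SmoothOn univ) : η.toDiffForm.SmoothOn univ := by
  intro x
  rw [OneForm.toDiffForm_smul h]
  exact (hθ x).const_smul c

lemma OneForm.d_smul {θ η : OneForm F P} {c : ℝ} (h : ∀ q, η q = c • θ q)
    (x : P) : η.d x = c • θ.d x := by
  change (extDeriv (η.toDiffForm.inChart x) _).compContinuousLinearMap _ = _
  rw [OneForm.toDiffForm_smul h, extDeriv_smul]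
  rfl

end OneFormSMul

/-! ### The splitting defined by a principal connection -/

section PrincipalConnection

variable {E : Type*} [NormedAddCommGroup E] [NormedSpace ℝ E]
  {M : Type*} [TopologicalSpace M] [ChartedSpace E M]
  {F : Type*} [NormedAddCommGroup F] [NormedSpace ℝ F]
  {P : Type*} [TopologicalSpace P] [ChartedSpace F P] [MulAction Circle P]

/-- Keeping the circle coordinate of `q` fixed in a local trivialization gives a local section
through `q`; its derivative is a right inverse of the derivative of `p`. -/
lemma IsPrincipalCircleBundle.mfderiv_surjective {p : P → M}
    (hp : IsPrincipalCircleBundle (E := E) (F := F) p) (q : P) :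
    Function.Surjective (mfderiv 𝓘(ℝ, F) 𝓘(ℝ, E) p q) := by
  obtain ⟨t, hx, -, ht, -⟩ := hp.locally_trivial (p q)
  let s : M → P := fun x => t.toOpenPartialHomeomorph.symm (x, (t q).2)
  have hq : q ∈ t.source := t.mem_source.2 hx
  have hsq : s (p q) = q := by
    have h1 := t.toOpenPartialHomeomorph.left_inv hq
    have h2 : t q = (p q, (t q).2) := Prod.ext (t.coe_fst hq) rfl
    change t.toOpenPartialHomeomorph.symm (p q, (t q).2) = q
    rw [← h2]
    exact h1
  have hmem : (p q, (t q).2) ∈ t.target := t.mem_target.2 hx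
  have hs : MDifferentiableAt 𝓘(ℝ, E) 𝓘(ℝ, F) s (p q) := by
    have h1 := (ht.contMDiffAt (t.open_target.mem_nhds hmem)).mdifferentiableAt (by simp)
    have h2 : MDifferentiableAt 𝓘(ℝ, E) (𝓘(ℝ, E).prod (𝓡 1)) (fun x : M => (x, (t q).2)) (p q) :=
      mdifferentiableAt_id.prodMk mdifferentiableAt_const
    exact MDifferentiableAt.comp (p q) h1 h2
  have hps : (fun x => p (s x)) =ᶠ[𝓝 (p q)] id := by
    filter_upwards [t.open_baseSet.mem_nhds hx] with x hx'
    exact t.proj_symm_apply (t.mem_target.2 hx')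
  have h3 : MDifferentiableAt 𝓘(ℝ, F) 𝓘(ℝ, E) p (s (p q)) :=
    (hp.smooth_proj _).mdifferentiableAt (by simp)
  have h4 := mfderiv_comp (p q) h3 hs
  have h5 : mfderiv 𝓘(ℝ, E) 𝓘(ℝ, E) (p ∘ s) (p q)
      = ContinuousLinearMap.id ℝ (TangentSpace 𝓘(ℝ, E) (p q)) :=
    (hps.mfderiv_eq (I := 𝓘(ℝ, E)) (I' := 𝓘(ℝ, E))).trans mfderiv_id
  -- The section returns to `q` only up to a propositional equality, so the conclusion is
  -- transported along it.
  have key : ∀ q', q' = q → ∀ v : E,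
      (∃ u : F, (mfderiv 𝓘(ℝ, F) 𝓘(ℝ, E) p q' : F →L[ℝ] E) u = v) →
      ∃ u : F, (mfderiv 𝓘(ℝ, F) 𝓘(ℝ, E) p q : F →L[ℝ] E) u = v := by
    rintro q' rfl v h
    exact h
  intro v
  refine key _ hsq v ⟨mfderiv 𝓘(ℝ, E) 𝓘(ℝ, F) s (p q) v, ?_⟩
  have h6 := congr(($(h4.symm.trans h5) : E →L[ℝ] E) v)
  exact h6

/-- The witness is the fundamental vector: the orbit curve `exp(it) • q` stays in one fibre, so `p`
is constant along it, while `θ` takes the value `1` by the axiom for connections. -/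
lemma IsPrincipalConnection.exists_vertical {p : P → M}
    (hp : IsPrincipalCircleBundle (E := E) (F := F) p) {θ : OneForm F P}
    (hθ : IsPrincipalConnection θ) (q : P) :
    ∃ v : TangentSpace 𝓘(ℝ, F) q, mfderiv 𝓘(ℝ, F) 𝓘(ℝ, E) p q v = 0 ∧ θ q v = 1 := by
  have key : ∀ q', q' = q → (∃ v : TangentSpace 𝓘(ℝ, F) q',
      mfderiv 𝓘(ℝ, F) 𝓘(ℝ, E) p q' v = 0 ∧ θ q' v = 1) → 
      ∃ v : TangentSpace 𝓘(ℝ, F) q, mfderiv 𝓘(ℝ, F) 𝓘(ℝ, E) p q v = 0 ∧ θ q v = 1 := by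
    rintro q' rfl h
    exact h
  refine key (Circle.exp 0 • q) (by simp) ⟨_, ?_, hθ.fundamental q⟩
  have h1 : MDifferentiableAt 𝓘(ℝ, ℝ) 𝓘(ℝ, F) (fun t : ℝ => Circle.exp t • q) 0 := by
    have h2 : ContMDiff 𝓘(ℝ, ℝ) ((𝓡 1).prod 𝓘(ℝ, F)) ∞ (fun t : ℝ => (Circle.exp t, q)) :=
      contMDiff_circleExp.prodMk contMDiff_const
    exact ((hp.smooth_action.comp h2) 0).mdifferentiableAt (by simp)
  have h3 : MDifferentiableAt 𝓘(ℝ, F) 𝓘(ℝ, E) p (Circle.exp 0 • q) :=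
    (hp.smooth_proj _).mdifferentiableAt (by simp)
  have h4 := mfderiv_comp (0 : ℝ) h3 h1
  have h5 : (p ∘ fun t : ℝ => Circle.exp t • q) = fun _ => p q := by
    funext t
    exact hp.proj_smul _ _
  have h6 : mfderiv 𝓘(ℝ, ℝ) 𝓘(ℝ, E) (p ∘ fun t : ℝ => Circle.exp t • q) 0 = 0 := by
    rw [h5]
    exact mfderiv_const
  exact congr(($(h4.symm.trans h6) : ℝ →L[ℝ] E) (1 : ℝ))

/-- The pair `(p_*, θ)` maps onto `E × ℝ`: lift the first component arbitrarily and correct the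
second with the vertical vector. As both sides have the same dimension, it is also injective. -/
lemma horizontal_ext [FiniteDimensional ℝ E] [FiniteDimensional ℝ F] {p : P → M}
    (hp : IsPrincipalCircleBundle (E := E) (F := F) p) {θ : OneForm F P}
    (hθ : IsPrincipalConnection θ) (hdim : Module.finrank ℝ F = Module.finrank ℝ E + 1) (q : P)
    (v : TangentSpace 𝓘(ℝ, F) q) (h1 : mfderiv 𝓘(ℝ, F) 𝓘(ℝ, E) p q v = 0) (h2 : θ q v = 0) :
    v = 0 := by
  let L : F →ₗ[ℝ] E × ℝ := LinearMap.prod (mfderiv 𝓘(ℝ, F) 𝓘(ℝ, E) p q : F →L[ℝ] E).toLinearMap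
    (θ q : F →L[ℝ] ℝ).toLinearMap
  obtain ⟨ξ, hξ, hξ'⟩ := hθ.exists_vertical hp q
  have hL : Function.Surjective L := by
    rintro ⟨w, t⟩
    obtain ⟨u, hu⟩ := hp.mfderiv_surjective q w
    let a : ℝ := t - θ q u
    refine ⟨(u + a • ξ : TangentSpace 𝓘(ℝ, F) q), Prod.ext ?_ ?_⟩
    · change mfderiv 𝓘(ℝ, F) 𝓘(ℝ, E) p q (u + a • ξ) = w
      rw [map_add, map_smul, hξ, hu, smul_zero]
      exact add_zero w
    · change θ q (u + a • ξ) = t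
      rw [map_add, map_smul, hξ']
      simp [a]
  have hinj : Function.Injective L :=
    (LinearMap.injective_iff_surjective_of_finrank_eq_finrank (by simp [hdim])).2 hL
  exact hinj ((Prod.ext h1 h2 : L v = 0).trans (map_zero L).symm)

/-- A preimage under the derivative of `p` becomes horizontal after subtracting its vertical
component, which does not change its projection. -/
lemma isInvertible_horizontalProj [FiniteDimensional ℝ E] [FiniteDimensional ℝ F] {p : P → M}
    (hp : IsPrincipalCircleBundle (E := E) (F := F) p) {θ : OneForm F P}
    (hθ : IsPrincipalConnection θ) (hdim : Module.finrank ℝ F = Module.finrank ℝ E + 1) (q : P) :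
    (horizontalProj E p θ q).IsInvertible := by
  obtain ⟨ξ, hξ, hξ'⟩ := hθ.exists_vertical hp q
  have hbij : Function.Bijective (horizontalProj E p θ q).toLinearMap := by
    constructor
    · rw [← LinearMap.ker_eq_bot, LinearMap.ker_eq_bot']
      rintro ⟨v, hv⟩ hv'
      exact Subtype.ext (horizontal_ext hp hθ hdim q v hv' hv)
    · intro w
      obtain ⟨u, hu⟩ := hp.mfderiv_surjective q w
      refine ⟨⟨u - θ q u • ξ, ?_⟩, ?_⟩
      · change θ q (u - θ q u • ξ) = 0
        rw [map_sub, map_smul, hξ']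
        simp
      · change mfderiv 𝓘(ℝ, F) 𝓘(ℝ, E) p q (u - θ q u • ξ) = w
        rw [map_sub, map_smul, hξ, hu, smul_zero, sub_zero]
  have : FiniteDimensional ℝ (TangentSpace 𝓘(ℝ, F) q) := inferInstanceAs (FiniteDimensional ℝ F)
  have : T2Space (TangentSpace 𝓘(ℝ, F) q) := inferInstanceAs (T2Space F)
  have : T2Space (TangentSpace 𝓘(ℝ, E) (p q)) := inferInstanceAs (T2Space E)
  refine ⟨(LinearEquiv.ofBijective _ hbij).toContinuousLinearEquiv, ?_⟩
  ext v
  rfl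

/-- A nonzero multiple of the connection form is allowed because the pseudohermitian form is `θ/2π`.
The kernel, hence the horizontal lift, stays that of `θ`, and the vertical vector is rescaled by
`c⁻¹` to keep `η(T) = 1`. -/
lemma exists_isSplitting [IsManifold 𝓘(ℝ, E) ∞ M] [IsManifold 𝓘(ℝ, F) ∞ P] [FiniteDimensional ℝ E] [FiniteDimensional ℝ F] {p : P → M}
    (hp : IsPrincipalCircleBundle (E := E) (F := F) p) {θ : OneForm F P}
    (hθ : IsPrincipalConnection θ) (hdim : Module.finrank ℝ F = Module.finrank ℝ E + 1)
    {η : OneForm F P} {c : ℝ} (hc : c ≠ 0) (hη : ∀ q, η q = c • θ q) :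
    ∃ T : ∀ q : P, TangentSpace 𝓘(ℝ, F) q,
      IsSplitting p η (fun q => (horizontal θ q).subtypeL.comp (horizontalLift p θ q) :
        ∀ q : P, TangentSpace 𝓘(ℝ, E) (p q) →L[ℝ] TangentSpace 𝓘(ℝ, F) q) T := by
  -- A pointwise choice suffices: the two equations determine the vector, and
  -- `IsSplitting.contMDiffAt_T` recovers smoothness afterwards.
  choose ξ hξ hξ' using hθ.exists_vertical (E := E) hp
  refine ⟨fun q => c⁻¹ • ξ q, hp.smooth_proj, OneForm.smoothOn_smul hη hθ.smooth, ?_, ?_, ?_, ?_, ?_⟩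
  · intro q u
    exact (isInvertible_horizontalProj hp hθ hdim q).self_apply_inverse u
  · intro q u
    have h1 : θ q (horizontalLift p θ q u : TangentSpace 𝓘(ℝ, F) q) = 0 :=
      (horizontalLift p θ q u).2
    rw [hη]
    change c • θ q (horizontalLift p θ q u : TangentSpace 𝓘(ℝ, F) q) = 0
    rw [h1, smul_zero]
  · intro q
    rw [map_smul, hξ, smul_zero]
  · intro q
    rw [hη, map_smul]
    change c⁻¹ • c • θ q (ξ q) = 1
    rw [hξ']
    simp [hc]
  · intro q v h1 h2
    refine horizontal_ext hp hθ hdim q v h1 ?_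
    rw [hη] at h2
    exact (smul_eq_zero.1 h2).resolve_left hc

end PrincipalConnection

/-! ### Vector fields -/

section Fields

open VectorField

variable {E : Type*} [NormedAddCommGroup E] [NormedSpace ℝ E]
  {M : Type*} [TopologicalSpace M] [ChartedSpace E M] [IsManifold 𝓘(ℝ, E) ∞ M]
  {X Y Z : ∀ x : M, TangentSpace 𝓘(ℝ, E) x} {U : Set M} {x : M}

lemma DiffFieldAt.add (hX : DiffFieldAt X x) (hY : DiffFieldAt Y x) :
    DiffFieldAt (fun y => X y + Y y) x := mdifferentiableAt_add_section hX hY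

lemma DiffFieldAt.neg (hX : DiffFieldAt X x) : DiffFieldAt (fun y => -X y) x :=
  mdifferentiableAt_neg_section hX

lemma DiffFieldAt.smul {f : M → ℝ} (hf : MDifferentiableAt 𝓘(ℝ, E) 𝓘(ℝ, ℝ) f x)
    (hX : DiffFieldAt X x) : DiffFieldAt (fun y => f y • X y) x :=
  MDifferentiableAt.smul_section hf hX

lemma SmoothFieldOn.add (hX : SmoothFieldOn X U) (hY : SmoothFieldOn Y U) :
    SmoothFieldOn (fun y => X y + Y y) U := ContMDiffOn.add_section hX hY

lemma SmoothFieldOn.smul {f : M → ℝ} (hf : ContMDiffOn 𝓘(ℝ, E) 𝓘(ℝ, ℝ) ∞ f U)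
    (hX : SmoothFieldOn X U) : SmoothFieldOn (fun y => f y • X y) U :=
  ContMDiffOn.smul_section hf hX

lemma SmoothFieldOn.diffFieldAt (hX : SmoothFieldOn X U) (hU : IsOpen U) (hx : x ∈ U) :
    DiffFieldAt X x :=
  (hX.contMDiffAt (hU.mem_nhds hx)).mdifferentiableAt (by simp)

lemma DiffFieldAt.congr (hX : DiffFieldAt X x) (h : ∀ᶠ y in 𝓝 x, Y y = X y) : DiffFieldAt Y x := by
  refine MDifferentiableAt.congr_of_eventuallyEq hX ?_
  filter_upwards [h] with y hy
  rw [hy]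

lemma SmoothFieldOn.mono {V : Set M} (hX : SmoothFieldOn X U) (h : V ⊆ U) : SmoothFieldOn X V :=
  ContMDiffOn.mono hX h

lemma SmoothFieldOn.congr (hX : SmoothFieldOn X U) (h : ∀ y ∈ U, Y y = X y) :
    SmoothFieldOn Y U := by
  refine ContMDiffOn.congr hX fun y hy => ?_
  rw [h y hy]

lemma SmoothFieldOn.mlieBracket [CompleteSpace E] (hU : IsOpen U) (hX : SmoothFieldOn X U)
    (hY : SmoothFieldOn Y U) : SmoothFieldOn (mlieBracket 𝓘(ℝ, E) X Y) U := by
  intro y hy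
  refine ContMDiffAt.contMDiffWithinAt ?_
  have : IsManifold 𝓘(ℝ, E) ((⊤ : ℕ∞) + 1) M := by simpa
  have : IsManifold 𝓘(ℝ, E) (minSmoothness ℝ 2) M := by
    rw [minSmoothness_of_isRCLikeNormedField]
    infer_instance
  exact ContMDiffAt.mlieBracket_vectorField (n := ⊤) (m := ⊤) (hX.contMDiffAt (hU.mem_nhds hy))
    (hY.contMDiffAt (hU.mem_nhds hy)) (by simp)

lemma smoothFieldOn_extend (u : TangentSpace 𝓘(ℝ, E) x) :
    SmoothFieldOn (FiberBundle.extend E u : ∀ y : M, TangentSpace 𝓘(ℝ, E) y)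
      (chartAt E x).source :=
  contMDiffOn_constSection _ _

lemma extend_self (u : TangentSpace 𝓘(ℝ, E) x) :
    (FiberBundle.extend E u : ∀ y : M, TangentSpace 𝓘(ℝ, E) y) x = u :=
  FiberBundle.extend_apply_self ..

lemma diffFieldAt_extend (u : TangentSpace 𝓘(ℝ, E) x) :
    DiffFieldAt (FiberBundle.extend E u : ∀ y : M, TangentSpace 𝓘(ℝ, E) y) x :=
  (smoothFieldOn_extend u).diffFieldAt (chartAt E x).open_source (mem_chart_source E x)

/-- Coefficients of a vector field in the frame of sections with constant coordinates. -/
def frameCoeff {ι : Type*} (b : Module.Basis ι ℝ E) (c : M)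
    (X : ∀ x : M, TangentSpace 𝓘(ℝ, E) x) (i : ι) (y : M) : ℝ :=
  b.repr (trivializationAt E (TangentSpace 𝓘(ℝ, E)) c ⟨y, X y⟩).2 i

lemma sum_frameCoeff {ι : Type*} [Fintype ι] (b : Module.Basis ι ℝ E) {c y : M}
    (hy : y ∈ (chartAt E c).source) (X : ∀ x : M, TangentSpace 𝓘(ℝ, E) x) :
    X y = ∑ i, frameCoeff b c X i y • constSection c (b i) y := by
  have hb : y ∈ (trivializationAt E (TangentSpace 𝓘(ℝ, E)) c).baseSet := hy
  let e := Trivialization.continuousLinearEquivAt ℝ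
    (trivializationAt E (TangentSpace 𝓘(ℝ, E)) c) y hb
  have h1 : ∀ v, constSection c v y = e.symm v := fun v => rfl
  have h2 := b.sum_repr (e (X y))
  have h3 := congrArg e.symm h2
  rw [e.symm_apply_apply, map_sum] at h3
  rw [← h3]
  refine Finset.sum_congr rfl fun i _ => ?_
  exact map_smul e.symm _ _

lemma contMDiffOn_frameCoeff {ι : Type*} [Fintype ι] (b : Module.Basis ι ℝ E) {c : M}
    (hU : IsOpen U) (hX : SmoothFieldOn X U) (i : ι) [FiniteDimensional ℝ E] :
    ContMDiffOn 𝓘(ℝ, E) 𝓘(ℝ, ℝ) ∞ (frameCoeff b c X i) (U ∩ (chartAt E c).source) := by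
  rintro y ⟨hy, hy'⟩
  refine ContMDiffAt.contMDiffWithinAt ?_
  have hb : y ∈ (trivializationAt E (TangentSpace 𝓘(ℝ, E)) c).baseSet := hy'
  have h1 := ((trivializationAt E (TangentSpace 𝓘(ℝ, E)) c).contMDiffAt_section_iff hb).1
    (hX.contMDiffAt (hU.mem_nhds hy))
  let l : E →L[ℝ] ℝ := LinearMap.toContinuousLinearMap (b.coord i)
  exact l.contMDiff.contMDiffAt.comp y h1

end Fields

/-! ### Linear connections -/

section Connection

open VectorField

variable {E : Type*} [NormedAddCommGroup E] [NormedSpace ℝ E]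
  {M : Type*} [TopologicalSpace M] [ChartedSpace E M] [IsManifold 𝓘(ℝ, E) ∞ M]
  {X Y Z V W : ∀ x : M, TangentSpace 𝓘(ℝ, E) x} {U : Set M} {x : M}
  (nabla : LinearConnection E M)

namespace LinearConnection

lemma map_congr (hY : DiffFieldAt Y x) (h : ∀ᶠ y in 𝓝 x, Z y = Y y) : nabla Z x = nabla Y x :=
  nabla.isCovariantDerivativeOn.congr_of_eventuallyEq (hY.congr h) hY Filter.univ_mem h

lemma map_add (hY : DiffFieldAt Y x) (hZ : DiffFieldAt Z x) (u : TangentSpace 𝓘(ℝ, E) x) :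
    nabla (fun y => Y y + Z y) x u = nabla Y x u + nabla Z x u :=
  congr($(nabla.isCovariantDerivativeOnUniv.add hY hZ) u)

lemma map_smul {f : M → ℝ} (hf : MDifferentiableAt 𝓘(ℝ, E) 𝓘(ℝ, ℝ) f x) (hY : DiffFieldAt Y x)
    (u : TangentSpace 𝓘(ℝ, E) x) :
    nabla (fun y => f y • Y y) x u = f x • nabla Y x u + mvfderiv 𝓘(ℝ, E) f x u • Y x := by
  have := congr($(nabla.isCovariantDerivativeOnUniv.leibniz hY hf) u)
  exact this

lemma map_neg (hY : DiffFieldAt Y x) (u : TangentSpace 𝓘(ℝ, E) x) :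
    nabla (fun y => -Y y) x u = -nabla Y x u := by
  have h := congr($(nabla.isCovariantDerivativeOnUniv.smul_const (-1 : ℝ) hY) u)
  have h2 : ((-1 : ℝ) • Y) = fun y => -Y y := by
    funext y
    exact neg_one_smul ℝ _
  rw [h2] at h
  exact h.trans (neg_one_smul ℝ _)

lemma map_sub (hY : DiffFieldAt Y x) (hZ : DiffFieldAt Z x) (u : TangentSpace 𝓘(ℝ, E) x) :
    nabla (fun y => Y y - Z y) x u = nabla Y x u - nabla Z x u := by
  simp only [sub_eq_add_neg]
  rw [map_add nabla hY hZ.neg, map_neg nabla hZ]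

variable {nabla} [FiniteDimensional ℝ E] [T2Space M]

/-- The smoothness condition on a connection is used for globally smooth fields. A bump function
equal to `1` near `x` makes `Y` global without changing its covariant derivative near `x`. -/
lemma contMDiffAt_hom (hn : CovariantDerivative.ContMDiffCovariantDerivative nabla ∞)
    (hU : IsOpen U) (hx : x ∈ U) (hY : SmoothFieldOn Y U) :
    ContMDiffAt 𝓘(ℝ, E) (𝓘(ℝ, E).prod 𝓘(ℝ, E →L[ℝ] E)) ∞
      (fun y => TotalSpace.mk' (E →L[ℝ] E)
        (E := fun y : M => TangentSpace 𝓘(ℝ, E) y →L[ℝ] TangentSpace 𝓘(ℝ, E) y) y (nabla Y y)) x := by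
  obtain ⟨f, -, hf⟩ := (SmoothBumpFunction.nhds_basis_tsupport (I := 𝓘(ℝ, E)) x).mem_iff.1
    (hU.mem_nhds hx)
  have h1 : ContMDiff 𝓘(ℝ, E) 𝓘(ℝ, E).tangent ∞
      (fun y => (⟨y, ((f : M → ℝ) • Y) y⟩ : TangentBundle 𝓘(ℝ, E) M)) :=
    ContMDiffOn.smul_section_of_tsupport f.contMDiff.contMDiffOn hU hf hY
  have h2 := hn.contMDiff.contMDiff (σ := (f : M → ℝ) • Y) (by simpa using h1.contMDiffOn)
  have h3 := h2.contMDiffAt (x := x) Filter.univ_mem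
  refine h3.congr_of_eventuallyEq ?_
  filter_upwards [f.eventuallyEq_one.eventuallyEq_nhds, hU.mem_nhds hx] with y hy hyU
  have h4 := map_congr nabla (hY.diffFieldAt hU hyU) (Z := (f : M → ℝ) • Y) (by
    filter_upwards [hy] with z hz
    change f z • Y z = Y z
    rw [hz]
    exact one_smul ℝ _)
  exact congrArg (TotalSpace.mk' (E →L[ℝ] E)
        (E := fun y : M => TangentSpace 𝓘(ℝ, E) y →L[ℝ] TangentSpace 𝓘(ℝ, E) y) y) h4.symm

lemma smoothFieldOn_apply (hn : CovariantDerivative.ContMDiffCovariantDerivative nabla ∞)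
    (hU : IsOpen U) (hY : SmoothFieldOn Y U) (hX : SmoothFieldOn X U) :
    SmoothFieldOn (fun y => nabla Y y (X y)) U := fun _ hy =>
  ContMDiffAt.contMDiffWithinAt <|
    ContMDiffAt.clm_bundle_apply (contMDiffAt_hom hn hU hy hY) (hX.contMDiffAt (hU.mem_nhds hy))

lemma diffFieldAt_apply (hn : CovariantDerivative.ContMDiffCovariantDerivative nabla ∞)
    (hU : IsOpen U) (hx : x ∈ U) (hY : SmoothFieldOn Y U) (hX : DiffFieldAt X x) :
    DiffFieldAt (fun y => nabla Y y (X y)) x :=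
  MDifferentiableAt.clm_bundle_apply
    ((contMDiffAt_hom hn hU hx hY).mdifferentiableAt (by simp)) hX

end LinearConnection

end Connection

/-! ### Tensoriality of the curvature -/

section Curvature

open VectorField

variable {E : Type*} [NormedAddCommGroup E] [NormedSpace ℝ E]
  {M : Type*} [TopologicalSpace M] [ChartedSpace E M] [IsManifold 𝓘(ℝ, E) ∞ M]
  {X X' Y Y' Z V W W' : ∀ x : M, TangentSpace 𝓘(ℝ, E) x} {U : Set M} {x : M}
  {nabla : LinearConnection E M}

variable (nabla) in
/-- The expression `∇_X ∇_Y W - ∇_Y ∇_X W - ∇_{[X, Y]} W` for vector fields. -/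
def curvatureOp (X Y W : ∀ x : M, TangentSpace 𝓘(ℝ, E) x) (x : M) : TangentSpace 𝓘(ℝ, E) x :=
  nabla (fun y => nabla W y (Y y)) x (X x) - nabla (fun y => nabla W y (X y)) x (Y x)
    - nabla W x (mlieBracket 𝓘(ℝ, E) X Y x)

lemma curvature_eq_curvatureOp_extend (u v w : TangentSpace 𝓘(ℝ, E) x) :
    curvature nabla x u v w = curvatureOp nabla (FiberBundle.extend E u) (FiberBundle.extend E v)
      (FiberBundle.extend E w) x := by
  simp only [curvature, curvatureOp, extend_self]

lemma curvatureOp_swap : curvatureOp nabla X Y W x = -curvatureOp nabla Y X W x := by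
  simp only [curvatureOp]
  rw [mlieBracket_swap_apply, map_neg]
  abel

lemma mlieBracket_add_left' [CompleteSpace E] (hX : DiffFieldAt X x) (hX' : DiffFieldAt X' x) :
    mlieBracket 𝓘(ℝ, E) (fun y => X y + X' y) Y x
      = mlieBracket 𝓘(ℝ, E) X Y x + mlieBracket 𝓘(ℝ, E) X' Y x :=
  mlieBracket_add_left hX hX'

lemma mlieBracket_smul_left' [CompleteSpace E] {f : M → ℝ} (hf : MDifferentiableAt 𝓘(ℝ, E) 𝓘(ℝ, ℝ) f x)
    (hX : DiffFieldAt X x) :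
    mlieBracket 𝓘(ℝ, E) (fun y => f y • X y) Y x
      = -(mvfderiv 𝓘(ℝ, E) f x (Y x) • X x) + f x • mlieBracket 𝓘(ℝ, E) X Y x :=
  (mlieBracket_smul_left hf hX).trans (by rw [neg_smul])

variable [FiniteDimensional ℝ E] [T2Space M]

/-- When `X` is multiplied by `f`, the term `(Y f) ∇_X W` arises once from the Leibniz rule and
once, with the opposite sign, from `[f X, Y]`. -/
lemma tensorialAt_curvatureOp (hn : CovariantDerivative.ContMDiffCovariantDerivative nabla ∞)
    (hU : IsOpen U) (hx : x ∈ U) (hW : SmoothFieldOn W U) :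
    TensorialAt 𝓘(ℝ, E) E (fun X => curvatureOp nabla X Y W x) x where
  smul {f X} hf hX := by
    have h1 : nabla (fun y => nabla W y ((f • X) y)) x (Y x)
        = f x • nabla (fun y => nabla W y (X y)) x (Y x)
          + mvfderiv 𝓘(ℝ, E) f x (Y x) • nabla W x (X x) := by
      rw [← LinearConnection.map_smul nabla hf
        (LinearConnection.diffFieldAt_apply hn hU hx hW hX)]
      congr 2
      funext y
      exact map_smul _ _ _
    have h2 := mlieBracket_smul_left' (Y := Y) hf hX
    have h3 : (fun y => f y • X y) = f • X := rfl
    rw [h3] at h2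
    have h4 : (f • X) x = f x • X x := rfl
    simp only [curvatureOp, h1, h2, h4, map_add, map_smul, map_neg]
    module
  add {X X'} hX hX' := by
    have h1 : nabla (fun y => nabla W y ((X + X') y)) x (Y x)
        = nabla (fun y => nabla W y (X y)) x (Y x) + nabla (fun y => nabla W y (X' y)) x (Y x) := by
      rw [← LinearConnection.map_add nabla (LinearConnection.diffFieldAt_apply hn hU hx hW hX)
        (LinearConnection.diffFieldAt_apply hn hU hx hW hX')]
      congr 2
      funext y
      exact map_add _ _ _
    have h2 := mlieBracket_add_left' (Y := Y) hX hX'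
    have h3 : (fun y => X y + X' y) = X + X' := rfl
    rw [h3] at h2
    have h4 : (X + X') x = X x + X' x := rfl
    simp only [curvatureOp, h1, h2, h4, map_add]
    abel

lemma curvatureOp_congr (hn : CovariantDerivative.ContMDiffCovariantDerivative nabla ∞)
    (hU : IsOpen U) (hx : x ∈ U) (hW : SmoothFieldOn W U) (hX : DiffFieldAt X x)
    (hX' : DiffFieldAt X' x) (hY : DiffFieldAt Y x) (hY' : DiffFieldAt Y' x) (h : X x = X' x)
    (h' : Y x = Y' x) : curvatureOp nabla X Y W x = curvatureOp nabla X' Y' W x := by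
  have h1 := (tensorialAt_curvatureOp (Y := Y) hn hU hx hW).pointwise hX hX' h
  have h2 := (tensorialAt_curvatureOp (Y := X') hn hU hx hW).pointwise hY hY' h'
  rw [h1, curvatureOp_swap, h2, ← curvatureOp_swap]

lemma curvatureOp_congr_section (hU : IsOpen U) (hx : x ∈ U) (hW : SmoothFieldOn W U)
    (h : ∀ y ∈ U, W' y = W y)
    (hn : CovariantDerivative.ContMDiffCovariantDerivative nabla ∞)
    (hX : DiffFieldAt X x) (hY : DiffFieldAt Y x) :
    curvatureOp nabla X Y W' x = curvatureOp nabla X Y W x := by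
  have h1 : ∀ y ∈ U, nabla W' y = nabla W y := fun y hy =>
    LinearConnection.map_congr nabla (hW.diffFieldAt hU hy)
      (Filter.mem_of_superset (hU.mem_nhds hy) h)
  have h2 : ∀ {Z : ∀ x : M, TangentSpace 𝓘(ℝ, E) x}, DiffFieldAt Z x →
      nabla (fun y => nabla W' y (Z y)) x = nabla (fun y => nabla W y (Z y)) x := by
    intro Z hZ
    refine LinearConnection.map_congr nabla
      (LinearConnection.diffFieldAt_apply hn hU hx hW hZ) ?_
    filter_upwards [hU.mem_nhds hx] with y hy
    rw [h1 y hy]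
  simp only [curvatureOp]
  rw [h2 hX, h2 hY, h1 x hx]

lemma curvatureOp_add (hn : CovariantDerivative.ContMDiffCovariantDerivative nabla ∞)
    (hU : IsOpen U) (hx : x ∈ U) (hW : SmoothFieldOn W U) (hW' : SmoothFieldOn W' U)
    (hX : DiffFieldAt X x) (hY : DiffFieldAt Y x) :
    curvatureOp nabla X Y (fun y => W y + W' y) x
      = curvatureOp nabla X Y W x + curvatureOp nabla X Y W' x := by
  have h2 : ∀ {Z : ∀ x : M, TangentSpace 𝓘(ℝ, E) x} {u}, DiffFieldAt Z x →
      nabla (fun y => nabla (fun z => W z + W' z) y (Z y)) x u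
        = nabla (fun y => nabla W y (Z y)) x u + nabla (fun y => nabla W' y (Z y)) x u := by
    intro Z u hZ
    rw [← LinearConnection.map_add nabla (LinearConnection.diffFieldAt_apply hn hU hx hW hZ)
      (LinearConnection.diffFieldAt_apply hn hU hx hW' hZ)]
    refine congr($(LinearConnection.map_congr nabla ((LinearConnection.diffFieldAt_apply hn hU hx hW hZ).add
      (LinearConnection.diffFieldAt_apply hn hU hx hW' hZ)) ?_) u)
    filter_upwards [hU.mem_nhds hx] with y hy
    exact LinearConnection.map_add nabla (hW.diffFieldAt hU hy) (hW'.diffFieldAt hU hy) _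
  simp only [curvatureOp]
  rw [h2 hX, h2 hY, LinearConnection.map_add nabla (hW.diffFieldAt hU hx) (hW'.diffFieldAt hU hx)]
  abel

/-- Two applications of the Leibniz rule give first-order terms symmetric in `X` and `Y`, which
cancel, and the second-order term `X(Y f) - Y(X f)`, which is removed by the derivative of `f` along
`[X, Y]`. -/
lemma curvatureOp_smul (hn : CovariantDerivative.ContMDiffCovariantDerivative nabla ∞)
    (hU : IsOpen U) (hx : x ∈ U) (hW : SmoothFieldOn W U) {f : M → ℝ}
    (hf : ContMDiffOn 𝓘(ℝ, E) 𝓘(ℝ, ℝ) ∞ f U)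
    (hX : DiffFieldAt X x) (hY : DiffFieldAt Y x) :
    curvatureOp nabla X Y (fun y => f y • W y) x = f x • curvatureOp nabla X Y W x := by
  have hfd : ∀ y ∈ U, MDifferentiableAt 𝓘(ℝ, E) 𝓘(ℝ, ℝ) f y := fun y hy =>
    (hf.contMDiffAt (hU.mem_nhds hy)).mdifferentiableAt (by simp)
  have hf2 : ContMDiffAt 𝓘(ℝ, E) 𝓘(ℝ, ℝ) 2 f x :=
    (hf.contMDiffAt (hU.mem_nhds hx)).of_le two_le_smooth
  have hWx := hW.diffFieldAt hU hx
  have h2 : ∀ {Z : ∀ x : M, TangentSpace 𝓘(ℝ, E) x} {u}, DiffFieldAt Z x →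
      nabla (fun y => nabla (fun z => f z • W z) y (Z y)) x u
        = f x • nabla (fun y => nabla W y (Z y)) x u + mvfderiv 𝓘(ℝ, E) f x u • nabla W x (Z x)
          + (mvfderiv 𝓘(ℝ, E) f x (Z x) • nabla W x u
            + mvfderiv 𝓘(ℝ, E) (fun y => mvfderiv 𝓘(ℝ, E) f y (Z y)) x u • W x) := by
    intro Z u hZ
    have h3 := LinearConnection.diffFieldAt_apply hn hU hx hW hZ
    have h4 := mdifferentiableAt_mvfderiv_apply hZ hf2
    rw [← LinearConnection.map_smul nabla (hfd x hx) h3, ← LinearConnection.map_smul nabla h4 hWx,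
      ← LinearConnection.map_add nabla (h3.smul (hfd x hx)) (hWx.smul h4)]
    refine congr($(LinearConnection.map_congr nabla ((h3.smul (hfd x hx)).add (hWx.smul h4)) ?_) u)
    filter_upwards [hU.mem_nhds hx] with y hy
    exact LinearConnection.map_smul nabla (hfd y hy) (hW.diffFieldAt hU hy) _
  simp only [curvatureOp]
  rw [h2 hX, h2 hY, LinearConnection.map_smul nabla (hfd x hx) hWx, mvfderiv_mlieBracket hX hY hf2]
  module

lemma curvatureOp_zero :
    curvatureOp nabla X Y (fun _ => 0) x = 0 := by
  have h : nabla (fun _ => 0) = 0 := CovariantDerivative.zero nabla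
  simp only [curvatureOp, h]
  have h' : nabla (fun _ => 0) x = 0 := congrFun h x
  change nabla (fun _ => 0) x (X x) - nabla (fun _ => 0) x (Y x) - 0 = 0
  rw [h']
  simp

lemma curvatureOp_sum (hn : CovariantDerivative.ContMDiffCovariantDerivative nabla ∞)
    (hU : IsOpen U) (hx : x ∈ U) {ι : Type*} (s : Finset ι)
    {w : ι → ∀ x : M, TangentSpace 𝓘(ℝ, E) x} (hw : ∀ i, SmoothFieldOn (w i) U) {f : ι → M → ℝ}
    (hf : ∀ i, ContMDiffOn 𝓘(ℝ, E) 𝓘(ℝ, ℝ) ∞ (f i) U)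
    (hX : DiffFieldAt X x) (hY : DiffFieldAt Y x) :
    curvatureOp nabla X Y (fun y => ∑ i ∈ s, f i y • w i y) x
      = ∑ i ∈ s, f i x • curvatureOp nabla X Y (w i) x := by
  classical
  have hs : ∀ s : Finset ι, SmoothFieldOn (fun y => ∑ i ∈ s, f i y • w i y) U := fun s =>
    ContMDiffOn.sum_section fun i _ => (hw i).smul (hf i)
  induction s using Finset.induction_on with
  | empty => simpa using (curvatureOp_zero (X := X) (Y := Y) (x := x) (nabla := nabla))
  | insert a s ha ih =>
    simp only [Finset.sum_insert ha]
    rw [curvatureOp_add hn hU hx ((hw a).smul (hf a)) (hs s) hX hY, ih,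
      curvatureOp_smul hn hU hx (hw a) (hf a) hX hY]

/-- The curvature computed with arbitrary extensions of the vectors. -/
lemma curvature_apply (hn : CovariantDerivative.ContMDiffCovariantDerivative nabla ∞)
    (hU : IsOpen U) (hx : x ∈ U) (hW : SmoothFieldOn W U) (hX : DiffFieldAt X x)
    (hY : DiffFieldAt Y x) :
    curvature nabla x (X x) (Y x) (W x) = curvatureOp nabla X Y W x := by
  rw [curvature_eq_curvatureOp_extend]
  have hC := (chartAt E x).open_source
  have hxC := mem_chart_source E x
  rw [curvatureOp_congr hn hC hxC (smoothFieldOn_extend (W x)) (diffFieldAt_extend _) hX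
    (diffFieldAt_extend _) hY (extend_self _) (extend_self _)]
  set U' := U ∩ (chartAt E x).source
  have hU' : IsOpen U' := hU.inter hC
  have hxU' : x ∈ U' := ⟨hx, hxC⟩
  let b := Module.finBasis ℝ E
  -- Expanding in a local frame with smooth coefficients shows that the third argument enters only
  -- through its value at `x`.
  have key : ∀ V : ∀ x : M, TangentSpace 𝓘(ℝ, E) x, SmoothFieldOn V U' →
      curvatureOp nabla X Y V x = ∑ i, b.repr (trivializationAt E (TangentSpace 𝓘(ℝ, E)) x
        ⟨x, V x⟩).2 i • curvatureOp nabla X Y (constSection x (b i)) x := by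
    intro V hV
    have hc : ∀ i, ContMDiffOn 𝓘(ℝ, E) 𝓘(ℝ, ℝ) ∞ (frameCoeff b x V i) U' := fun i =>
      (contMDiffOn_frameCoeff b hU' hV i).mono fun y hy => ⟨hy, hy.2⟩
    have he : ∀ i, SmoothFieldOn (constSection (E₁ := E) x (b i)) U' := fun i =>
      (contMDiffOn_constSection x (b i)).mono inter_subset_right
    have h1 := curvatureOp_sum hn hU' hxU' Finset.univ he hc hX hY
    rw [← curvatureOp_congr_section hU' hxU' hV (fun y hy => (sum_frameCoeff b hy.2 V).symm)
      hn hX hY, h1]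
    rfl
  rw [key _ ((smoothFieldOn_extend (W x)).mono inter_subset_right),
    key _ (hW.mono inter_subset_left), extend_self]

variable {u u' v w w' : TangentSpace 𝓘(ℝ, E) x}

lemma curvature_swap : curvature nabla x u v w = -curvature nabla x v u w := by
  simp only [curvature_eq_curvatureOp_extend]
  exact curvatureOp_swap

lemma curvature_add_left (hn : CovariantDerivative.ContMDiffCovariantDerivative nabla ∞) :
    curvature nabla x (u + u') v w = curvature nabla x u v w + curvature nabla x u' v w := by
  have hC := (chartAt E x).open_source
  have hxC := mem_chart_source E x
  have hw := smoothFieldOn_extend w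
  have h1 := (tensorialAt_curvatureOp (Y := FiberBundle.extend E v) hn hC hxC hw).add
    (diffFieldAt_extend u) (diffFieldAt_extend u')
  have h2 := curvature_apply hn hC hxC hw
    ((diffFieldAt_extend u).add (diffFieldAt_extend u')) (diffFieldAt_extend v)
  simp only [extend_self] at h2
  rw [h2, curvature_eq_curvatureOp_extend, curvature_eq_curvatureOp_extend]
  exact h1

lemma curvature_smul_left (hn : CovariantDerivative.ContMDiffCovariantDerivative nabla ∞) (a : ℝ) :
    curvature nabla x (a • u) v w = a • curvature nabla x u v w := by
  have hC := (chartAt E x).open_source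
  have hxC := mem_chart_source E x
  have hw := smoothFieldOn_extend w
  have ha : MDifferentiableAt 𝓘(ℝ, E) 𝓘(ℝ, ℝ) (fun _ : M => a) x := mdifferentiableAt_const
  have h1 := (tensorialAt_curvatureOp (Y := FiberBundle.extend E v) hn hC hxC hw).smul ha
    (diffFieldAt_extend u)
  have h2 := curvature_apply hn hC hxC hw ((diffFieldAt_extend u).smul ha) (diffFieldAt_extend v)
  simp only [extend_self] at h2
  rw [h2, curvature_eq_curvatureOp_extend]
  exact h1

lemma curvature_add_right (hn : CovariantDerivative.ContMDiffCovariantDerivative nabla ∞) :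
    curvature nabla x u v (w + w') = curvature nabla x u v w + curvature nabla x u v w' := by
  have hC := (chartAt E x).open_source
  have hxC := mem_chart_source E x
  have hw := smoothFieldOn_extend w
  have hw' := smoothFieldOn_extend w'
  have h1 := curvatureOp_add hn hC hxC hw hw' (diffFieldAt_extend u) (diffFieldAt_extend v)
  have h2 := curvature_apply hn hC hxC (hw.add hw') (diffFieldAt_extend u) (diffFieldAt_extend v)
  simp only [extend_self] at h2
  rw [h2, curvature_eq_curvatureOp_extend, curvature_eq_curvatureOp_extend]
  exact h1

lemma curvature_smul_right (hn : CovariantDerivative.ContMDiffCovariantDerivative nabla ∞) (a : ℝ) :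
    curvature nabla x u v (a • w) = a • curvature nabla x u v w := by
  have hC := (chartAt E x).open_source
  have hxC := mem_chart_source E x
  have hw := smoothFieldOn_extend w
  have ha : ContMDiffOn 𝓘(ℝ, E) 𝓘(ℝ, ℝ) ∞ (fun _ : M => a) (chartAt E x).source :=
    contMDiffOn_const
  have h1 := curvatureOp_smul hn hC hxC hw ha (diffFieldAt_extend u) (diffFieldAt_extend v)
  have h2 := curvature_apply hn hC hxC (hw.smul ha) (diffFieldAt_extend u) (diffFieldAt_extend v)
  simp only [extend_self] at h2
  rw [h2, curvature_eq_curvatureOp_extend]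
  exact h1

/-- The curvature at a point as a trilinear map. -/
def curvatureHom (hn : CovariantDerivative.ContMDiffCovariantDerivative nabla ∞) (x : M) :
    E →ₗ[ℝ] E →ₗ[ℝ] E →ₗ[ℝ] E :=
  LinearMap.mk₂ ℝ (fun u v : E =>
      ({ toFun := fun w => curvature nabla x u v w
         map_add' := fun _ _ => curvature_add_right hn
         map_smul' := fun a _ => curvature_smul_right hn a } : E →ₗ[ℝ] E))
    (fun _ _ _ => LinearMap.ext fun _ => curvature_add_left hn)
    (fun a _ _ => LinearMap.ext fun _ => curvature_smul_left hn a)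
    (fun u v v' => LinearMap.ext fun w => by
      have h1 : curvature nabla x u (v + v' : E) w = -curvature nabla x (v + v' : E) u w :=
        curvature_swap
      have h2 : curvature nabla x (v + v' : E) u w
        = curvature nabla x v u w + curvature nabla x v' u w := curvature_add_left hn
      have h3 : curvature nabla x u v w = -curvature nabla x v u w := curvature_swap
      have h4 : curvature nabla x u v' w = -curvature nabla x v' u w := curvature_swap
      refine (h1.trans (congrArg Neg.neg h2)).trans ?_
      refine Eq.trans ?_ (congr($(h3.symm) + $(h4.symm)))
      exact neg_add _ _)
    (fun a u v => LinearMap.ext fun w => by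
      have h1 : curvature nabla x u (a • v : E) w = -curvature nabla x (a • v : E) u w :=
        curvature_swap
      have h2 : curvature nabla x (a • v : E) u w = a • curvature nabla x v u w :=
        curvature_smul_left hn a
      have h3 : curvature nabla x u v w = -curvature nabla x v u w := curvature_swap
      refine (h1.trans (congrArg Neg.neg h2)).trans ?_
      refine Eq.trans ?_ (congrArg (a • ·) h3.symm)
      exact (smul_neg _ _).symm)

end Curvature

/-! ### The Kähler metric -/

section KahlerMetric

variable {E : Type*} [NormedAddCommGroup E] [NormedSpace ℝ E]
  {M : Type*} [TopologicalSpace M] [ChartedSpace E M]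

namespace DiffForm

variable (α : DiffForm E M 2) (x : M) (u u' v v' : TangentSpace 𝓘(ℝ, E) x) (a : ℝ)

lemma swap₂ : α x ![u, v] = -α x ![v, u] := by
  have h := (α x).toAlternatingMap.map_swap ![u, v] (i := 0) (j := 1) (by decide)
  have h2 : (![u, v] : Fin 2 → TangentSpace 𝓘(ℝ, E) x) ∘ Equiv.swap 0 1 = ![v, u] := by
    funext i
    fin_cases i <;> rfl
  rw [h2] at h
  exact (neg_eq_iff_eq_neg.2 h).symm

lemma add_left₂ : α x ![u + u', v] = α x ![u, v] + α x ![u', v] := by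
  have h := (α x).toAlternatingMap.map_update_add ![u, v] 0 u u'
  have h2 : ∀ w, Function.update (![u, v] : Fin 2 → TangentSpace 𝓘(ℝ, E) x) 0 w = ![w, v] := by
    intro w
    funext i
    fin_cases i <;> rfl
  rw [h2, h2, h2] at h
  exact h

lemma smul_left₂ : α x ![a • u, v] = a * α x ![u, v] := by
  have h := (α x).toAlternatingMap.map_update_smul ![u, v] 0 a u
  have h2 : ∀ w, Function.update (![u, v] : Fin 2 → TangentSpace 𝓘(ℝ, E) x) 0 w = ![w, v] := by
    intro w
    funext i
    fin_cases i <;> rfl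
  rw [h2, h2] at h
  exact h

lemma add_right₂ : α x ![u, v + v'] = α x ![u, v] + α x ![u, v'] := by
  rw [swap₂, add_left₂, swap₂ α x v u, swap₂ α x v' u]
  ring

lemma smul_right₂ : α x ![u, a • v] = a * α x ![u, v] := by
  rw [swap₂, smul_left₂, swap₂ α x v u]
  ring

lemma neg_left₂ : α x ![-u, v] = -α x ![u, v] := by
  have h := smul_left₂ α x u v (-1)
  rw [neg_one_smul] at h
  rw [h]
  ring

lemma neg_right₂ : α x ![u, -v] = -α x ![u, v] := by
  rw [swap₂, neg_left₂, ← swap₂]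

lemma zero_left₂ : α x ![0, v] = 0 := by
  have h := smul_left₂ α x 0 v 0
  rw [zero_smul] at h
  rw [h, zero_mul]

end DiffForm

variable [IsManifold 𝓘(ℝ, E) ∞ M]
  {J : ∀ x : M, TangentSpace 𝓘(ℝ, E) x →L[ℝ] TangentSpace 𝓘(ℝ, E) x} {omega : DiffForm E M 2}
  {x : M} {u u' v v' : TangentSpace 𝓘(ℝ, E) x}

lemma kahlerMetric_symm (h : IsKahler J omega) :
    kahlerMetric J omega x u v = kahlerMetric J omega x v u := by
  simp only [kahlerMetric]
  rw [← h.invariant x u (J x v), h.complex.sq, DiffForm.neg_right₂, ← DiffForm.swap₂]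

lemma kahlerMetric_J (h : IsKahler J omega) :
    kahlerMetric J omega x (J x u) (J x v) = kahlerMetric J omega x u v :=
  h.invariant x u (J x v)

lemma kahlerMetric_J_left (h : IsKahler J omega) :
    kahlerMetric J omega x (J x u) v = -kahlerMetric J omega x u (J x v) := by
  rw [← kahlerMetric_J h, h.complex.sq]
  simp only [kahlerMetric]
  exact DiffForm.neg_left₂ _ _ _ _

lemma apply_eq_kahlerMetric (h : IsKahler J omega) :
    omega x ![u, v] = kahlerMetric J omega x (J x u) v :=
  (h.invariant x u v).symm

lemma kahlerMetric_add_left : kahlerMetric J omega x (u + u') v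
    = kahlerMetric J omega x u v + kahlerMetric J omega x u' v :=
  DiffForm.add_left₂ _ _ _ _ _

lemma kahlerMetric_add_right : kahlerMetric J omega x u (v + v')
    = kahlerMetric J omega x u v + kahlerMetric J omega x u v' := by
  simp only [kahlerMetric, map_add, DiffForm.add_right₂]

lemma kahlerMetric_smul_left (a : ℝ) : kahlerMetric J omega x (a • u) v
    = a * kahlerMetric J omega x u v :=
  DiffForm.smul_left₂ _ _ _ _ _

lemma kahlerMetric_smul_right (a : ℝ) : kahlerMetric J omega x u (a • v)
    = a * kahlerMetric J omega x u v := by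
  simp only [kahlerMetric, map_smul, DiffForm.smul_right₂]

lemma kahlerMetric_neg_left : kahlerMetric J omega x (-u) v = -kahlerMetric J omega x u v :=
  DiffForm.neg_left₂ _ _ _ _

lemma kahlerMetric_neg_right : kahlerMetric J omega x u (-v) = -kahlerMetric J omega x u v := by
  simp only [kahlerMetric, map_neg, DiffForm.neg_right₂]

lemma kahlerMetric_sub_left : kahlerMetric J omega x (u - u') v
    = kahlerMetric J omega x u v - kahlerMetric J omega x u' v := by
  rw [sub_eq_add_neg, kahlerMetric_add_left, kahlerMetric_neg_left]
  exact (sub_eq_add_neg _ _).symm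

lemma eq_zero_of_kahlerMetric (h : IsKahler J omega)
    (hu : ∀ v, kahlerMetric J omega x u v = 0) : u = 0 := by
  by_contra hne
  exact (h.pos x u hne).ne' (hu u)

end KahlerMetric

/-! ### The complex structure of a Kähler manifold is parallel -/

section ParallelComplexStructure

open VectorField

variable {E : Type*} [NormedAddCommGroup E] [NormedSpace ℝ E] [FiniteDimensional ℝ E]
  {M : Type*} [TopologicalSpace M] [ChartedSpace E M] [IsManifold 𝓘(ℝ, E) ∞ M]
  {J : ∀ x : M, TangentSpace 𝓘(ℝ, E) x →L[ℝ] TangentSpace 𝓘(ℝ, E) x} {omega : DiffForm E M 2}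
  {x : M} {U : Set M} {X Y Z : ∀ x : M, TangentSpace 𝓘(ℝ, E) x}

/-- The definition says only that `J` maps smooth fields to smooth fields. As a smooth family of
operators, `J` can also be applied to fields that are merely differentiable at one point. -/
lemma IsComplexStructure.smoothHomAt (hJ : IsComplexStructure J) (x : M) :
    SmoothHomAt E (fun y : M => y) (fun y => y) J x :=
  SmoothHomAt.of_apply_constSection continuousAt_id fun v =>
    (hJ.smooth _ (chartAt E x).open_source _ (contMDiffOn_constSection x v)).contMDiffAt
      ((chartAt E x).open_source.mem_nhds (mem_chart_source E x))

lemma IsComplexStructure.diffFieldAt (hJ : IsComplexStructure J) (hY : DiffFieldAt Y x) :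
    DiffFieldAt (fun y => J y (Y y)) x :=
  (hJ.smoothHomAt x).mdifferentiableAt_apply contMDiffAt_id hY

/-- The algebraic core: a tensor with the symmetries of `g((∇_u J) v, w)` vanishes. -/
lemma eq_zero_of_kahler_symmetries {V : Type*} [AddCommGroup V] (J : V → V) (hJ : ∀ u, J (J u) = -u)
    (a : V → V → V → ℝ) (hneg : ∀ u v w, a u v (-w) = -a u v w)
    (skew : ∀ u v w, a u v w = -a u w v) (hJ₂ : ∀ u v w, a u (J v) w = a u v (J w))
    (cyc : ∀ u v w, a u v w + a v w u + a w u v = 0)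
    (nij : ∀ u v w, a (J u) v w + a u v (J w) = a (J v) u w + a v u (J w)) (u v w : V) :
    a u v w = 0 := by
  -- The hypothesis `nij` says that `c` is symmetric in its first two arguments, and `skew` with
  -- `hJ₂` makes it skew in the last two. Alternating the two symmetries around the permutations
  -- gives `c = -c`.
  let c : V → V → V → ℝ := fun u v w => a (J u) v w + a u v (J w)
  have c1 : ∀ u v w, c u v w = c v u w := nij
  have c2 : ∀ u v w, c u v w = -c u w v := by
    intro u v w
    have h1 := skew (J u) v w
    have h2 := skew u v (J w)
    have h3 := hJ₂ u w v
    simp only [c]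
    linarith
  have c0 : ∀ u v w, c u v w = 0 := by
    intro u v w
    have h1 := c1 u v w
    have h2 := c2 v u w
    have h3 := c1 v w u
    have h4 := c2 w v u
    have h5 := c1 w u v
    have h6 := c2 u w v
    linarith
  suffices H : ∀ u v w, a w u v = 0 from H v w u
  intro u v w
  -- Since `c = 0`, the cyclic sum at `(J u, J v, w)` has the same first two terms as the one at
  -- `(u, v, w)` and the opposite third term; comparing the two sums kills the third term.
  have h1 := c0 u (J v) w
  have h2 := c0 v w (J u)
  have h3 := cyc (J u) (J v) w
  have h4 := cyc u v w
  simp only [c, hJ₂, hJ, hneg] at h1 h2 h3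
  have h5 := hJ₂ w u (J v)
  rw [hJ, hneg] at h5
  linarith

variable {nabla : LinearConnection E M}

lemma IsLeviCivita.mlieBracket_eq {g : ∀ x : M, TangentSpace 𝓘(ℝ, E) x → TangentSpace 𝓘(ℝ, E) x → ℝ}
    (hL : IsLeviCivita g nabla) (hX : DiffFieldAt X x) (hY : DiffFieldAt Y x) :
    mlieBracket 𝓘(ℝ, E) X Y x = nabla Y x (X x) - nabla X x (Y x) :=
  ((CovariantDerivative.torsion_eq_zero_iff nabla).1 hL.torsion_free hX hY).symm

variable (J nabla) in
/-- The tensor `(∇_u J) v`. -/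
def nablaJ (x : M) (u v : TangentSpace 𝓘(ℝ, E) x) : TangentSpace 𝓘(ℝ, E) x :=
  nabla (fun y => J y (FiberBundle.extend E v y)) x u
    - J x (nabla (FiberBundle.extend E v) x u)

/-- The expression is tensorial in `Y`: the derivative of a factor `f` contributes `(u f) J Y` to
both terms. -/
lemma nablaJ_apply (hJ : IsComplexStructure J) (hY : DiffFieldAt Y x)
    (u : TangentSpace 𝓘(ℝ, E) x) :
    nablaJ J nabla x u (Y x) = nabla (fun y => J y (Y y)) x u - J x (nabla Y x u) := by
  have ht : TensorialAt 𝓘(ℝ, E) E (fun Y : ∀ x : M, TangentSpace 𝓘(ℝ, E) x =>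
      nabla (fun y => J y (Y y)) x u - J x (nabla Y x u)) x := by
    constructor
    · intro f Y hf hY
      have h1 := LinearConnection.map_smul nabla hf (hJ.diffFieldAt hY) u
      have h2 := LinearConnection.map_smul nabla hf hY u
      have h3 : (fun y => J y ((f • Y) y)) = fun y => f y • J y (Y y) := by
        funext y
        exact map_smul _ _ _
      have h4 : (f • Y) = fun y => f y • Y y := rfl
      rw [h3, h1, h4, h2, map_add, map_smul, map_smul]
      module
    · intro Y Y' hY hY'
      have h1 := LinearConnection.map_add nabla (hJ.diffFieldAt hY) (hJ.diffFieldAt hY') u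
      have h2 := LinearConnection.map_add nabla hY hY' u
      have h3 : (fun y => J y ((Y + Y') y)) = fun y => J y (Y y) + J y (Y' y) := by
        funext y
        exact map_add _ _ _
      have h4 : (Y + Y') = fun y => Y y + Y' y := rfl
      rw [h3, h1, h4, h2, map_add]
      abel
  exact ht.pointwise (diffFieldAt_extend _) hY (extend_self _)

section LeviCivita

variable (h : IsKahler J omega) (hL : IsLeviCivita (kahlerMetric J omega) nabla)

include h hL

/-- Differentiate `g(J Y, Z) = -g(J Z, Y)` with a metric connection. -/
lemma nablaJ_skew (u v w : TangentSpace 𝓘(ℝ, E) x) :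
    kahlerMetric J omega x (nablaJ J nabla x u v) w
      = -kahlerMetric J omega x (nablaJ J nabla x u w) v := by
  let Y : ∀ y : M, TangentSpace 𝓘(ℝ, E) y := FiberBundle.extend E v
  let Z : ∀ y : M, TangentSpace 𝓘(ℝ, E) y := FiberBundle.extend E w
  have hY : DiffFieldAt Y x := diffFieldAt_extend v
  have hZ : DiffFieldAt Z x := diffFieldAt_extend w
  have h1 := hL.metric _ Z x (h.complex.diffFieldAt hY) hZ u
  have h2 := hL.metric _ Y x (h.complex.diffFieldAt hZ) hY u
  have h3 : (fun y => kahlerMetric J omega y (J y (Y y)) (Z y))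
      = -fun y => kahlerMetric J omega y (J y (Z y)) (Y y) := by
    funext y
    change kahlerMetric J omega y (J y (Y y)) (Z y) = -kahlerMetric J omega y (J y (Z y)) (Y y)
    rw [kahlerMetric_J_left h, kahlerMetric_symm h]
  rw [h3] at h1
  have h4 : mvfderiv 𝓘(ℝ, E) (-fun y => kahlerMetric J omega y (J y (Z y)) (Y y)) x u
      = -mvfderiv 𝓘(ℝ, E) (fun y => kahlerMetric J omega y (J y (Z y)) (Y y)) x u :=
    congr($(mvfderiv_neg) u)
  rw [h4, h2] at h1
  have h5 := nablaJ_apply (nabla := nabla) h.complex hY u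
  have h6 := nablaJ_apply (nabla := nabla) h.complex hZ u
  rw [show Y x = v from extend_self v] at h1 h5
  rw [show Z x = w from extend_self w] at h1 h6
  rw [h5, h6, kahlerMetric_sub_left, kahlerMetric_sub_left,
    kahlerMetric_J_left h (u := nabla Y x u), kahlerMetric_J_left h (u := nabla Z x u),
    kahlerMetric_symm h (u := nabla Y x u), kahlerMetric_symm h (u := nabla Z x u)]
  linarith

-- Differentiate `J² = -1`; only the connection axioms are needed.
omit hL in
lemma nablaJ_J (u v : TangentSpace 𝓘(ℝ, E) x) :
    nablaJ J nabla x u (J x v) = -J x (nablaJ J nabla x u v) := by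
  let Y : ∀ y : M, TangentSpace 𝓘(ℝ, E) y := FiberBundle.extend E v
  have hY : DiffFieldAt Y x := diffFieldAt_extend v
  have h1 := nablaJ_apply (nabla := nabla) h.complex hY u
  have h2 := nablaJ_apply (nabla := nabla) h.complex (h.complex.diffFieldAt hY) u
  have h3 : (fun y => J y (J y (Y y))) = fun y => -Y y := by
    funext y
    exact h.complex.sq _ _
  rw [h3, LinearConnection.map_neg nabla hY] at h2
  rw [show Y x = v from extend_self v] at h1 h2
  rw [h1, h2, map_sub, h.complex.sq]
  abel

/-- The covariant derivative of `ω` is `g((∇_u J) v, w)`. For a torsion-free connection the brackets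
in `dω` cancel the derivatives of the auxiliary fields, so `dω = 0` becomes the vanishing of the
cyclic sum. -/
lemma nablaJ_cyclic (u v w : TangentSpace 𝓘(ℝ, E) x) :
    kahlerMetric J omega x (nablaJ J nabla x u v) w
      + kahlerMetric J omega x (nablaJ J nabla x v w) u
      + kahlerMetric J omega x (nablaJ J nabla x w u) v = 0 := by
  let X : ∀ y : M, TangentSpace 𝓘(ℝ, E) y := FiberBundle.extend E u
  let Y : ∀ y : M, TangentSpace 𝓘(ℝ, E) y := FiberBundle.extend E v
  let Z : ∀ y : M, TangentSpace 𝓘(ℝ, E) y := FiberBundle.extend E w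
  have hX : DiffFieldAt X x := diffFieldAt_extend u
  have hY : DiffFieldAt Y x := diffFieldAt_extend v
  have hZ : DiffFieldAt Z x := diffFieldAt_extend w
  have key : ∀ (Y Z : ∀ y : M, TangentSpace 𝓘(ℝ, E) y) (u : TangentSpace 𝓘(ℝ, E) x),
      DiffFieldAt Y x → DiffFieldAt Z x →
      mvfderiv 𝓘(ℝ, E) (fun y => omega y ![Y y, Z y]) x u
        = kahlerMetric J omega x (nablaJ J nabla x u (Y x)) (Z x)
          + omega x ![nabla Y x u, Z x] + omega x ![Y x, nabla Z x u] := by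
    intro Y Z u hY hZ
    have h1 := hL.metric _ Z x (h.complex.diffFieldAt hY) hZ u
    have h2 : (fun y => kahlerMetric J omega y (J y (Y y)) (Z y))
        = fun y => omega y ![Y y, Z y] := by
      funext y
      exact (apply_eq_kahlerMetric h).symm
    rw [h2] at h1
    rw [h1, nablaJ_apply h.complex hY, kahlerMetric_sub_left, apply_eq_kahlerMetric h,
      apply_eq_kahlerMetric h]
    ring
  have hd := DiffForm.d_apply₃ h.smooth hX hY hZ
  rw [h.closed, key Y Z _ hY hZ, key X Z _ hX hZ, key X Y _ hX hY, hL.mlieBracket_eq hX hY,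
    hL.mlieBracket_eq hX hZ, hL.mlieBracket_eq hY hZ] at hd
  simp only [sub_eq_add_neg, DiffForm.add_left₂, DiffForm.neg_left₂] at hd
  rw [show X x = u from extend_self u, show Y x = v from extend_self v,
    show Z x = w from extend_self w] at hd
  have e0 : (0 : DiffForm E M 3) x ![u, v, w] = 0 := rfl
  rw [e0] at hd
  have e1 := nablaJ_skew h hL v u w
  have s1 := DiffForm.swap₂ omega x (nabla Z x u) v
  have s2 := DiffForm.swap₂ omega x (nabla Z x v) u
  have s3 := DiffForm.swap₂ omega x (nabla Y x w) u
  linarith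

/-- Replace each bracket in the Nijenhuis identity by a difference of covariant derivatives; only
derivatives of `J` survive. -/
lemma nablaJ_nijenhuis (u v : TangentSpace 𝓘(ℝ, E) x) :
    nablaJ J nabla x (J x u) v - J x (nablaJ J nabla x u v)
      = nablaJ J nabla x (J x v) u - J x (nablaJ J nabla x v u) := by
  let X : ∀ y : M, TangentSpace 𝓘(ℝ, E) y := FiberBundle.extend E u
  let Y : ∀ y : M, TangentSpace 𝓘(ℝ, E) y := FiberBundle.extend E v
  have hX : DiffFieldAt X x := diffFieldAt_extend u
  have hY : DiffFieldAt Y x := diffFieldAt_extend v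
  have hJX := h.complex.diffFieldAt hX
  have hJY := h.complex.diffFieldAt hY
  have hN := h.complex.nijenhuis _ (chartAt E x).open_source X Y (smoothFieldOn_extend u)
    (smoothFieldOn_extend v) x (mem_chart_source E x)
  rw [hL.mlieBracket_eq hJX hJY, hL.mlieBracket_eq hX hY, hL.mlieBracket_eq hJX hY,
    hL.mlieBracket_eq hX hJY] at hN
  have h1 := fun u => nablaJ_apply (nabla := nabla) h.complex hX u
  have h2 := fun u => nablaJ_apply (nabla := nabla) h.complex hY u
  rw [show X x = u from extend_self u] at h1 hN
  rw [show Y x = v from extend_self v] at h2 hN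
  simp only [h1, h2, map_sub, map_add, h.complex.sq] at hN ⊢
  rw [← sub_eq_zero] at hN ⊢
  rw [← hN]
  abel

lemma nablaJ_eq_zero (u v : TangentSpace 𝓘(ℝ, E) x) : nablaJ J nabla x u v = 0 := by
  refine eq_zero_of_kahlerMetric h fun w => ?_
  refine eq_zero_of_kahler_symmetries (J x) (h.complex.sq x)
    (fun u v w => kahlerMetric J omega x (nablaJ J nabla x u v) w)
    (fun u v w => kahlerMetric_neg_right) (nablaJ_skew h hL) ?_ (nablaJ_cyclic h hL) ?_ u v w
  · intro u v w
    rw [nablaJ_J h, kahlerMetric_neg_left, kahlerMetric_J_left h, neg_neg]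
  · intro u v w
    have h1 := congrArg (fun z => kahlerMetric J omega x z w) (nablaJ_nijenhuis h hL u v)
    simp only [kahlerMetric_sub_left, kahlerMetric_J_left h] at h1
    linarith

/-- The complex structure of a Kähler manifold is parallel. -/
lemma IsLeviCivita.parallel_J (hY : DiffFieldAt Y x) (u : TangentSpace 𝓘(ℝ, E) x) :
    nabla (fun y => J y (Y y)) x u = J x (nabla Y x u) := by
  rw [← sub_eq_zero, ← nablaJ_apply h.complex hY]
  exact nablaJ_eq_zero h hL _ _

end LeviCivita

end ParallelComplexStructure

/-! ### Linear algebra of Kähler curvature tensors -/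

section KahlerAlgebra

open LinearMap Module

variable {V : Type*} [AddCommGroup V] [Module ℝ V]

/-- `g` is a scalar product for which `J` is an orthogonal complex structure. -/
structure IsHermitianStructure (J : V →ₗ[ℝ] V) (g : V →ₗ[ℝ] V →ₗ[ℝ] ℝ) : Prop where
  sq : ∀ u, J (J u) = -u
  symm : ∀ u v, g u v = g v u
  invariant : ∀ u v, g (J u) (J v) = g u v
  pos : ∀ u, u ≠ 0 → 0 < g u u

/-- `R` has the symmetries of the curvature tensor of a Kähler manifold. -/
structure IsKahlerCurvature (J : V →ₗ[ℝ] V) (g : V →ₗ[ℝ] V →ₗ[ℝ] ℝ)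
    (R : V →ₗ[ℝ] V →ₗ[ℝ] V →ₗ[ℝ] V) : Prop extends IsHermitianStructure J g where
  swap : ∀ u v w, R u v w = -R v u w
  bianchi : ∀ u v w, R u v w + R v w u + R w u v = 0
  skew : ∀ u v w z, g (R u v w) z = -g (R u v z) w
  map_J : ∀ u v w, R u v (J w) = J (R u v w)

/-- The Ricci tensor `tr (w ↦ R(w, u) v)`. -/
def ricciForm (R : V →ₗ[ℝ] V →ₗ[ℝ] V →ₗ[ℝ] V) (u v : V) : ℝ :=
  trace ℝ V ((R.flip u).flip v)

variable {J : V →ₗ[ℝ] V} {g : V →ₗ[ℝ] V →ₗ[ℝ] ℝ} {R : V →ₗ[ℝ] V →ₗ[ℝ] V →ₗ[ℝ] V}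

namespace IsHermitianStructure

variable (h : IsHermitianStructure J g)
include h

lemma map_J_left (u v : V) : g (J u) v = -g u (J v) := by
  rw [← h.invariant u (J v), h.sq, map_neg, neg_neg]

lemma eq_zero {u : V} (hu : ∀ v, g u v = 0) : u = 0 := by
  by_contra hne
  exact (h.pos u hne).ne' (hu u)

lemma eq_of_forall {u v : V} (hu : ∀ w, g u w = g v w) : u = v := by
  rw [← sub_eq_zero]
  refine h.eq_zero fun w => ?_
  rw [map_sub, LinearMap.sub_apply, hu, sub_self]

variable [FiniteDimensional ℝ V]

lemma bijective : Function.Bijective (g : V → Dual ℝ V) := by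
  have h1 : Function.Injective (g : V → Dual ℝ V) := by
    rw [← LinearMap.ker_eq_bot, LinearMap.ker_eq_bot']
    intro u hu
    exact h.eq_zero fun v => congr($hu v)
  exact ⟨h1, (LinearMap.injective_iff_surjective_of_finrank_eq_finrank
    (Subspace.dual_finrank_eq).symm).1 h1⟩

/-- Under the isomorphism of `V` with its dual given by `g`, a skew `A` satisfies that `-A` becomes
the transpose of `A`, so the trace equals its own negative. -/
lemma trace_eq_zero_of_skew {A : V →ₗ[ℝ] V} (hA : ∀ u v, g (A u) v = -g (A v) u) :
    trace ℝ V A = 0 := by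
  let e : V ≃ₗ[ℝ] Dual ℝ V := LinearEquiv.ofBijective g h.bijective
  have h1 : e.conj (-A) = Dual.transpose (R := ℝ) A := by
    refine LinearMap.ext fun f => ?_
    obtain ⟨u, rfl⟩ := e.surjective f
    rw [LinearEquiv.conj_apply_apply, e.symm_apply_apply]
    refine LinearMap.ext fun v => ?_
    change g (-A u) v = g u (A v)
    rw [map_neg, LinearMap.neg_apply, hA, h.symm u, neg_neg]
  have h2 := LinearMap.trace_conj' (-A) e
  rw [h1, LinearMap.trace_transpose', map_neg] at h2
  linarith

lemma exists_rep (B : V →ₗ[ℝ] V →ₗ[ℝ] ℝ) : ∃ A : V →ₗ[ℝ] V, ∀ u v, g (A u) v = B u v := by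
  let e : V ≃ₗ[ℝ] Dual ℝ V := LinearEquiv.ofBijective g h.bijective
  refine ⟨e.symm.toLinearMap ∘ₗ B, fun u v => ?_⟩
  have : e (e.symm (B u)) = B u := e.apply_symm_apply _
  exact congr($this v)

end IsHermitianStructure

namespace IsKahlerCurvature

variable (h : IsKahlerCurvature J g R)
include h

/-- The octahedron argument: the four Bianchi identities at the cyclic shifts of `(u, v, w, z)` are
combined with the two skew-symmetries. -/
lemma pair_symm (u v w z : V) : g (R u v w) z = g (R w z u) v := by
  have b : ∀ a b c d, g (R a b c) d + g (R b c a) d + g (R c a b) d = 0 := by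
    intro a b c d
    have := congrArg (fun x => g x d) (h.bianchi a b c)
    simpa using this
  have s : ∀ a b c d, g (R a b c) d = -g (R b a c) d := by
    intro a b c d
    rw [h.swap, map_neg, LinearMap.neg_apply]
  have k := h.skew
  have b1 := b u v w z
  have b2 := b v w z u
  have b3 := b w z u v
  have b4 := b z u v w
  have k1 := k v w z u
  have k2 := k w z v u
  have k3 := k z v w u
  have k4 := k w z u v
  have k5 := k z u w v
  have k6 := k u w z v
  have k7 := k z u v w
  have k8 := k u v z w
  have k9 := k v z u w
  have s1 := s w u v z
  have s2 := s z v w u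
  have s3 := s z v u w
  have k10 := k w u v z
  have s4 := s w u z v
  linarith

/-- Invariance under `J` in the last pair of arguments follows from `map_J`; pair symmetry moves it
to the first pair. -/
lemma map_J_J (u v : V) : R (J u) (J v) = R u v := by
  refine LinearMap.ext fun w => h.eq_of_forall fun z => ?_
  rw [h.pair_symm, h.map_J, h.invariant, ← h.pair_symm]

variable [FiniteDimensional ℝ V]

lemma trace_eq_zero (u v : V) : trace ℝ V (R u v) = 0 :=
  h.trace_eq_zero_of_skew (h.skew u v)

/-- By the Bianchi identity the antisymmetric part of Ricci is, up to sign, the trace of `R(u, v)`,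
which vanishes because that operator is skew. -/
lemma ricciForm_symm (u v : V) : ricciForm R u v = ricciForm R v u := by
  have h1 : (R.flip u).flip v - (R.flip v).flip u = -R u v := by
    refine LinearMap.ext fun w => ?_
    have h2 := h.bianchi u v w
    have h3 := h.swap v w u
    change R w u v - R w v u = -R u v w
    rw [h3] at h2
    rw [← sub_eq_zero, ← h2]
    abel
  have h2 := congrArg (trace ℝ V) h1
  rw [map_sub, map_neg, h.trace_eq_zero, neg_zero, sub_eq_zero] at h2
  exact h2

/-- Pull `J` out of the last argument, move it to the other side inside the trace, and absorb it
with `map_J_J`. -/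
lemma ricciForm_J (u v : V) : ricciForm R (J u) (J v) = ricciForm R u v := by
  have h1 : (R.flip (J u)).flip (J v) = J ∘ₗ ((R.flip (J u)).flip v) :=
    LinearMap.ext fun w => h.map_J w (J u) v
  have h2 : ((R.flip (J u)).flip v) ∘ₗ J = (R.flip u).flip v :=
    LinearMap.ext fun w => congr($(h.map_J_J w u) v)
  rw [ricciForm, h1, LinearMap.trace_comp_comm', h2]
  rfl

lemma ricciForm_J_right (u v : V) : ricciForm R v (J u) = -ricciForm R u (J v) := by
  rw [← h.ricciForm_J, h.sq, h.ricciForm_symm]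
  have h1 : (R.flip (-u)).flip (J v) = -((R.flip u).flip (J v)) := by
    ext w
    simp
  rw [ricciForm, h1, map_neg]
  rfl

/-- The Bianchi identity writes `J R(u, v)` as a difference of two operators whose traces are Ricci
values, equal up to sign by `ricciForm_J_right`. This is where the trace of the curvature forms
turns into the Ricci form. -/
lemma trace_J_comp (u v : V) : trace ℝ V (J ∘ₗ R u v) = -2 * ricciForm R u (J v) := by
  have h1 : J ∘ₗ R u v = ((R.flip v).flip u) ∘ₗ J - ((R.flip u).flip v) ∘ₗ J := by
    refine LinearMap.ext fun w => ?_
    change J (R u v w) = R (J w) v u - R (J w) u v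
    have h2 := h.bianchi u v (J w)
    have h3 := h.swap v (J w) u
    rw [← h.map_J]
    rw [h3] at h2
    rw [← sub_eq_zero, ← h2]
    abel
  have h2 : ∀ a b : V, trace ℝ V (((R.flip a).flip b) ∘ₗ J) = ricciForm R a (J b) := by
    intro a b
    rw [LinearMap.trace_comp_comm']
    congr 1
    exact LinearMap.ext fun w => (h.map_J w a b).symm
  rw [h1, map_sub, h2, h2, h.ricciForm_J_right]
  ring

end IsKahlerCurvature

/-- A complex coframe with its dual frame. -/
structure IsComplexCoframe {n : ℕ} (J : V →ₗ[ℝ] V) (κ : V →ₗ[ℝ] (Fin n → ℂ)) (e : Fin n → V) :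
    Prop where
  map_J : ∀ v, κ (J v) = Complex.I • κ v
  injective : ∀ v, κ v = 0 → v = 0
  dual : ∀ α, κ (e α) = Pi.single α 1

namespace IsComplexCoframe

variable {n : ℕ} {κ : V →ₗ[ℝ] (Fin n → ℂ)} {e : Fin n → V} (hκ : IsComplexCoframe J κ e)
include hκ

lemma apply_sum (c : Fin n → ℂ) : κ (∑ α, ((c α).re • e α + (c α).im • J (e α))) = c := by
  rw [map_sum]
  have : ∀ α, κ ((c α).re • e α + (c α).im • J (e α)) = Pi.single α (c α) := by
    intro α
    rw [map_add, map_smul, map_smul, hκ.map_J, hκ.dual]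
    funext β
    by_cases hβ : β = α
    · subst hβ
      simp only [Pi.add_apply, Pi.smul_apply, Pi.single_eq_same, smul_eq_mul, mul_one,
        Complex.real_smul]
      exact Complex.re_add_im _
    · simp [hβ]
  simp only [this]
  exact Finset.univ_sum_single c

lemma sum_coframe (v : V) : ∑ α, ((κ v α).re • e α + (κ v α).im • J (e α)) = v := by
  rw [← sub_eq_zero]
  apply hκ.injective
  rw [map_sub, hκ.apply_sum, sub_self]

/-- The frame `e_α, J e_α` is a real basis. For `A` commuting with `J` both vectors of each pair
contribute the real part of the same diagonal entry. -/
lemma trace_eq [FiniteDimensional ℝ V] {A : V →ₗ[ℝ] V} (hA : ∀ v, A (J v) = J (A v)) :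
    trace ℝ V A = 2 * (∑ α, κ (A (e α)) α).re := by
  let re : Fin n → V →ₗ[ℝ] ℝ := fun α => Complex.reLm ∘ₗ LinearMap.proj α ∘ₗ κ
  let im : Fin n → V →ₗ[ℝ] ℝ := fun α => Complex.imLm ∘ₗ LinearMap.proj α ∘ₗ κ
  have h1 : A = ∑ α, ((re α).smulRight (A (e α)) + (im α).smulRight (A (J (e α)))) := by
    refine LinearMap.ext fun v => ?_
    conv_lhs => rw [← hκ.sum_coframe v]
    simp only [map_sum, map_add, map_smul, LinearMap.sum_apply, LinearMap.add_apply,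
      LinearMap.smulRight_apply]
    rfl
  have h2 : trace ℝ V A = ∑ α, (re α (A (e α)) + im α (A (J (e α)))) := by
    conv_lhs => rw [h1]
    simp only [map_sum, map_add, LinearMap.trace_smulRight]
  rw [h2, Complex.re_sum, Finset.mul_sum]
  refine Finset.sum_congr rfl fun α _ => ?_
  have h3 : im α (A (J (e α))) = (κ (A (e α)) α).re := by
    change (κ (A (J (e α))) α).im = _
    rw [hA, hκ.map_J]
    simp
  rw [h3]
  change (κ (A (e α)) α).re + _ = _
  ring

/-- The real part of the complex trace is given by `trace_eq` for `A`, and the imaginary part by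
`trace_eq` for `J A`, whose complex trace is `i` times as large. -/
lemma sum_eq [FiniteDimensional ℝ V] {A : V →ₗ[ℝ] V}
    (hA : ∀ v, A (J v) = J (A v)) :
    ∑ α, κ (A (e α)) α = (trace ℝ V A / 2 : ℝ) - Complex.I * (trace ℝ V (J ∘ₗ A) / 2 : ℝ) := by
  have h1 := hκ.trace_eq hA
  have h2 := hκ.trace_eq (A := J ∘ₗ A) fun v => by
    change J (A (J v)) = J (J (A v))
    rw [hA]
  have h3 : ∑ α, κ ((J ∘ₗ A) (e α)) α = Complex.I * ∑ α, κ (A (e α)) α := by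
    rw [Finset.mul_sum]
    refine Finset.sum_congr rfl fun α _ => ?_
    change κ (J (A (e α))) α = _
    rw [hκ.map_J]
    rfl
  rw [h3] at h2
  rw [h1, h2]
  apply Complex.ext
  · simp
  · simp
    ring

end IsComplexCoframe

/-- The hermitian form `(g(u, v) + i g(u, J v)) / 2`. -/
def hermitianForm (J : V →ₗ[ℝ] V) (g : V →ₗ[ℝ] V →ₗ[ℝ] ℝ) (u v : V) : ℂ :=
  ((g u v : ℂ) + Complex.I * (g u (J v) : ℂ)) / 2

section Contraction

variable {n : ℕ} {κ : V →ₗ[ℝ] (Fin n → ℂ)} {e : Fin n → V}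

/-- The hermitian form is complex linear in its first argument, with `J` acting as multiplication by
`i`. -/
lemma IsHermitianStructure.hermitianForm_sum (h : IsHermitianStructure J g)
    (hκ : IsComplexCoframe J κ e) (u v : V) :
    hermitianForm J g u v = ∑ τ, κ u τ * hermitianForm J g (e τ) v := by
  have hadd : ∀ u u' : V, hermitianForm J g (u + u') v
      = hermitianForm J g u v + hermitianForm J g u' v := by
    intro u u'
    simp only [hermitianForm, map_add, LinearMap.add_apply, Complex.ofReal_add]
    ring
  let L : V →+ ℂ := AddMonoidHom.mk' (fun u => hermitianForm J g u v) hadd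
  have h1 : L u = ∑ τ, L ((κ u τ).re • e τ + (κ u τ).im • J (e τ)) := by
    rw [← map_sum, hκ.sum_coframe]
  refine h1.trans (Finset.sum_congr rfl fun τ _ => ?_)
  have h2 : L ((κ u τ).re • e τ + (κ u τ).im • J (e τ))
      = ((κ u τ).re + (κ u τ).im * Complex.I) * hermitianForm J g (e τ) v := by
    change hermitianForm J g _ v = _
    simp only [hermitianForm, map_add, map_smul, LinearMap.add_apply, LinearMap.smul_apply,
      smul_eq_mul, Complex.ofReal_add, Complex.ofReal_mul, h.map_J_left, h.sq, map_neg,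
      Complex.ofReal_neg, neg_neg]
    linear_combination (-(κ u τ).im * (g (e τ) (J v)) / 2 : ℂ) * Complex.I_sq
  rw [h2, Complex.re_add_im]

/-- A null row vector consists of the complex coordinates of a vector whose hermitian product with
every `e_σ` is zero. Real and imaginary parts make it `g`-orthogonal to all `e_σ` and `J e_σ`, hence
zero. -/
lemma IsHermitianStructure.det_hermitianForm_ne_zero (h : IsHermitianStructure J g)
    (hκ : IsComplexCoframe J κ e) :
    (Matrix.of fun ρ σ => hermitianForm J g (e ρ) (e σ)).det ≠ 0 := by
  intro h0
  obtain ⟨c, hc, hc'⟩ := Matrix.exists_vecMul_eq_zero_iff.2 h0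
  set u := ∑ α, ((c α).re • e α + (c α).im • J (e α))
  have hu : κ u = c := hκ.apply_sum c
  have h1 : ∀ σ, hermitianForm J g u (e σ) = 0 := by
    intro σ
    rw [h.hermitianForm_sum hκ, hu]
    exact congr($hc' σ)
  have h2 : ∀ σ, g u (e σ) = 0 ∧ g u (J (e σ)) = 0 := by
    intro σ
    have h3 : hermitianForm J g u (e σ) = ((g u (e σ) / 2 : ℝ) : ℂ)
        + ((g u (J (e σ)) / 2 : ℝ) : ℂ) * Complex.I := by
      simp only [hermitianForm]
      push_cast
      ring
    have h4 := h1 σ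
    rw [h3] at h4
    have h5 := congrArg Complex.re h4
    have h6 := congrArg Complex.im h4
    simp at h5 h6
    exact ⟨h5, h6⟩
  have h3 : u = 0 := by
    refine h.eq_zero fun v => ?_
    rw [← hκ.sum_coframe v, map_sum]
    refine Finset.sum_eq_zero fun σ _ => ?_
    rw [map_add, map_smul, map_smul, (h2 σ).1, (h2 σ).2]
    simp
  apply hc
  rw [← hu, h3, map_zero]

/-- The contraction of the `(1, 1)`-part of the trace of the curvature with the hermitian metric is
half the contraction of the Ricci tensor. -/
lemma IsKahlerCurvature.contraction [FiniteDimensional ℝ V] (h : IsKahlerCurvature J g R)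
    (hκ : IsComplexCoframe J κ e) {A : V →ₗ[ℝ] V} (hA : ∀ u v, g (A u) v = ricciForm R u v)
    {hm r : Matrix (Fin n) (Fin n) ℂ}
    (hhm : ∀ ρ σ, hm ρ σ = complexExtend (fun v w => (g v w : ℂ))
      ((1 / 2 : ℝ) • e ρ, -((1 / 2 : ℝ) • J (e ρ))) ((1 / 2 : ℝ) • e σ, (1 / 2 : ℝ) • J (e σ)))
    (hr : ∀ ρ σ, r ρ σ = ∑ α, complexExtend (fun v w => κ (R v w ((1 / 2 : ℝ) • e α)) α
        + Complex.I * κ (R v w (-((1 / 2 : ℝ) • J (e α)))) α)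
      ((1 / 2 : ℝ) • e ρ, -((1 / 2 : ℝ) • J (e ρ))) ((1 / 2 : ℝ) • e σ, (1 / 2 : ℝ) • J (e σ))) :
    ∑ ρ, ∑ σ, hm⁻¹ σ ρ * r ρ σ = ((trace ℝ V A / 2 : ℝ) : ℂ) := by
  have hhm' : hm = Matrix.of fun ρ σ => hermitianForm J g (e ρ) (e σ) := by
    ext ρ σ
    rw [hhm]
    simp only [complexExtend, hermitianForm, map_smul, map_neg, LinearMap.smul_apply,
      LinearMap.neg_apply, smul_eq_mul, h.invariant, h.map_J_left, Matrix.of_apply]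
    push_cast
    ring
  -- A complex linear map takes the same value on `Z_α = (e_α - i J e_α)/2` as on `e_α`, so the
  -- frame vector may be replaced by a real one.
  have hform : ∀ u v α, κ (R u v ((1 / 2 : ℝ) • e α)) α
      + Complex.I * κ (R u v (-((1 / 2 : ℝ) • J (e α)))) α = κ (R u v (e α)) α := by
    intro u v α
    simp only [map_smul, map_neg, h.map_J, hκ.map_J, Pi.smul_apply, Pi.neg_apply,
      Complex.real_smul, smul_eq_mul]
    push_cast
    linear_combination (-(1 / 2) * κ (R u v (e α)) α) * Complex.I_sq
  -- The Ricci endomorphism is complex linear because the Ricci tensor is `J`-invariant.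
  have hAJ : ∀ v, A (J v) = J (A v) := by
    intro v
    refine h.eq_of_forall fun w => ?_
    rw [hA, h.map_J_left, hA, h.ricciForm_symm, h.ricciForm_J_right]
  -- The real trace of `R(u, v)` is zero, so its complex trace is purely imaginary and given by
  -- `trace_J_comp`.
  have htr : ∀ u v, ∑ α, κ (R u v (e α)) α = Complex.I * (g (A u) (J v) : ℂ) := by
    intro u v
    rw [hκ.sum_eq (h.map_J u v), h.trace_eq_zero, h.trace_J_comp, hA]
    push_cast
    ring
  -- Here `R_{ρσ̄}` is the Ricci endomorphism with an index lowered by `h`. Multiplying by the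
  -- inverse of `h` leaves the matrix of `A`, and its trace is the complex trace.
  have hr' : r = (Matrix.of fun ρ τ => κ (A (e ρ)) τ) * hm := by
    ext ρ σ
    rw [hr, hhm', Matrix.mul_apply]
    simp only [hform, Matrix.of_apply]
    rw [← h.hermitianForm_sum hκ]
    simp only [complexExtend, Finset.sum_add_distrib, Finset.sum_sub_distrib, ← Finset.mul_sum, htr]
    simp only [hermitianForm, map_smul, map_neg, LinearMap.smul_apply, LinearMap.neg_apply, smul_eq_mul,
      hAJ, h.invariant, h.map_J_left, h.sq]
    push_cast
    linear_combination (-(g (A (e ρ)) (e σ)) / 2 : ℂ) * Complex.I_sq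
  have hdet : IsUnit hm.det := by
    rw [hhm']
    exact (h.det_hermitianForm_ne_zero hκ).isUnit
  have h1 : ∑ ρ, ∑ σ, hm⁻¹ σ ρ * r ρ σ = Matrix.trace (r * hm⁻¹) := by
    simp only [Matrix.trace, Matrix.diag, Matrix.mul_apply]
    exact Finset.sum_congr rfl fun _ _ => Finset.sum_congr rfl fun _ _ => mul_comm _ _
  rw [h1, hr', Matrix.mul_assoc, Matrix.mul_nonsing_inv _ hdet, Matrix.mul_one]
  -- Since `Ric(u, J v)` is alternating, `J A` is skew; so the complex trace of `A` is real and
  -- equals half of the real trace.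
  have h2 : trace ℝ V (J ∘ₗ A) = 0 := by
    refine h.trace_eq_zero_of_skew fun u v => ?_
    change g (J (A u)) v = -g (J (A v)) u
    rw [h.map_J_left, h.map_J_left, hA, hA, h.ricciForm_J_right]
  have h3 := hκ.sum_eq hAJ
  rw [h2] at h3
  refine h3.trans ?_
  simp

/-- The metric contraction of the Ricci tensor over a real basis. -/
lemma IsHermitianStructure.trace_inv_mul [FiniteDimensional ℝ V] (h : IsHermitianStructure J g)
    {ι : Type*} [Fintype ι] [DecidableEq ι] (b : Basis ι ℝ V) (A : V →ₗ[ℝ] V) :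
    Matrix.trace ((Matrix.of fun i j => g (b i) (b j))⁻¹ * Matrix.of fun i j => g (A (b i)) (b j))
      = trace ℝ V A := by
  set G : Matrix ι ι ℝ := Matrix.of fun i j => g (b i) (b j)
  have h1 : (Matrix.of fun i j => g (A (b i)) (b j)) = (LinearMap.toMatrix b b A).transpose * G := by
    ext i j
    rw [Matrix.mul_apply, Matrix.of_apply]
    conv_lhs => rw [← b.sum_repr (A (b i))]
    rw [map_sum, LinearMap.sum_apply]
    refine Finset.sum_congr rfl fun k _ => ?_
    rw [map_smul, LinearMap.smul_apply, Matrix.transpose_apply, LinearMap.toMatrix_apply]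
    rfl
  have hdet : IsUnit G.det := by
    rw [isUnit_iff_ne_zero]
    intro h0
    obtain ⟨c, hc, hc'⟩ := Matrix.exists_vecMul_eq_zero_iff.2 h0
    have h2 : ∑ i, c i • b i = 0 := by
      refine h.eq_zero fun v => ?_
      rw [← b.sum_repr v, map_sum]
      refine Finset.sum_eq_zero fun j _ => ?_
      have h3 : g (∑ i, c i • b i) (b j) = 0 := by
        rw [map_sum, LinearMap.sum_apply]
        have h4 := congr($hc' j)
        simpa [Matrix.vecMul, dotProduct, G] using h4
      rw [map_smul, h3, smul_zero]
    apply hc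
    funext i
    exact Fintype.linearIndependent_iff.1 b.linearIndependent c h2 i
  rw [h1, Matrix.trace_mul_comm, Matrix.mul_assoc, Matrix.mul_nonsing_inv _ hdet, Matrix.mul_one,
    Matrix.trace_transpose, LinearMap.trace_eq_matrix_trace ℝ b]

end Contraction

end KahlerAlgebra

/-! ### The curvature of a Kähler manifold -/

section KahlerCurvature

open VectorField

variable {E : Type*} [NormedAddCommGroup E] [NormedSpace ℝ E] [FiniteDimensional ℝ E]
  {M : Type*} [TopologicalSpace M] [ChartedSpace E M] [IsManifold 𝓘(ℝ, E) ∞ M] [T2Space M]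
  {J : ∀ x : M, TangentSpace 𝓘(ℝ, E) x →L[ℝ] TangentSpace 𝓘(ℝ, E) x} {omega : DiffForm E M 2}
  {x : M} {nabla : LinearConnection E M}

lemma DiffFieldAt.mdifferentiableAt_kahlerMetric (h : IsKahler J omega)
    {Y Z : ∀ x : M, TangentSpace 𝓘(ℝ, E) x} (hY : DiffFieldAt Y x) (hZ : DiffFieldAt Z x) :
    MDifferentiableAt 𝓘(ℝ, E) 𝓘(ℝ, ℝ) (fun y => kahlerMetric J omega y (Y y) (Z y)) x :=
  DiffForm.mdifferentiableAt_apply₂ h.smooth hY (h.complex.diffFieldAt hZ)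

lemma SmoothFieldOn.contMDiffOn_kahlerMetric (h : IsKahler J omega) {U : Set M} (hU : IsOpen U)
    {Y Z : ∀ x : M, TangentSpace 𝓘(ℝ, E) x} (hY : SmoothFieldOn Y U) (hZ : SmoothFieldOn Z U) :
    ContMDiffOn 𝓘(ℝ, E) 𝓘(ℝ, ℝ) ∞ (fun y => kahlerMetric J omega y (Y y) (Z y)) U := fun _ hy =>
  ContMDiffAt.contMDiffWithinAt <| DiffForm.contMDiffAt_apply₂ (m := ⊤) h.smooth
    (hY.contMDiffAt (hU.mem_nhds hy)) ((h.complex.smooth U hU Z hZ).contMDiffAt (hU.mem_nhds hy))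

section

variable (h : IsKahler J omega) (hL : IsLeviCivita (kahlerMetric J omega) nabla)

include h hL

/-- As `J` is parallel, it can be moved out of each covariant derivative in the curvature. -/
lemma IsLeviCivita.curvature_J (u v w : TangentSpace 𝓘(ℝ, E) x) :
    curvature nabla x u v (J x w) = J x (curvature nabla x u v w) := by
  have hC := (chartAt E x).open_source
  have hxC := mem_chart_source E x
  let X : ∀ y : M, TangentSpace 𝓘(ℝ, E) y := FiberBundle.extend E u
  let Y : ∀ y : M, TangentSpace 𝓘(ℝ, E) y := FiberBundle.extend E v
  let W : ∀ y : M, TangentSpace 𝓘(ℝ, E) y := FiberBundle.extend E w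
  have hX : DiffFieldAt X x := diffFieldAt_extend u
  have hY : DiffFieldAt Y x := diffFieldAt_extend v
  have hW : SmoothFieldOn W (chartAt E x).source := smoothFieldOn_extend w
  have hJW := h.complex.smooth _ hC W hW
  have h1 := curvature_apply hL.smooth hC hxC hJW hX hY
  have h2 := curvature_apply hL.smooth hC hxC hW hX hY
  rw [show X x = u from extend_self u, show Y x = v from extend_self v,
    show W x = w from extend_self w] at h1 h2
  rw [h1, h2]
  have key : ∀ {Z : ∀ y : M, TangentSpace 𝓘(ℝ, E) y}, DiffFieldAt Z x →
      ∀ u, nabla (fun y => nabla (fun z => J z (W z)) y (Z y)) x u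
        = J x (nabla (fun y => nabla W y (Z y)) x u) := by
    intro Z hZ u
    have h3 := LinearConnection.diffFieldAt_apply hL.smooth hC hxC hW hZ
    rw [← hL.parallel_J h h3]
    refine congr($(LinearConnection.map_congr nabla (h.complex.diffFieldAt h3) ?_) u)
    filter_upwards [hC.mem_nhds hxC] with y hy
    exact hL.parallel_J h (hW.diffFieldAt hC hy) _
  simp only [curvatureOp]
  rw [key hX, key hY, hL.parallel_J h (hW.diffFieldAt hC hxC), map_sub, map_sub]

-- With zero torsion the second derivatives in the cyclic sum pair up to iterated brackets, and the
-- sum becomes the Jacobi identity.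
omit h in
lemma IsLeviCivita.curvature_bianchi (u v w : TangentSpace 𝓘(ℝ, E) x) :
    curvature nabla x u v w + curvature nabla x v w u + curvature nabla x w u v = 0 := by
  have hC := (chartAt E x).open_source
  have hxC := mem_chart_source E x
  let X : ∀ y : M, TangentSpace 𝓘(ℝ, E) y := FiberBundle.extend E u
  let Y : ∀ y : M, TangentSpace 𝓘(ℝ, E) y := FiberBundle.extend E v
  let Z : ∀ y : M, TangentSpace 𝓘(ℝ, E) y := FiberBundle.extend E w
  have hX : SmoothFieldOn X (chartAt E x).source := smoothFieldOn_extend u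
  have hY : SmoothFieldOn Y (chartAt E x).source := smoothFieldOn_extend v
  have hZ : SmoothFieldOn Z (chartAt E x).source := smoothFieldOn_extend w
  simp only [curvature_eq_curvatureOp_extend]
  change curvatureOp nabla X Y Z x + curvatureOp nabla Y Z X x + curvatureOp nabla Z X Y x = 0
  have key : ∀ {X Y Z : ∀ y : M, TangentSpace 𝓘(ℝ, E) y},
      SmoothFieldOn X (chartAt E x).source → SmoothFieldOn Y (chartAt E x).source →
      SmoothFieldOn Z (chartAt E x).source →
      nabla (fun y => nabla Y y (X y)) x (Z x) - nabla (fun y => nabla X y (Y y)) x (Z x)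
        = nabla (mlieBracket 𝓘(ℝ, E) X Y) x (Z x) := by
    intro X Y Z hX hY hZ
    have h1 := (LinearConnection.smoothFieldOn_apply hL.smooth hC hY hX).diffFieldAt hC hxC
    have h2 := (LinearConnection.smoothFieldOn_apply hL.smooth hC hX hY).diffFieldAt hC hxC
    rw [← LinearConnection.map_sub nabla h1 h2]
    refine congr($(LinearConnection.map_congr nabla
      ((hX.mlieBracket hC hY).diffFieldAt hC hxC) ?_) (Z x))
    filter_upwards [hC.mem_nhds hxC] with y hy
    exact (hL.mlieBracket_eq (hX.diffFieldAt hC hy) (hY.diffFieldAt hC hy)).symm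
  have t : ∀ {X Y Z : ∀ y : M, TangentSpace 𝓘(ℝ, E) y},
      SmoothFieldOn X (chartAt E x).source → SmoothFieldOn Y (chartAt E x).source →
      SmoothFieldOn Z (chartAt E x).source →
      mlieBracket 𝓘(ℝ, E) (mlieBracket 𝓘(ℝ, E) X Y) Z x
        = nabla Z x (mlieBracket 𝓘(ℝ, E) X Y x)
          - nabla (mlieBracket 𝓘(ℝ, E) X Y) x (Z x) := by
    intro X Y Z hX hY hZ
    exact hL.mlieBracket_eq ((hX.mlieBracket hC hY).diffFieldAt hC hxC) (hZ.diffFieldAt hC hxC)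
  have jac : mlieBracket 𝓘(ℝ, E) (mlieBracket 𝓘(ℝ, E) X Y) Z x
      + mlieBracket 𝓘(ℝ, E) (mlieBracket 𝓘(ℝ, E) Y Z) X x
      + mlieBracket 𝓘(ℝ, E) (mlieBracket 𝓘(ℝ, E) Z X) Y x = 0 := by
    have : IsManifold 𝓘(ℝ, E) (minSmoothness ℝ 3) M := by
      rw [minSmoothness_of_isRCLikeNormedField]
      exact IsManifold.of_le (n := ∞) (WithTop.coe_le_coe.2 (le_top : (3 : ℕ∞) ≤ ⊤))
    have two : ∀ {X : ∀ y : M, TangentSpace 𝓘(ℝ, E) y}, SmoothFieldOn X (chartAt E x).source →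
        ContMDiffAt 𝓘(ℝ, E) 𝓘(ℝ, E).tangent (minSmoothness ℝ 2)
          (fun y => (⟨y, X y⟩ : TangentBundle 𝓘(ℝ, E) M)) x := by
      intro X hX
      rw [minSmoothness_of_isRCLikeNormedField]
      exact (hX.contMDiffAt (hC.mem_nhds hxC)).of_le two_le_smooth
    have h1 := leibniz_identity_mlieBracket_apply (two hX) (two hY) (two hZ)
    rw [mlieBracket_swap_apply (V := mlieBracket 𝓘(ℝ, E) Y Z),
      mlieBracket_swap_apply (V := mlieBracket 𝓘(ℝ, E) Z X), h1,
      mlieBracket_swap (V := Z) (W := X)]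
    have h2 : mlieBracket 𝓘(ℝ, E) Y (-mlieBracket 𝓘(ℝ, E) X Z) x
        = -mlieBracket 𝓘(ℝ, E) Y (mlieBracket 𝓘(ℝ, E) X Z) x := by
      have h3 := mlieBracket_const_smul_right (I := 𝓘(ℝ, E)) (V := Y) (c := (-1 : ℝ))
        ((hX.mlieBracket hC hZ).diffFieldAt hC hxC)
      rw [neg_one_smul, neg_one_smul] at h3
      exact h3
    rw [h2]
    abel
  rw [t hX hY hZ, t hY hZ hX, t hZ hX hY, ← key hX hY hZ, ← key hY hZ hX, ← key hZ hX hY] at jac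
  simp only [curvatureOp]
  rw [← neg_eq_zero, ← jac]
  abel

/-- Apply `[X, Y]` to the function `g(W, Z)` as a commutator of derivations. Expanding with a metric
connection, the mixed terms are symmetric in `X` and `Y` and cancel, leaving the two curvature
terms. -/
lemma IsLeviCivita.curvature_skew (u v w z : TangentSpace 𝓘(ℝ, E) x) :
    kahlerMetric J omega x (curvature nabla x u v w) z
      = -kahlerMetric J omega x (curvature nabla x u v z) w := by
  have hC := (chartAt E x).open_source
  have hxC := mem_chart_source E x
  let X : ∀ y : M, TangentSpace 𝓘(ℝ, E) y := FiberBundle.extend E u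
  let Y : ∀ y : M, TangentSpace 𝓘(ℝ, E) y := FiberBundle.extend E v
  let W : ∀ y : M, TangentSpace 𝓘(ℝ, E) y := FiberBundle.extend E w
  let Z : ∀ y : M, TangentSpace 𝓘(ℝ, E) y := FiberBundle.extend E z
  have hX : SmoothFieldOn X (chartAt E x).source := smoothFieldOn_extend u
  have hY : SmoothFieldOn Y (chartAt E x).source := smoothFieldOn_extend v
  have hW : SmoothFieldOn W (chartAt E x).source := smoothFieldOn_extend w
  have hZ : SmoothFieldOn Z (chartAt E x).source := smoothFieldOn_extend z
  have h1 := curvature_apply hL.smooth hC hxC hW (hX.diffFieldAt hC hxC) (hY.diffFieldAt hC hxC)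
  have h2 := curvature_apply hL.smooth hC hxC hZ (hX.diffFieldAt hC hxC) (hY.diffFieldAt hC hxC)
  have hf : ContMDiffAt 𝓘(ℝ, E) 𝓘(ℝ, ℝ) 2 (fun y => kahlerMetric J omega y (W y) (Z y)) x :=
    ((hW.contMDiffOn_kahlerMetric h hC hZ).contMDiffAt (hC.mem_nhds hxC)).of_le two_le_smooth
  have h3 := mvfderiv_mlieBracket (hX.diffFieldAt hC hxC) (hY.diffFieldAt hC hxC) hf
  have key : ∀ {Y : ∀ y : M, TangentSpace 𝓘(ℝ, E) y}, SmoothFieldOn Y (chartAt E x).source →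
      ∀ u, mvfderiv 𝓘(ℝ, E) (fun y => mvfderiv 𝓘(ℝ, E)
        (fun y => kahlerMetric J omega y (W y) (Z y)) y (Y y)) x u
        = kahlerMetric J omega x (nabla (fun y => nabla W y (Y y)) x u) (Z x)
          + kahlerMetric J omega x (nabla W x (Y x)) (nabla Z x u)
          + (kahlerMetric J omega x (nabla W x u) (nabla Z x (Y x))
            + kahlerMetric J omega x (W x) (nabla (fun y => nabla Z y (Y y)) x u)) := by
    intro Y hY u
    have h4 := (LinearConnection.smoothFieldOn_apply hL.smooth hC hW hY).diffFieldAt hC hxC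
    have h5 := (LinearConnection.smoothFieldOn_apply hL.smooth hC hZ hY).diffFieldAt hC hxC
    have hW' := hW.diffFieldAt hC hxC
    have hZ' := hZ.diffFieldAt hC hxC
    rw [← hL.metric _ _ x h4 hZ' u, ← hL.metric _ _ x hW' h5 u]
    have h6 : (fun y => mvfderiv 𝓘(ℝ, E)
        (fun y => kahlerMetric J omega y (W y) (Z y)) y (Y y)) =ᶠ[𝓝 x]
        (fun y => kahlerMetric J omega y (nabla W y (Y y)) (Z y))
          + fun y => kahlerMetric J omega y (W y) (nabla Z y (Y y)) := by
      filter_upwards [hC.mem_nhds hxC] with y hy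
      exact hL.metric W Z y (hW.diffFieldAt hC hy) (hZ.diffFieldAt hC hy) _
    rw [mvfderiv_congr h6]
    exact congr($(mvfderiv_add (h4.mdifferentiableAt_kahlerMetric h hZ')
      (hW'.mdifferentiableAt_kahlerMetric h h5)) u)
  rw [key hX, key hY, hL.metric W Z x (hW.diffFieldAt hC hxC) (hZ.diffFieldAt hC hxC)] at h3
  rw [show X x = u from extend_self u, show Y x = v from extend_self v,
    show W x = w from extend_self w] at h1
  rw [show X x = u from extend_self u, show Y x = v from extend_self v,
    show Z x = z from extend_self z] at h2
  rw [h1, h2]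
  simp only [curvatureOp, kahlerMetric_sub_left]
  rw [show W x = w from extend_self w, show Z x = z from extend_self z] at h3
  rw [kahlerMetric_symm h (v := w), kahlerMetric_symm h (v := w), kahlerMetric_symm h (v := w)]
  linarith

end

/-- The Kähler metric at a point as a bilinear map. -/
def kahlerMetricHom (J : ∀ x : M, TangentSpace 𝓘(ℝ, E) x →L[ℝ] TangentSpace 𝓘(ℝ, E) x)
    (omega : DiffForm E M 2) (x : M) : E →ₗ[ℝ] E →ₗ[ℝ] ℝ :=
  LinearMap.mk₂ ℝ (fun u v : E => kahlerMetric J omega x u v)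
    (fun _ _ _ => kahlerMetric_add_left) (fun _ _ _ => kahlerMetric_smul_left _)
    (fun _ _ _ => kahlerMetric_add_right) (fun _ _ _ => kahlerMetric_smul_right _)

/-- The complex structure at a point as a linear map of the model space. -/
def complexStructureHom (J : ∀ x : M, TangentSpace 𝓘(ℝ, E) x →L[ℝ] TangentSpace 𝓘(ℝ, E) x) (x : M) :
    E →ₗ[ℝ] E :=
  (J x).toLinearMap

lemma IsLeviCivita.isKahlerCurvature (h : IsKahler J omega)
    (hL : IsLeviCivita (kahlerMetric J omega) nabla) (x : M) :
    IsKahlerCurvature (V := E) (complexStructureHom J x) (kahlerMetricHom J omega x)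
      (curvatureHom hL.smooth x) where
  sq := h.complex.sq x
  symm _ _ := kahlerMetric_symm h
  invariant _ _ := kahlerMetric_J h
  pos := h.pos x
  swap _ _ _ := curvature_swap
  bianchi := hL.curvature_bianchi
  skew := hL.curvature_skew h
  map_J := hL.curvature_J h

lemma ricci_eq_ricciForm (hn : CovariantDerivative.ContMDiffCovariantDerivative nabla ∞) (x : M)
    (u v : TangentSpace 𝓘(ℝ, E) x) : ricci nabla x u v = ricciForm (curvatureHom hn x) u v := by
  refine Eq.trans ?_ (LinearMap.trace_eq_matrix_trace ℝ (Module.finBasis ℝ E)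
    (((curvatureHom hn x).flip u).flip v)).symm
  simp only [Matrix.trace, Matrix.diag, LinearMap.toMatrix_apply]
  rfl

/-- The contraction of the trace of the curvature in a complex coframe. -/
lemma IsLeviCivita.contraction (h : IsKahler J omega)
    (hL : IsLeviCivita (kahlerMetric J omega) nabla) (x : M) {n : ℕ} {κ : E →ₗ[ℝ] (Fin n → ℂ)}
    {e : Fin n → E} (hκ : IsComplexCoframe (V := E) (complexStructureHom J x) κ e)
    {hm r : Matrix (Fin n) (Fin n) ℂ}
    (hhm : ∀ ρ σ, hm ρ σ = complexExtend (fun v w : E => (kahlerMetric J omega x v w : ℂ))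
      ((1 / 2 : ℝ) • e ρ, -((1 / 2 : ℝ) • J x (e ρ)))
      ((1 / 2 : ℝ) • e σ, (1 / 2 : ℝ) • J x (e σ)))
    (hr : ∀ ρ σ, r ρ σ = ∑ α, complexExtend (fun v w : E =>
        κ (curvature nabla x v w ((1 / 2 : ℝ) • e α)) α
          + Complex.I * κ (curvature nabla x v w (-((1 / 2 : ℝ) • J x (e α)))) α)
      ((1 / 2 : ℝ) • e ρ, -((1 / 2 : ℝ) • J x (e ρ)))
      ((1 / 2 : ℝ) • e σ, (1 / 2 : ℝ) • J x (e σ))) :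
    ∑ ρ, ∑ σ, hm⁻¹ σ ρ * r ρ σ = (kahlerScalarCurvature J omega nabla x : ℂ) := by
  have hK := hL.isKahlerCurvature h x
  -- The Ricci form is defined only as a function of two vectors; taking the trace after permuting
  -- the arguments of the curvature exhibits it as a bilinear map, which `g` then represents by an
  -- endomorphism.
  obtain ⟨B, hB⟩ : ∃ B : E →ₗ[ℝ] E →ₗ[ℝ] ℝ, ∀ u v, B u v = ricciForm (curvatureHom hL.smooth x) u v := by
    let flip : (E →ₗ[ℝ] E →ₗ[ℝ] E) →ₗ[ℝ] (E →ₗ[ℝ] E →ₗ[ℝ] E) :=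
      (LinearMap.lflip (R₀ := ℝ) : (E →ₗ[ℝ] E →ₗ[ℝ] E) ≃ₗ[ℝ] (E →ₗ[ℝ] E →ₗ[ℝ] E)).toLinearMap
    exact ⟨(flip ∘ₗ (curvatureHom hL.smooth x).flip).compr₂ (LinearMap.trace ℝ E),
      fun _ _ => rfl⟩
  obtain ⟨A, hA⟩ := hK.exists_rep B
  have h1 := hK.contraction hκ (A := A) (fun u v => (hA u v).trans (hB u v)) hhm hr
  rw [h1]
  congr 1
  have h2 := hK.trace_inv_mul (Module.finBasis ℝ E) A
  rw [← h2]
  simp only [kahlerScalarCurvature, riemannianScalarCurvature]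
  congr 4
  ext a b
  rw [ricci_eq_ricciForm hL.smooth, hA, hB]
  rfl

end KahlerCurvature

/-! ### Lie brackets and the lifted complex structure -/

section LiftedStructure

open VectorField

variable {E : Type*} [NormedAddCommGroup E] [NormedSpace ℝ E] [FiniteDimensional ℝ E]
  {M : Type*} [TopologicalSpace M] [ChartedSpace E M] [IsManifold 𝓘(ℝ, E) ∞ M]
  {F : Type*} [NormedAddCommGroup F] [NormedSpace ℝ F] [FiniteDimensional ℝ F]
  {P : Type*} [TopologicalSpace P] [ChartedSpace F P] [IsManifold 𝓘(ℝ, F) ∞ P]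
  {p : P → M} {η : OneForm F P}
  {lift : ∀ q : P, TangentSpace 𝓘(ℝ, E) (p q) →L[ℝ] TangentSpace 𝓘(ℝ, F) q}
  {T : ∀ q : P, TangentSpace 𝓘(ℝ, F) q}
  {J : ∀ x : M, TangentSpace 𝓘(ℝ, E) x →L[ℝ] TangentSpace 𝓘(ℝ, E) x} {omega : DiffForm E M 2}
  {q : P} {U : Set P}

/-- The endomorphism of the tangent bundle of `P` which is the lift of `J` on horizontal vectors
and vanishes on vertical vectors. -/
def liftEnd (p : P → M)
    (lift : ∀ q : P, TangentSpace 𝓘(ℝ, E) (p q) →L[ℝ] TangentSpace 𝓘(ℝ, F) q)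
    (J : ∀ x : M, TangentSpace 𝓘(ℝ, E) x →L[ℝ] TangentSpace 𝓘(ℝ, E) x) (q : P) :
    TangentSpace 𝓘(ℝ, F) q →L[ℝ] TangentSpace 𝓘(ℝ, F) q :=
  (lift q).comp ((J (p q)).comp (mfderiv 𝓘(ℝ, F) 𝓘(ℝ, E) p q))

lemma liftEnd_apply (v : TangentSpace 𝓘(ℝ, F) q) :
    liftEnd p lift J q v = lift q (J (p q) (mfderiv 𝓘(ℝ, F) 𝓘(ℝ, E) p q v)) := rfl

lemma mlieBracket_congr {X X' Y Y' : ∀ q : P, TangentSpace 𝓘(ℝ, F) q} (hU : IsOpen U) (hq : q ∈ U)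
    (hX : ∀ y ∈ U, X y = X' y) (hY : ∀ y ∈ U, Y y = Y' y) :
    mlieBracket 𝓘(ℝ, F) X Y q = mlieBracket 𝓘(ℝ, F) X' Y' q :=
  Filter.EventuallyEq.mlieBracket_vectorField_eq (Filter.mem_of_superset (hU.mem_nhds hq) hX)
    (Filter.mem_of_superset (hU.mem_nhds hq) hY)

lemma mlieBracket_neg_left {X Y : ∀ q : P, TangentSpace 𝓘(ℝ, F) q} (hX : DiffFieldAt X q) :
    mlieBracket 𝓘(ℝ, F) (fun y => -X y) Y q = -mlieBracket 𝓘(ℝ, F) X Y q := by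
  have h1 := mlieBracket_const_smul_left (I := 𝓘(ℝ, F)) (W := Y) (c := (-1 : ℝ)) hX
  have h2 : ((-1 : ℝ) • X) = fun y => -X y := by
    funext y
    exact neg_one_smul ℝ _
  rw [h2] at h1
  exact h1.trans (neg_one_smul ℝ _)

lemma mlieBracket_neg_right {X Y : ∀ q : P, TangentSpace 𝓘(ℝ, F) q} (hY : DiffFieldAt Y q) :
    mlieBracket 𝓘(ℝ, F) X (fun y => -Y y) q = -mlieBracket 𝓘(ℝ, F) X Y q := by
  rw [mlieBracket_swap_apply, mlieBracket_neg_left hY, mlieBracket_swap_apply (V := X), neg_neg]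

namespace IsSplitting

variable (h : IsSplitting p η lift T)
include h

lemma mfderiv_liftEnd (v : TangentSpace 𝓘(ℝ, F) q) :
    mfderiv 𝓘(ℝ, F) 𝓘(ℝ, E) p q (liftEnd p lift J q v)
      = J (p q) (mfderiv 𝓘(ℝ, F) 𝓘(ℝ, E) p q v) := by
  rw [liftEnd_apply, h.proj_lift]

lemma form_liftEnd (v : TangentSpace 𝓘(ℝ, F) q) : η q (liftEnd p lift J q v) = 0 := by
  rw [liftEnd_apply, h.form_lift]

lemma liftEnd_lift (u : TangentSpace 𝓘(ℝ, E) (p q)) :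
    liftEnd p lift J q (lift q u) = lift q (J (p q) u) := by
  rw [liftEnd_apply, h.proj_lift]

lemma liftEnd_T : liftEnd p lift J q (T q) = 0 := by
  rw [liftEnd_apply, h.proj_T, map_zero, map_zero]

/-- The square is minus the projection onto `H` along `T`. -/
lemma liftEnd_liftEnd (hJ : IsComplexStructure J) (v : TangentSpace 𝓘(ℝ, F) q) :
    liftEnd p lift J q (liftEnd p lift J q v) = -v + η q v • T q := by
  have h1 : liftEnd p lift J q (liftEnd p lift J q v)
      = -lift q (mfderiv 𝓘(ℝ, F) 𝓘(ℝ, E) p q v) := by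
    rw [liftEnd_apply, h.mfderiv_liftEnd, hJ.sq, map_neg]
  rw [h1]
  conv_rhs => rw [h.decomp q v]
  rw [map_add, h.form_lift, map_smul, h.form_T]
  simp

lemma smoothHomAt_liftEnd (hJ : IsComplexStructure J) (q : P) :
    SmoothHomAt F (fun y : P => y) (fun y => y) (liftEnd p lift J) q := by
  refine SmoothHomAt.of_apply_constSection continuousAt_id fun v => ?_
  have h1 : ContMDiffAt 𝓘(ℝ, F) 𝓘(ℝ, F).tangent ∞
      (fun y => (⟨y, constSection q v y⟩ : TangentBundle 𝓘(ℝ, F) P)) q :=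
    (contMDiffOn_constSection q v).contMDiffAt
      ((chartAt F q).open_source.mem_nhds (mem_chart_source F q))
  have h2 := (smoothHomAt_mfderiv h.smooth_proj q).contMDiffAt_apply (h.smooth_proj q) h1
  have h3 := (SmoothHomAt.comp (hJ.smoothHomAt (p q)) (h.smooth_proj q)).contMDiffAt_apply
    (h.smooth_proj q) h2
  exact h.contMDiffAt_lift h3

lemma smoothFieldOn_liftEnd (hJ : IsComplexStructure J) (hU : IsOpen U)
    {V : ∀ q : P, TangentSpace 𝓘(ℝ, F) q} (hV : SmoothFieldOn V U) :
    SmoothFieldOn (fun y => liftEnd p lift J y (V y)) U := fun q hq =>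
  ContMDiffAt.contMDiffWithinAt <|
    (h.smoothHomAt_liftEnd hJ q).contMDiffAt_apply contMDiffAt_id (hV.contMDiffAt (hU.mem_nhds hq))

lemma diffFieldAt_liftEnd (hJ : IsComplexStructure J)
    {V : ∀ q : P, TangentSpace 𝓘(ℝ, F) q} (hV : DiffFieldAt V q) :
    DiffFieldAt (fun y => liftEnd p lift J y (V y)) q :=
  (h.smoothHomAt_liftEnd hJ q).mdifferentiableAt_apply contMDiffAt_id hV

lemma diffFieldAt_T (q : P) : DiffFieldAt T q := (h.contMDiffAt_T q).mdifferentiableAt (by simp)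

lemma mfderiv_mlieBracket_lift {X Y : ∀ x : M, TangentSpace 𝓘(ℝ, E) x}
    (hX : DiffFieldAt X (p q)) (hY : DiffFieldAt Y (p q)) :
    mfderiv 𝓘(ℝ, F) 𝓘(ℝ, E) p q
        (mlieBracket 𝓘(ℝ, F) (fun y => lift y (X (p y))) (fun y => lift y (Y (p y))) q)
      = mlieBracket 𝓘(ℝ, E) X Y (p q) :=
  mfderiv_mlieBracket_of_related h.smooth_proj hX hY (h.diffFieldAt_lift hX)
    (h.diffFieldAt_lift hY) (Filter.Eventually.of_forall fun _ => h.proj_lift _ _)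
    (Filter.Eventually.of_forall fun _ => h.proj_lift _ _)

/-- On fields with constant pairing with `η`, the bracket pairs with `η` as minus `dη`. -/
lemma form_mlieBracket {X Y : ∀ q : P, TangentSpace 𝓘(ℝ, F) q} {a b : ℝ}
    (hX : DiffFieldAt X q) (hY : DiffFieldAt Y q) (hXa : ∀ᶠ y in 𝓝 q, η y (X y) = a)
    (hYb : ∀ᶠ y in 𝓝 q, η y (Y y) = b) :
    η q (mlieBracket 𝓘(ℝ, F) X Y q) = -η.d q ![X q, Y q] := by
  rw [OneForm.d_apply h.smooth_form hX hY]
  have h1 : ∀ {Z : ∀ q : P, TangentSpace 𝓘(ℝ, F) q} {c : ℝ}, (∀ᶠ y in 𝓝 q, η y (Z y) = c) → ∀ u,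
      mvfderiv 𝓘(ℝ, F) (fun y => η y (Z y)) q u = 0 := by
    intro Z c hZ u
    have h2 : (fun y => η y (Z y)) =ᶠ[𝓝 q] fun _ => c := hZ
    rw [mvfderiv_congr h2]
    exact congr($(mvfderiv_const c) u)
  rw [h1 hXa, h1 hYb]
  simp

variable (hc : ∀ (q : P) (u v : TangentSpace 𝓘(ℝ, F) q), η.d q ![u, v]
  = omega (p q) ![mfderiv 𝓘(ℝ, F) 𝓘(ℝ, E) p q u, mfderiv 𝓘(ℝ, F) 𝓘(ℝ, E) p q v])
include hc

lemma isReebField : IsReebField η T where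
  smooth q _ := (h.contMDiffAt_T q).contMDiffWithinAt
  apply_self := h.form_T
  contract q v := by rw [hc, h.proj_T, DiffForm.zero_left₂]

/-- If `u = p_* T'` were nonzero, contracting `dη` with `T'` and the lift of `J u` would give `ω(u,
J u) > 0`. Hence `T'` is vertical, and `η(T') = 1` fixes it. -/
lemma eq_of_isReebField (hom : IsKahler J omega) {T' : ∀ q : P, TangentSpace 𝓘(ℝ, F) q}
    (hT' : IsReebField η T') : T' = T := by
  funext q
  have h1 : mfderiv 𝓘(ℝ, F) 𝓘(ℝ, E) p q (T' q) = 0 := by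
    by_contra hne
    have h2 := hom.pos (p q) _ hne
    have h3 := hT'.contract q (lift q (J (p q) (mfderiv 𝓘(ℝ, F) 𝓘(ℝ, E) p q (T' q))))
    rw [hc, h.proj_lift] at h3
    exact h2.ne' h3
  rw [← sub_eq_zero]
  refine h.ext q _ ?_ ?_
  · rw [map_sub, h1, h.proj_T, sub_zero]
  · rw [map_sub, hT'.apply_self, h.form_T, sub_self]

lemma form_mlieBracket_lift {X Y : ∀ x : M, TangentSpace 𝓘(ℝ, E) x}
    (hX : DiffFieldAt X (p q)) (hY : DiffFieldAt Y (p q)) :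
    η q (mlieBracket 𝓘(ℝ, F) (fun y => lift y (X (p y))) (fun y => lift y (Y (p y))) q)
      = -omega (p q) ![X (p q), Y (p q)] := by
  rw [h.form_mlieBracket (h.diffFieldAt_lift hX) (h.diffFieldAt_lift hY)
    (Filter.Eventually.of_forall fun _ => h.form_lift _ _)
    (Filter.Eventually.of_forall fun _ => h.form_lift _ _), hc, h.proj_lift, h.proj_lift]

/-- The vertical field commutes with horizontal lifts. -/
lemma mlieBracket_T_lift {X : ∀ x : M, TangentSpace 𝓘(ℝ, E) x} (hX : DiffFieldAt X (p q)) :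
    mlieBracket 𝓘(ℝ, F) T (fun y => lift y (X (p y))) q = 0 := by
  have h0 : DiffFieldAt (fun x : M => (0 : TangentSpace 𝓘(ℝ, E) x)) (p q) :=
    mdifferentiable_zeroSection ..
  have h1 := mfderiv_mlieBracket_of_related h.smooth_proj h0 hX (h.diffFieldAt_T q)
    (h.diffFieldAt_lift hX) (Filter.Eventually.of_forall fun _ => h.proj_T _)
    (Filter.Eventually.of_forall fun _ => h.proj_lift _ _)
  refine h.ext q _ ?_ ?_
  · refine h1.trans ?_
    have h2 : (fun x : M => (0 : TangentSpace 𝓘(ℝ, E) x)) = 0 := rfl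
    rw [h2, mlieBracket_zero_left]
    rfl
  · rw [h.form_mlieBracket (h.diffFieldAt_T q) (h.diffFieldAt_lift hX)
      (Filter.Eventually.of_forall h.form_T)
      (Filter.Eventually.of_forall fun _ => h.form_lift _ _), hc, h.proj_T, DiffForm.zero_left₂,
      neg_zero]

end IsSplitting

/-- The Nijenhuis tensor of a field of endomorphisms. -/
def nijenhuisTensor (A : ∀ q : P, TangentSpace 𝓘(ℝ, F) q →L[ℝ] TangentSpace 𝓘(ℝ, F) q)
    (V W : ∀ q : P, TangentSpace 𝓘(ℝ, F) q) (q : P) : TangentSpace 𝓘(ℝ, F) q :=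
  mlieBracket 𝓘(ℝ, F) (fun y => A y (V y)) (fun y => A y (W y)) q
    + A q (A q (mlieBracket 𝓘(ℝ, F) V W q))
    - A q (mlieBracket 𝓘(ℝ, F) (fun y => A y (V y)) W q
      + mlieBracket 𝓘(ℝ, F) V (fun y => A y (W y)) q)

section Nijenhuis

variable {A : ∀ q : P, TangentSpace 𝓘(ℝ, F) q →L[ℝ] TangentSpace 𝓘(ℝ, F) q}
  {V V' W W' : ∀ q : P, TangentSpace 𝓘(ℝ, F) q}

lemma nijenhuisTensor_swap : nijenhuisTensor A V W q = -nijenhuisTensor A W V q := by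
  simp only [nijenhuisTensor]
  rw [mlieBracket_swap_apply (V := fun y => A y (V y)) (W := fun y => A y (W y)),
    mlieBracket_swap_apply (V := V) (W := W), mlieBracket_swap_apply (V := V),
    mlieBracket_swap_apply (W := W)]
  simp only [map_neg, map_add]
  abel

/-- With `A²[V, W]` in the definition in place of `-[V, W]`, all derivatives of `f` cancel for an
arbitrary `A`. The lifted structure needs this generality, because it kills `T`. -/
lemma tensorialAt_nijenhuisTensor
    (hA : SmoothHomAt F (fun y : P => y) (fun y => y) A q) :
    TensorialAt 𝓘(ℝ, F) F (fun V => nijenhuisTensor A V W q) q where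
  smul {f V} hf hV := by
    have hAV : DiffFieldAt (fun y => A y (V y)) q := hA.mdifferentiableAt_apply contMDiffAt_id hV
    have h1 : (fun y => A y ((f • V) y)) = fun y => f y • A y (V y) := by
      funext y
      exact map_smul _ _ _
    have h2 : (f • V) = fun y => f y • V y := rfl
    simp only [nijenhuisTensor, h1]
    rw [h2, mlieBracket_smul_left' hf hAV, mlieBracket_smul_left' hf hV,
      mlieBracket_smul_left' hf hAV, mlieBracket_smul_left' hf hV]
    simp only [map_add, map_neg, map_smul]
    module
  add {V V'} hV hV' := by
    have hAV : DiffFieldAt (fun y => A y (V y)) q := hA.mdifferentiableAt_apply contMDiffAt_id hV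
    have hAV' : DiffFieldAt (fun y => A y (V' y)) q :=
      hA.mdifferentiableAt_apply contMDiffAt_id hV'
    have h1 : (fun y => A y ((V + V') y)) = fun y => A y (V y) + A y (V' y) := by
      funext y
      exact map_add _ _ _
    have h2 : (V + V') = fun y => V y + V' y := rfl
    simp only [nijenhuisTensor, h1]
    rw [h2, mlieBracket_add_left' hAV hAV', mlieBracket_add_left' hV hV',
      mlieBracket_add_left' hAV hAV', mlieBracket_add_left' hV hV']
    simp only [map_add]
    abel

lemma nijenhuisTensor_congr (hA : SmoothHomAt F (fun y : P => y) (fun y => y) A q)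
    (hV : DiffFieldAt V q) (hV' : DiffFieldAt V' q) (hW : DiffFieldAt W q) (hW' : DiffFieldAt W' q)
    (h : V q = V' q) (h' : W q = W' q) : nijenhuisTensor A V W q = nijenhuisTensor A V' W' q := by
  rw [(tensorialAt_nijenhuisTensor hA).pointwise hV hV' h, nijenhuisTensor_swap,
    (tensorialAt_nijenhuisTensor hA).pointwise hW hW' h', ← nijenhuisTensor_swap]

end Nijenhuis

namespace IsSplitting

variable (h : IsSplitting p η lift T) (hom : IsKahler J omega)
  (hc : ∀ (q : P) (u v : TangentSpace 𝓘(ℝ, F) q), η.d q ![u, v]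
    = omega (p q) ![mfderiv 𝓘(ℝ, F) 𝓘(ℝ, E) p q u, mfderiv 𝓘(ℝ, F) 𝓘(ℝ, E) p q v])
  {V W : ∀ q : P, TangentSpace 𝓘(ℝ, F) q}
include h hom hc

/-- By tensoriality `V` and `W` may be replaced by horizontal lifts of fields on `M`. The projection
is then the Nijenhuis tensor of `J`, and `η` sees only the bracket of the two rotated lifts, which
is `-ω(J u, J w) = -ω(u, w)`. -/
lemma nijenhuisTensor_liftEnd (hV : DiffFieldAt V q) (hW : DiffFieldAt W q) (hVη : η q (V q) = 0)
    (hWη : η q (W q) = 0) :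
    nijenhuisTensor (liftEnd p lift J) V W q
      = -omega (p q) ![mfderiv 𝓘(ℝ, F) 𝓘(ℝ, E) p q (V q), mfderiv 𝓘(ℝ, F) 𝓘(ℝ, E) p q (W q)] • T q := by
  set u := mfderiv 𝓘(ℝ, F) 𝓘(ℝ, E) p q (V q)
  set w := mfderiv 𝓘(ℝ, F) 𝓘(ℝ, E) p q (W q)
  let X : ∀ y : M, TangentSpace 𝓘(ℝ, E) y := FiberBundle.extend E u
  let Y : ∀ y : M, TangentSpace 𝓘(ℝ, E) y := FiberBundle.extend E w
  have hX : DiffFieldAt X (p q) := diffFieldAt_extend u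
  have hY : DiffFieldAt Y (p q) := diffFieldAt_extend w
  have hJX := hom.complex.diffFieldAt hX
  have hJY := hom.complex.diffFieldAt hY
  have hXu : X (p q) = u := extend_self u
  have hYw : Y (p q) = w := extend_self w
  rw [nijenhuisTensor_congr (V' := fun y => lift y (X (p y))) (W' := fun y => lift y (Y (p y)))
    (h.smoothHomAt_liftEnd hom.complex q) hV (h.diffFieldAt_lift hX) hW (h.diffFieldAt_lift hY)
    (by rw [hXu, h.lift_proj hVη]) (by rw [hYw, h.lift_proj hWη])]
  have hN := hom.complex.nijenhuis _ (chartAt E (p q)).open_source X Y (smoothFieldOn_extend u)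
    (smoothFieldOn_extend w) (p q) (mem_chart_source E (p q))
  simp only [nijenhuisTensor, h.liftEnd_lift]
  have b1 := h.mfderiv_mlieBracket_lift hJX hJY
  have b2 := h.mfderiv_mlieBracket_lift hX hY
  have b3 := h.mfderiv_mlieBracket_lift hJX hY
  have b4 := h.mfderiv_mlieBracket_lift hX hJY
  rw [← sub_eq_zero]
  refine h.ext q _ ?_ ?_
  · simp only [map_sub, map_add, map_smul, h.proj_T, h.mfderiv_liftEnd, hom.complex.sq]
    rw [b1, b2, b3, b4, hN]
    simp only [map_add, smul_zero]
    abel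
  · simp only [map_sub, map_add, map_smul, h.form_T, h.form_liftEnd]
    rw [h.form_mlieBracket_lift hc hJX hJY, hom.invariant, hXu, hYw]
    simp

/-- Integrability of the lifted complex structure on horizontal fields. -/
lemma mlieBracket_liftEnd (hV : DiffFieldAt V q) (hW : DiffFieldAt W q)
    (hVη : ∀ᶠ y in 𝓝 q, η y (V y) = 0) (hWη : ∀ᶠ y in 𝓝 q, η y (W y) = 0) :
    mlieBracket 𝓘(ℝ, F) (fun y => liftEnd p lift J y (V y))
        (fun y => liftEnd p lift J y (W y)) q
      = mlieBracket 𝓘(ℝ, F) V W q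
        + liftEnd p lift J q (mlieBracket 𝓘(ℝ, F) (fun y => liftEnd p lift J y (V y)) W q
          + mlieBracket 𝓘(ℝ, F) V (fun y => liftEnd p lift J y (W y)) q) := by
  have h1 := h.nijenhuisTensor_liftEnd hom hc hV hW hVη.self_of_nhds hWη.self_of_nhds
  -- On the bracket the squared endomorphism is `-1` plus a vertical correction `η([V, W]) T =
  -- -dη(V, W) T`, which is exactly the vertical value of the Nijenhuis tensor.
  rw [nijenhuisTensor, h.liftEnd_liftEnd hom.complex, h.form_mlieBracket hV hW hVη hWη, hc] at h1
  rw [← sub_eq_zero] at h1 ⊢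
  rw [← h1]
  module

/-- This is `dη(J V, W) + dη(V, J W) = 0`, a form of the `J`-invariance of `ω`; it makes the mixed
brackets add up to a horizontal vector. -/
lemma form_mlieBracket_add (hV : DiffFieldAt V q) (hW : DiffFieldAt W q)
    (hVη : ∀ᶠ y in 𝓝 q, η y (V y) = 0) (hWη : ∀ᶠ y in 𝓝 q, η y (W y) = 0) :
    η q (mlieBracket 𝓘(ℝ, F) (fun y => liftEnd p lift J y (V y)) W q
          + mlieBracket 𝓘(ℝ, F) V (fun y => liftEnd p lift J y (W y)) q) = 0 := by
  have hJη : ∀ V : ∀ q : P, TangentSpace 𝓘(ℝ, F) q,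
      ∀ᶠ y in 𝓝 q, η y (liftEnd p lift J y (V y)) = 0 := fun V =>
    Filter.Eventually.of_forall fun _ => h.form_liftEnd _
  rw [map_add, h.form_mlieBracket (h.diffFieldAt_liftEnd hom.complex hV) hW (hJη V) hWη,
    h.form_mlieBracket hV (h.diffFieldAt_liftEnd hom.complex hW) hVη (hJη W), hc, hc,
    h.mfderiv_liftEnd, h.mfderiv_liftEnd, ← hom.invariant (p q) (J (p q) _), hom.complex.sq,
    DiffForm.neg_left₂]
  ring

end IsSplitting

end LiftedStructure

/-! ### The CR structure on the horizontal distribution -/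

section CRStructure

open VectorField

variable {E : Type*} [NormedAddCommGroup E] [NormedSpace ℝ E] [FiniteDimensional ℝ E]
  {M : Type*} [TopologicalSpace M] [ChartedSpace E M] [IsManifold 𝓘(ℝ, E) ∞ M]
  {F : Type*} [NormedAddCommGroup F] [NormedSpace ℝ F] [FiniteDimensional ℝ F]
  {P : Type*} [TopologicalSpace P] [ChartedSpace F P] [IsManifold 𝓘(ℝ, F) ∞ P]
  {p : P → M} {η : OneForm F P}
  {lift : ∀ q : P, TangentSpace 𝓘(ℝ, E) (p q) →L[ℝ] TangentSpace 𝓘(ℝ, F) q}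
  {T : ∀ q : P, TangentSpace 𝓘(ℝ, F) q}
  {J : ∀ x : M, TangentSpace 𝓘(ℝ, E) x →L[ℝ] TangentSpace 𝓘(ℝ, E) x} {omega : DiffForm E M 2}

/-- `(H, JH)` is the kernel of `η` with the lift of `J`. -/
structure IsHorizontalCR (p : P → M) (η : OneForm F P)
    (lift : ∀ q : P, TangentSpace 𝓘(ℝ, E) (p q) →L[ℝ] TangentSpace 𝓘(ℝ, F) q)
    (J : ∀ x : M, TangentSpace 𝓘(ℝ, E) x →L[ℝ] TangentSpace 𝓘(ℝ, E) x)
    (H : TangentDistribution F P) (JH : EndField H) : Prop where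
  ker : ∀ q : P, (η q).ker = H q
  coe_apply : ∀ (q : P) (v : H q),
    (JH q v : TangentSpace 𝓘(ℝ, F) q) = liftEnd p lift J q (v : TangentSpace 𝓘(ℝ, F) q)

namespace IsHorizontalCR

variable {H : TangentDistribution F P} {JH : EndField H} {q : P}

lemma mem_iff (hH : IsHorizontalCR p η lift J H JH) {v : TangentSpace 𝓘(ℝ, F) q} :
    v ∈ H q ↔ η q v = 0 := by
  rw [← hH.ker q]
  exact Iff.rfl

lemma form_apply (hH : IsHorizontalCR p η lift J H JH) (v : H q) : η q (v : TangentSpace 𝓘(ℝ, F) q) = 0 :=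
  hH.mem_iff.1 v.2

lemma mem_T10_iff (hH : IsHorizontalCR p η lift J H JH)
    {z : TangentSpace 𝓘(ℝ, F) q × TangentSpace 𝓘(ℝ, F) q} :
    z ∈ T10 H JH q ↔ η q z.1 = 0 ∧ z.2 = -liftEnd p lift J q z.1 := by
  constructor
  · rintro ⟨v, rfl⟩
    exact ⟨hH.form_apply v, congrArg Neg.neg (hH.coe_apply q v)⟩
  · rintro ⟨h1, h2⟩
    exact ⟨⟨z.1, hH.mem_iff.2 h1⟩,
      Prod.ext rfl (h2.trans (congrArg Neg.neg (hH.coe_apply q ⟨z.1, hH.mem_iff.2 h1⟩).symm))⟩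

variable (hH : IsHorizontalCR p η lift J H JH) (h : IsSplitting p η lift T) (hom : IsKahler J omega)
  (hc : ∀ (q : P) (u v : TangentSpace 𝓘(ℝ, F) q), η.d q ![u, v]
    = omega (p q) ![mfderiv 𝓘(ℝ, F) 𝓘(ℝ, E) p q u, mfderiv 𝓘(ℝ, F) 𝓘(ℝ, E) p q v])
include hH h

lemma lift_mem (u : TangentSpace 𝓘(ℝ, E) (p q)) : lift q u ∈ H q := hH.mem_iff.2 (h.form_lift q u)

include hom hc

lemma isCRStructure : IsCRStructure H JH where
  smooth_subbundle q := by
    refine ⟨univ, isOpen_univ, mem_univ q, η, h.smooth_form, fun y _ => ⟨fun h0 => ?_, (hH.ker y).symm⟩⟩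
    have h1 := h.form_T y
    rw [h0] at h1
    exact zero_ne_one h1
  smooth_J U hU V hV := by
    have h1 := h.smoothFieldOn_liftEnd hom.complex hU hV
    exact h1.congr fun y hy => hH.coe_apply y (V y)
  sq q v := by
    refine Subtype.ext ?_
    rw [hH.coe_apply, hH.coe_apply, h.liftEnd_liftEnd hom.complex, hH.form_apply v, zero_smul]
    exact add_zero _
  integrable U hU Z W hZ1 hZ2 hW1 hW2 hZ hW q hq := by
    have hZ' := fun y hy => hH.mem_T10_iff.1 (hZ y hy)
    have hW' := fun y hy => hH.mem_T10_iff.1 (hW y hy)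
    set V : ∀ q : P, TangentSpace 𝓘(ℝ, F) q := fun y => (Z y).1 with hV
    set V' : ∀ q : P, TangentSpace 𝓘(ℝ, F) q := fun y => (W y).1 with hV'
    have dV : DiffFieldAt V q := hZ1.diffFieldAt hU hq
    have dV' : DiffFieldAt V' q := hW1.diffFieldAt hU hq
    have dJV := h.diffFieldAt_liftEnd hom.complex dV
    have dJV' := h.diffFieldAt_liftEnd hom.complex dV'
    have eV : ∀ᶠ y in 𝓝 q, η y (V y) = 0 :=
      Filter.mem_of_superset (hU.mem_nhds hq) fun y hy => (hZ' y hy).1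
    have eV' : ∀ᶠ y in 𝓝 q, η y (V' y) = 0 :=
      Filter.mem_of_superset (hU.mem_nhds hq) fun y hy => (hW' y hy).1
    have eZ : ∀ y ∈ U, (Z y).2 = -liftEnd p lift J y (V y) := fun y hy => (hZ' y hy).2
    have eW : ∀ y ∈ U, (W y).2 = -liftEnd p lift J y (V' y) := fun y hy => (hW' y hy).2
    have r1 : mlieBracket 𝓘(ℝ, F) (fun y => (Z y).2) (fun y => (W y).2) q
        = mlieBracket 𝓘(ℝ, F) (fun y => liftEnd p lift J y (V y))
            (fun y => liftEnd p lift J y (V' y)) q := by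
      rw [mlieBracket_congr hU hq eZ eW, mlieBracket_neg_left dJV, mlieBracket_neg_right dJV', neg_neg]
    have r2 : mlieBracket 𝓘(ℝ, F) (fun y => (Z y).2) V' q
        = -mlieBracket 𝓘(ℝ, F) (fun y => liftEnd p lift J y (V y)) V' q := by
      rw [mlieBracket_congr hU hq eZ (fun _ _ => rfl), mlieBracket_neg_left dJV]
    have r3 : mlieBracket 𝓘(ℝ, F) V (fun y => (W y).2) q
        = -mlieBracket 𝓘(ℝ, F) V (fun y => liftEnd p lift J y (V' y)) q := by
      rw [mlieBracket_congr hU hq (fun _ _ => rfl) eW, mlieBracket_neg_right dJV']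
    have N1 := h.mlieBracket_liftEnd hom hc dV dV' eV eV'
    have N2 := h.form_mlieBracket_add hom hc dV dV' eV eV'
    -- For sections `V - i J V` and `V' - i J V'` the bracket has real part `-J K` and imaginary
    -- part `-K`. As `K` is horizontal, this is `v - i J v` with `v = -J K`.
    set K := mlieBracket 𝓘(ℝ, F) (fun y => liftEnd p lift J y (V y)) V' q
      + mlieBracket 𝓘(ℝ, F) V (fun y => liftEnd p lift J y (V' y)) q with hK
    have c1 : (complexBracket Z W q).1 = -liftEnd p lift J q K := by
      change mlieBracket 𝓘(ℝ, F) V V' q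
        - mlieBracket 𝓘(ℝ, F) (fun y => (Z y).2) (fun y => (W y).2) q = _
      rw [r1, N1]
      abel
    have c2 : (complexBracket Z W q).2 = -K := by
      change mlieBracket 𝓘(ℝ, F) V (fun y => (W y).2) q
        + mlieBracket 𝓘(ℝ, F) (fun y => (Z y).2) V' q = _
      rw [r2, r3, hK]
      abel
    refine hH.mem_T10_iff.2 ⟨?_, ?_⟩
    · rw [c1, map_neg, h.form_liftEnd, neg_zero]
    · rw [c1, c2, map_neg, h.liftEnd_liftEnd hom.complex, N2, zero_smul, neg_neg]
      exact (add_zero _).symm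

lemma leviForm_eq (v w : H q) :
    leviForm H JH η q v w = kahlerMetric J omega (p q) (mfderiv 𝓘(ℝ, F) 𝓘(ℝ, E) p q v)
      (mfderiv 𝓘(ℝ, F) 𝓘(ℝ, E) p q w) := by
  rw [leviForm, hc, hH.coe_apply, h.mfderiv_liftEnd]
  rfl

lemma leviForm_pos (v : H q) (hv : v ≠ 0) : 0 < leviForm H JH η q v v := by
  rw [hH.leviForm_eq h hom hc]
  refine hom.pos _ _ fun h0 => hv (Subtype.ext ?_)
  exact h.ext q _ h0 (hH.form_apply v)

lemma isPseudohermitian : IsPseudohermitian H JH η where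
  cr := hH.isCRStructure h hom hc
  smooth := h.smooth_form
  ne_zero q h0 := by
    have h1 := h.form_T q
    rw [h0] at h1
    exact zero_ne_one h1
  ker := hH.ker
  pos _ := hH.leviForm_pos h hom hc

end IsHorizontalCR

/-- Positive multiples of pseudohermitian structures. -/
lemma IsPseudohermitian.smul {H : TangentDistribution F P} {JH : EndField H} {θ : OneForm F P}
    (hη : IsPseudohermitian H JH η) {c : ℝ} (hc : 0 < c) (hθη : ∀ q, η q = c • θ q)
    (hθ : θ.toDiffForm.SmoothOn univ) : IsPseudohermitian H JH θ where
  cr := hη.cr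
  smooth := hθ
  ne_zero q h0 := hη.ne_zero q (by rw [hθη, h0]; exact smul_zero _)
  ker q := by
    rw [← hη.ker q, hθη]
    ext v
    change θ q v = 0 ↔ c • θ q v = 0
    simp [hc.ne']
  pos q v hv := by
    have h1 := hη.pos q v hv
    rw [leviForm, OneForm.d_smul hθη] at h1
    exact pos_of_mul_pos_right h1 hc.le

end CRStructure

/-! ### The pullback connection -/

section Along

variable {E : Type*} [NormedAddCommGroup E] [NormedSpace ℝ E] [FiniteDimensional ℝ E]
  {M : Type*} [TopologicalSpace M] [ChartedSpace E M] [IsManifold 𝓘(ℝ, E) ∞ M]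
  {F : Type*} [NormedAddCommGroup F] [NormedSpace ℝ F]
  {P : Type*} [TopologicalSpace P] [ChartedSpace F P] [IsManifold 𝓘(ℝ, F) ∞ P]
  {p : P → M}

lemma contMDiffAt_mvfderiv_apply {f : P → ℝ} {q : P} {Y : ∀ y : P, TangentSpace 𝓘(ℝ, F) y}
    (hf : ContMDiffAt 𝓘(ℝ, F) 𝓘(ℝ, ℝ) ∞ f q)
    (hY : ContMDiffAt 𝓘(ℝ, F) 𝓘(ℝ, F).tangent ∞
      (fun y => (⟨y, Y y⟩ : TangentBundle 𝓘(ℝ, F) P)) q) :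
    ContMDiffAt 𝓘(ℝ, F) 𝓘(ℝ, ℝ) ∞ (fun y => mvfderiv 𝓘(ℝ, F) f y (Y y)) q := by
  have hf' : ContDiffAt ℝ ∞ (f ∘ (extChartAt 𝓘(ℝ, F) q).symm) (extChartAt 𝓘(ℝ, F) q q) := by
    rw [← contMDiffAt_iff_contDiffAt]
    refine ContMDiffAt.comp (extChartAt 𝓘(ℝ, F) q q) (I' := 𝓘(ℝ, F)) (g := f) ?_
      ((contMDiffOn_extChartAt_symm (n := ∞) q).contMDiffAt
        (extChartAt_target_mem_nhds q))
    rwa [chart_symm_chart]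
  have hd := hf'.fderiv_right (m := ∞) (by simp)
  refine contMDiffAt_of_comp_chart_symm (k := ⊤)
    (hd.clm_apply (contDiffAt_fieldInChart (k := ⊤) hY)) ?_
  filter_upwards [eventually_mem_chart_target q, (tendsto_chart_symm q).eventually
    (hf.of_le (m := 1) (by simp)).eventually_mdifferentiableAt] with y hy hfy
  rw [fderiv_comp_chart_symm hy hfy Y]
  rfl

/-- The coefficients of a vector field along `p` in the frame `constSection c (b i)`, where `b` is
the fixed basis of the model space. -/
def alongCoeff (p : P → M) (c : M) (S : ∀ y : P, TangentSpace 𝓘(ℝ, E) (p y))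
    (i : Fin (Module.finrank ℝ E)) (y : P) : ℝ :=
  (Module.finBasis ℝ E).repr (trivializationAt E (TangentSpace 𝓘(ℝ, E)) c ⟨p y, S y⟩).2 i

/-- The fixed frame of `TM` near `c`. -/
def baseFrame (c : M) (i : Fin (Module.finrank ℝ E)) (x : M) : TangentSpace 𝓘(ℝ, E) x :=
  constSection c (Module.finBasis ℝ E i) x

lemma smoothFieldOn_baseFrame (c : M) (i : Fin (Module.finrank ℝ E)) :
    SmoothFieldOn (baseFrame c i) (chartAt E c).source := contMDiffOn_constSection _ _

lemma diffFieldAt_baseFrame {c x : M} (hx : x ∈ (chartAt E c).source)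
    (i : Fin (Module.finrank ℝ E)) : DiffFieldAt (baseFrame c i) x :=
  (smoothFieldOn_baseFrame c i).diffFieldAt (chartAt E c).open_source hx

variable {c : M} {S S' : ∀ y : P, TangentSpace 𝓘(ℝ, E) (p y)} {i : Fin (Module.finrank ℝ E)} {q y : P}

lemma alongCoeff_add (hy : p y ∈ (chartAt E c).source) :
    alongCoeff p c (fun y => S y + S' y) i y = alongCoeff p c S i y + alongCoeff p c S' i y := by
  have hb : p y ∈ (trivializationAt E (TangentSpace 𝓘(ℝ, E)) c).baseSet := hy
  let e := Trivialization.continuousLinearEquivAt ℝ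
    (trivializationAt E (TangentSpace 𝓘(ℝ, E)) c) (p y) hb
  change (Module.finBasis ℝ E).repr (e (S y + S' y)) i
    = (Module.finBasis ℝ E).repr (e (S y)) i + (Module.finBasis ℝ E).repr (e (S' y)) i
  rw [map_add, map_add]
  rfl

lemma alongCoeff_smul {f : P → ℝ} (hy : p y ∈ (chartAt E c).source) :
    alongCoeff p c (fun y => f y • S y) i y = f y * alongCoeff p c S i y := by
  have hb : p y ∈ (trivializationAt E (TangentSpace 𝓘(ℝ, E)) c).baseSet := hy
  let e := Trivialization.continuousLinearEquivAt ℝ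
    (trivializationAt E (TangentSpace 𝓘(ℝ, E)) c) (p y) hb
  change (Module.finBasis ℝ E).repr (e (f y • S y)) i
    = f y * (Module.finBasis ℝ E).repr (e (S y)) i
  rw [map_smul, map_smul]
  rfl

lemma sum_alongCoeff (hy : p y ∈ (chartAt E c).source) (S : ∀ y : P, TangentSpace 𝓘(ℝ, E) (p y)) :
    S y = ∑ i, alongCoeff p c S i y • baseFrame c i (p y) := by
  have hb : p y ∈ (trivializationAt E (TangentSpace 𝓘(ℝ, E)) c).baseSet := hy
  let e := Trivialization.continuousLinearEquivAt ℝ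
    (trivializationAt E (TangentSpace 𝓘(ℝ, E)) c) (p y) hb
  have h2 := (Module.finBasis ℝ E).sum_repr (e (S y))
  have h3 := congrArg e.symm h2
  rw [e.symm_apply_apply, map_sum] at h3
  rw [← h3]
  refine Finset.sum_congr rfl fun i _ => ?_
  exact map_smul e.symm _ _

lemma mdifferentiableAt_alongCoeff (hS : MDifferentiableAt 𝓘(ℝ, F) 𝓘(ℝ, E).tangent
      (fun y => (⟨p y, S y⟩ : TangentBundle 𝓘(ℝ, E) M)) q) :
    MDifferentiableAt 𝓘(ℝ, F) 𝓘(ℝ, ℝ) (alongCoeff p (p q) S i) q := by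
  have h1 := ((mdifferentiableAt_totalSpace _ _).1 hS).2
  let l : E →L[ℝ] ℝ := LinearMap.toContinuousLinearMap ((Module.finBasis ℝ E).coord i)
  exact MDifferentiableAt.comp q l.mdifferentiableAt h1

lemma contMDiffAt_alongCoeff (hS : ContMDiffAt 𝓘(ℝ, F) 𝓘(ℝ, E).tangent ∞
      (fun y => (⟨p y, S y⟩ : TangentBundle 𝓘(ℝ, E) M)) q) :
    ContMDiffAt 𝓘(ℝ, F) 𝓘(ℝ, ℝ) ∞ (alongCoeff p (p q) S i) q := by
  have h1 := (contMDiffAt_totalSpace.1 hS).2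
  let l : E →L[ℝ] ℝ := LinearMap.toContinuousLinearMap ((Module.finBasis ℝ E).coord i)
  exact l.contMDiff.contMDiffAt.comp q h1

/-- Differentiability of the sum is part of the conclusion because the induction step needs it for
the partial sums. -/
lemma LinearConnection.map_sum {ι : Type*} (nabla : LinearConnection E M) {x : M} (s : Finset ι)
    {f : ι → M → ℝ} {Y : ι → ∀ x : M, TangentSpace 𝓘(ℝ, E) x}
    (hf : ∀ i ∈ s, MDifferentiableAt 𝓘(ℝ, E) 𝓘(ℝ, ℝ) (f i) x) (hY : ∀ i ∈ s, DiffFieldAt (Y i) x)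
    (u : TangentSpace 𝓘(ℝ, E) x) :
    DiffFieldAt (fun y => ∑ i ∈ s, f i y • Y i y) x ∧
    nabla (fun y => ∑ i ∈ s, f i y • Y i y) x u
      = ∑ i ∈ s, (f i x • nabla (Y i) x u + mvfderiv 𝓘(ℝ, E) (f i) x u • Y i x) := by
  classical
  induction s using Finset.induction_on with
  | empty =>
    simp only [Finset.sum_empty]
    refine ⟨mdifferentiable_zeroSection .., ?_⟩
    have h0 : (fun y : M => (0 : TangentSpace 𝓘(ℝ, E) y)) = 0 := rfl
    rw [h0, CovariantDerivative.zero]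
    rfl
  | insert i s hi ih =>
    obtain ⟨h1, h2⟩ := ih (fun j hj => hf j (Finset.mem_insert_of_mem hj))
      (fun j hj => hY j (Finset.mem_insert_of_mem hj))
    have hfi := hf i (Finset.mem_insert_self i s)
    have hYi := hY i (Finset.mem_insert_self i s)
    simp only [Finset.sum_insert hi]
    refine ⟨(hYi.smul hfi).add h1, ?_⟩
    rw [LinearConnection.map_add nabla (hYi.smul hfi) h1, LinearConnection.map_smul nabla hfi hYi, h2]

end Along

/-! ### Construction of the pullback connection -/

section PullbackConnection

open VectorField

variable {E : Type*} [NormedAddCommGroup E] [NormedSpace ℝ E] [FiniteDimensional ℝ E]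
  {M : Type*} [TopologicalSpace M] [ChartedSpace E M] [IsManifold 𝓘(ℝ, E) ∞ M]
  {F : Type*} [NormedAddCommGroup F] [NormedSpace ℝ F] [FiniteDimensional ℝ F]
  {P : Type*} [TopologicalSpace P] [ChartedSpace F P] [IsManifold 𝓘(ℝ, F) ∞ P]

/-- The operator of the pullback connection on `H ⊕ ℝ T`. -/
def pullbackCov (p : P → M) (η : OneForm F P)
    (lift : ∀ q : P, TangentSpace 𝓘(ℝ, E) (p q) →L[ℝ] TangentSpace 𝓘(ℝ, F) q)
    (T : ∀ q : P, TangentSpace 𝓘(ℝ, F) q) (nablaM : LinearConnection E M)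
    (Y : ∀ q : P, TangentSpace 𝓘(ℝ, F) q) (q : P) :
    TangentSpace 𝓘(ℝ, F) q →L[ℝ] TangentSpace 𝓘(ℝ, F) q :=
  ∑ i, (alongCoeff p (p q) (fun y => mfderiv 𝓘(ℝ, F) 𝓘(ℝ, E) p y (Y y)) i q •
      (lift q).comp ((nablaM (baseFrame (p q) i) (p q)).comp (mfderiv 𝓘(ℝ, F) 𝓘(ℝ, E) p q))
    + (mvfderiv 𝓘(ℝ, F) (alongCoeff p (p q) (fun y => mfderiv 𝓘(ℝ, F) 𝓘(ℝ, E) p y (Y y)) i)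
        q).smulRight (lift q (baseFrame (p q) i (p q))))
  + (mvfderiv 𝓘(ℝ, F) (fun y => η y (Y y)) q).smulRight (T q)

variable {p : P → M} {η : OneForm F P}
  {lift : ∀ q : P, TangentSpace 𝓘(ℝ, E) (p q) →L[ℝ] TangentSpace 𝓘(ℝ, F) q}
  {T : ∀ q : P, TangentSpace 𝓘(ℝ, F) q}
  {q : P} {nablaM : LinearConnection E M} {Y Z : ∀ q : P, TangentSpace 𝓘(ℝ, F) q}

omit [FiniteDimensional ℝ F] in
lemma pullbackCov_apply (v : TangentSpace 𝓘(ℝ, F) q) :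
    pullbackCov p η lift T nablaM Y q v
      = ∑ i, (alongCoeff p (p q) (fun y => mfderiv 𝓘(ℝ, F) 𝓘(ℝ, E) p y (Y y)) i q •
          lift q (nablaM (baseFrame (p q) i) (p q) (mfderiv 𝓘(ℝ, F) 𝓘(ℝ, E) p q v))
        + mvfderiv 𝓘(ℝ, F) (alongCoeff p (p q) (fun y => mfderiv 𝓘(ℝ, F) 𝓘(ℝ, E) p y (Y y)) i) q v
          • lift q (baseFrame (p q) i (p q)))
      + mvfderiv 𝓘(ℝ, F) (fun y => η y (Y y)) q v • T q := by
  rw [pullbackCov, add_apply, sum_apply]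
  rfl

namespace IsSplitting

variable (h : IsSplitting p η lift T)
include h

lemma mdifferentiableAt_mfderiv_apply (hY : DiffFieldAt Y q) :
    MDifferentiableAt 𝓘(ℝ, F) 𝓘(ℝ, E).tangent
      (fun y => (⟨p y, mfderiv 𝓘(ℝ, F) 𝓘(ℝ, E) p y (Y y)⟩ : TangentBundle 𝓘(ℝ, E) M)) q :=
  (smoothHomAt_mfderiv h.smooth_proj q).mdifferentiableAt_apply (h.smooth_proj q) hY

lemma eventually_mem_chart (q : P) : ∀ᶠ y in 𝓝 q, p y ∈ (chartAt E (p q)).source :=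
  (h.smooth_proj q).continuousAt.eventually
    ((chartAt E (p q)).open_source.mem_nhds (mem_chart_source E (p q)))

/-- Near `q` the frame coefficients of `p_* Y` and the function `η(Y)` are linear over functions, so
their derivatives obey the product rule. -/
lemma isCovariantDerivativeOn_pullbackCov :
    IsCovariantDerivativeOn F (pullbackCov p η lift T nablaM) where
  add {Y Z q} hY hZ _ := by
    ext v
    have hev := h.eventually_mem_chart q
    have e1 : ∀ i, alongCoeff p (p q) (fun y => mfderiv 𝓘(ℝ, F) 𝓘(ℝ, E) p y ((Y + Z) y)) i
        =ᶠ[𝓝 q] fun y => alongCoeff p (p q) (fun y => mfderiv 𝓘(ℝ, F) 𝓘(ℝ, E) p y (Y y)) i y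
          + alongCoeff p (p q) (fun y => mfderiv 𝓘(ℝ, F) 𝓘(ℝ, E) p y (Z y)) i y := by
      intro i
      filter_upwards [hev] with y hy
      rw [← alongCoeff_add hy]
      congr 1
      funext y
      exact map_add _ _ _
    have e2 : (fun y => η y ((Y + Z) y)) = fun y => η y (Y y) + η y (Z y) := by
      funext y
      exact map_add _ _ _
    change _ = pullbackCov p η lift T nablaM Y q v + pullbackCov p η lift T nablaM Z q v
    rw [pullbackCov_apply, pullbackCov_apply, pullbackCov_apply]
    have d1 : ∀ i, mvfderiv 𝓘(ℝ, F)
        (alongCoeff p (p q) (fun y => mfderiv 𝓘(ℝ, F) 𝓘(ℝ, E) p y ((Y + Z) y)) i) q v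
        = mvfderiv 𝓘(ℝ, F) (alongCoeff p (p q) (fun y => mfderiv 𝓘(ℝ, F) 𝓘(ℝ, E) p y (Y y)) i) q v
          + mvfderiv 𝓘(ℝ, F) (alongCoeff p (p q) (fun y => mfderiv 𝓘(ℝ, F) 𝓘(ℝ, E) p y (Z y)) i) q v :=
      fun i => (mvfderiv_congr (e1 i) v).trans congr($(mvfderiv_add
        (mdifferentiableAt_alongCoeff (h.mdifferentiableAt_mfderiv_apply hY))
        (mdifferentiableAt_alongCoeff (h.mdifferentiableAt_mfderiv_apply hZ))) v)
    have d2 : mvfderiv 𝓘(ℝ, F) (fun y => η y (Y y) + η y (Z y)) q v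
        = mvfderiv 𝓘(ℝ, F) (fun y => η y (Y y)) q v + mvfderiv 𝓘(ℝ, F) (fun y => η y (Z y)) q v :=
      congr($(mvfderiv_add (OneForm.mdifferentiableAt_apply h.smooth_form hY)
        (OneForm.mdifferentiableAt_apply h.smooth_form hZ)) v)
    simp only [e2, d1, d2, (e1 _).self_of_nhds, add_smul, Finset.sum_add_distrib]
    abel
  leibniz {Y g q} hY hg _ := by
    ext v
    have hev := h.eventually_mem_chart q
    have e1 : ∀ i, alongCoeff p (p q) (fun y => mfderiv 𝓘(ℝ, F) 𝓘(ℝ, E) p y ((g • Y) y)) i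
        =ᶠ[𝓝 q] fun y =>
          g y • alongCoeff p (p q) (fun y => mfderiv 𝓘(ℝ, F) 𝓘(ℝ, E) p y (Y y)) i y := by
      intro i
      filter_upwards [hev] with y hy
      rw [smul_eq_mul, ← alongCoeff_smul hy]
      congr 1
      funext y
      exact map_smul _ _ _
    have e2 : (fun y => η y ((g • Y) y)) = fun y => g y • η y (Y y) := by
      funext y
      exact map_smul _ _ _
    change _ = g q • pullbackCov p η lift T nablaM Y q v + mvfderiv 𝓘(ℝ, F) g q v • Y q
    rw [pullbackCov_apply, pullbackCov_apply]
    have d1 : ∀ i, mvfderiv 𝓘(ℝ, F)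
        (alongCoeff p (p q) (fun y => mfderiv 𝓘(ℝ, F) 𝓘(ℝ, E) p y ((g • Y) y)) i) q v
        = g q * mvfderiv 𝓘(ℝ, F)
            (alongCoeff p (p q) (fun y => mfderiv 𝓘(ℝ, F) 𝓘(ℝ, E) p y (Y y)) i) q v
          + mvfderiv 𝓘(ℝ, F) g q v
            * alongCoeff p (p q) (fun y => mfderiv 𝓘(ℝ, F) 𝓘(ℝ, E) p y (Y y)) i q :=
      fun i => (mvfderiv_congr (e1 i) v).trans congr($(mvfderiv_smul hg
        (mdifferentiableAt_alongCoeff (h.mdifferentiableAt_mfderiv_apply hY))) v)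
    have d2 : mvfderiv 𝓘(ℝ, F) (fun y => g y • η y (Y y)) q v
        = g q * mvfderiv 𝓘(ℝ, F) (fun y => η y (Y y)) q v + mvfderiv 𝓘(ℝ, F) g q v * η q (Y q) :=
      congr($(mvfderiv_smul hg (OneForm.mdifferentiableAt_apply h.smooth_form hY)) v)
    -- The terms with the derivative of `g` reassemble to `Y q` through its expansion in the lifted
    -- frame and `T`.
    have d3 : Y q = ∑ i, alongCoeff p (p q) (fun y => mfderiv 𝓘(ℝ, F) 𝓘(ℝ, E) p y (Y y)) i q •
        lift q (baseFrame (p q) i (p q)) + η q (Y q) • T q := by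
      conv_lhs => rw [h.decomp q (Y q)]
      rw [sum_alongCoeff hev.self_of_nhds (fun y => mfderiv 𝓘(ℝ, F) 𝓘(ℝ, E) p y (Y y)), map_sum]
      simp only [map_smul]
    conv_rhs => rw [d3]
    simp only [e2, d1, d2, (e1 _).self_of_nhds, smul_add, Finset.smul_sum, add_smul, mul_smul,
      Finset.sum_add_distrib, smul_assoc]
    abel

/-- The pullback of the connection `nablaM` to the horizontal bundle, extended by `∇ T = 0`. -/
def pullbackConnection (nablaM : LinearConnection E M) : LinearConnection F P where
  toFun := pullbackCov p η lift T nablaM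
  isCovariantDerivativeOnUniv := h.isCovariantDerivativeOn_pullbackCov

/-- The coefficients of a lifted field are functions on `M` composed with `p`, so the defining
formula is the lift of the Leibniz expansion of `∇^M X`. In particular the choice of frame drops
out. -/
lemma pullbackConnection_lift {X : ∀ x : M, TangentSpace 𝓘(ℝ, E) x} (hX : DiffFieldAt X (p q))
    (v : TangentSpace 𝓘(ℝ, F) q) :
    h.pullbackConnection nablaM (fun y => lift y (X (p y))) q v
      = lift q (nablaM X (p q) (mfderiv 𝓘(ℝ, F) 𝓘(ℝ, E) p q v)) := by
  refine (pullbackCov_apply v).trans ?_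
  have hx := mem_chart_source E (p q)
  have h1 : ∀ i, alongCoeff p (p q)
      (fun y => mfderiv 𝓘(ℝ, F) 𝓘(ℝ, E) p y (lift y (X (p y)))) i
      = fun y => alongCoeff (fun x : M => x) (p q) X i (p y) := by
    intro i
    simp only [h.proj_lift]
    rfl
  have h2 : ∀ i, MDifferentiableAt 𝓘(ℝ, E) 𝓘(ℝ, ℝ) (alongCoeff (fun x : M => x) (p q) X i) (p q) :=
    fun i => mdifferentiableAt_alongCoeff (p := fun x : M => x) hX
  have h3 : (fun y => η y (lift y (X (p y)))) = fun _ => (0 : ℝ) := by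
    funext y
    exact h.form_lift _ _
  have h4 : mvfderiv 𝓘(ℝ, F) (fun y => η y (lift y (X (p y)))) q v = 0 := by
    rw [h3]
    exact congr($(mvfderiv_const (0 : ℝ)) v)
  rw [h4, zero_smul]
  refine (add_zero _).trans ?_
  have h5 := (nablaM.map_sum Finset.univ (fun i _ => h2 i)
    (fun i _ => diffFieldAt_baseFrame hx i) (mfderiv 𝓘(ℝ, F) 𝓘(ℝ, E) p q v)).2
  have h6 : ∀ᶠ x in 𝓝 (p q), (∑ i, alongCoeff (fun x : M => x) (p q) X i x • baseFrame (p q) i x)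
      = X x := by
    filter_upwards [(chartAt E (p q)).open_source.mem_nhds hx] with x hx
    exact (sum_alongCoeff (p := fun x : M => x) hx X).symm
  rw [nablaM.map_congr hX h6] at h5
  rw [h5, _root_.map_sum]
  refine Finset.sum_congr rfl fun i _ => ?_
  rw [map_add, map_smul, map_smul, h1, mvfderiv_comp' (h2 i) (h.mdifferentiableAt_proj q)]

lemma pullbackConnection_T (v : TangentSpace 𝓘(ℝ, F) q) :
    h.pullbackConnection nablaM T q v = 0 := by
  refine (pullbackCov_apply v).trans ?_
  have hev := h.eventually_mem_chart q
  have h1 : ∀ i, alongCoeff p (p q) (fun y => mfderiv 𝓘(ℝ, F) 𝓘(ℝ, E) p y (T y)) i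
      =ᶠ[𝓝 q] fun _ => 0 := by
    intro i
    filter_upwards [hev] with y hy
    have h2 := alongCoeff_smul (p := p) (i := i) (f := fun _ => (0 : ℝ))
      (S := fun y => mfderiv 𝓘(ℝ, F) 𝓘(ℝ, E) p y (T y)) hy
    rw [zero_mul] at h2
    rw [← h2]
    congr 1
    funext y
    rw [h.proj_T, smul_zero]
  have h3 : (fun y => η y (T y)) = fun _ => (1 : ℝ) := by
    funext y
    exact h.form_T _
  have h4 : mvfderiv 𝓘(ℝ, F) (fun y => η y (T y)) q v = 0 := by
    rw [h3]
    exact congr($(mvfderiv_const (1 : ℝ)) v)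
  have h5 : ∀ i, mvfderiv 𝓘(ℝ, F)
      (alongCoeff p (p q) (fun y => mfderiv 𝓘(ℝ, F) 𝓘(ℝ, E) p y (T y)) i) q v = 0 := fun i =>
    (mvfderiv_congr (h1 i) v).trans congr($(mvfderiv_const (0 : ℝ)) v)
  rw [h4, zero_smul]
  refine (add_zero _).trans (Finset.sum_eq_zero fun i _ => ?_)
  rw [h5, (h1 i).self_of_nhds, zero_smul, zero_smul]
  exact add_zero _

/-- An expression which is tensorial, and vanishes on horizontal lifts and on `T`, vanishes. -/
lemma eq_zero_of_tensorialAt {A : Type*} [NormedAddCommGroup A] [NormedSpace ℝ A]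
    {Φ : (∀ q : P, TangentSpace 𝓘(ℝ, F) q) → A} (hΦ : TensorialAt 𝓘(ℝ, F) F Φ q)
    (hlift : ∀ X : ∀ x : M, TangentSpace 𝓘(ℝ, E) x, DiffFieldAt X (p q) →
      Φ (fun y => lift y (X (p y))) = 0)
    (hT : Φ T = 0) (hY : DiffFieldAt Y q) : Φ Y = 0 := by
  let X : ∀ x : M, TangentSpace 𝓘(ℝ, E) x :=
    FiberBundle.extend E (mfderiv 𝓘(ℝ, F) 𝓘(ℝ, E) p q (Y q))
  have hX : DiffFieldAt X (p q) := diffFieldAt_extend _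
  have hXq : X (p q) = mfderiv 𝓘(ℝ, F) 𝓘(ℝ, E) p q (Y q) := extend_self _
  have hc : MDifferentiableAt 𝓘(ℝ, F) 𝓘(ℝ, ℝ) (fun _ : P => η q (Y q)) q :=
    mdifferentiableAt_const
  have h1 := hΦ.pointwise (σ' := (fun y => lift y (X (p y))) + (fun _ : P => η q (Y q)) • T) hY
    ((h.diffFieldAt_lift hX).add ((h.diffFieldAt_T q).smul hc)) (by
      change Y q = lift q (X (p q)) + η q (Y q) • T q
      rw [hXq]
      exact h.decomp q (Y q))
  have h2 := hΦ.add (σ' := (fun _ : P => η q (Y q)) • T) (h.diffFieldAt_lift hX)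
    ((h.diffFieldAt_T q).smul hc)
  rw [h1, h2, hΦ.smul hc (h.diffFieldAt_T q), hlift X hX, hT, smul_zero, add_zero]

lemma form_pullbackConnection (v : TangentSpace 𝓘(ℝ, F) q) :
    η q (h.pullbackConnection nablaM Y q v) = mvfderiv 𝓘(ℝ, F) (fun y => η y (Y y)) q v := by
  have h1 : h.pullbackConnection nablaM Y q v = _ := pullbackCov_apply v
  rw [h1]
  simp only [map_add, _root_.map_sum, map_smul, h.form_lift, h.form_T]
  simp

end IsSplitting

end PullbackConnection

/-! ### Smoothness of the pullback connection -/

section PullbackSmooth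

open VectorField

variable {E : Type*} [NormedAddCommGroup E] [NormedSpace ℝ E] [FiniteDimensional ℝ E]
  {M : Type*} [TopologicalSpace M] [ChartedSpace E M] [IsManifold 𝓘(ℝ, E) ∞ M] [T2Space M]
  {F : Type*} [NormedAddCommGroup F] [NormedSpace ℝ F] [FiniteDimensional ℝ F]
  {P : Type*} [TopologicalSpace P] [ChartedSpace F P] [IsManifold 𝓘(ℝ, F) ∞ P]
  {p : P → M} {η : OneForm F P}
  {lift : ∀ q : P, TangentSpace 𝓘(ℝ, E) (p q) →L[ℝ] TangentSpace 𝓘(ℝ, F) q}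
  {T : ∀ q : P, TangentSpace 𝓘(ℝ, F) q}
  {q : P} {nablaM : LinearConnection E M} {Y Z : ∀ q : P, TangentSpace 𝓘(ℝ, F) q}
  (h : IsSplitting p η lift T)
include h

namespace IsSplitting

lemma sum_alongCoeff_lift {q y : P} (hy : p y ∈ (chartAt E (p q)).source)
    (Y : ∀ q : P, TangentSpace 𝓘(ℝ, F) q) :
    Y y = ∑ i, alongCoeff p (p q) (fun y => mfderiv 𝓘(ℝ, F) 𝓘(ℝ, E) p y (Y y)) i y •
        lift y (baseFrame (p q) i (p y)) + η y (Y y) • T y := by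
  conv_lhs => rw [h.decomp y (Y y)]
  rw [sum_alongCoeff hy (fun y => mfderiv 𝓘(ℝ, F) 𝓘(ℝ, E) p y (Y y)), map_sum]
  simp only [map_smul]

/-- The defining formula at `y` uses the frame centred at `p y`, which does not vary continuously
with `y`. Expanding `Y` in the single frame centred at `p q` and using the connection laws gives an
expression that is visibly smooth. -/
lemma contMDiffAt_pullbackConnection
    (hn : CovariantDerivative.ContMDiffCovariantDerivative nablaM ∞)
    (hY : SmoothFieldOn Y univ) (q : P) :
    SmoothHomAt F (fun y : P => y) (fun y => y) (h.pullbackConnection nablaM Y) q := by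
  refine SmoothHomAt.of_apply_constSection continuousAt_id fun w => ?_
  have hYq : ContMDiffAt 𝓘(ℝ, F) 𝓘(ℝ, F).tangent ∞
      (fun y => (⟨y, Y y⟩ : TangentBundle 𝓘(ℝ, F) P)) q := hY.contMDiffAt Filter.univ_mem
  have hV : ContMDiffAt 𝓘(ℝ, F) 𝓘(ℝ, F).tangent ∞
      (fun y => (⟨y, constSection q w y⟩ : TangentBundle 𝓘(ℝ, F) P)) q :=
    (contMDiffOn_constSection q w).contMDiffAt
      ((chartAt F q).open_source.mem_nhds (mem_chart_source F q))
  have hpV := (smoothHomAt_mfderiv h.smooth_proj q).contMDiffAt_apply (h.smooth_proj q) hV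
  have hO := (chartAt E (p q)).open_source
  have hx := mem_chart_source E (p q)
  have hOP : IsOpen (p ⁻¹' (chartAt E (p q)).source) := hO.preimage h.smooth_proj.continuous
  set c : Fin (Module.finrank ℝ E) → P → ℝ :=
    alongCoeff p (p q) (fun y => mfderiv 𝓘(ℝ, F) 𝓘(ℝ, E) p y (Y y)) with hcdef
  have hc : ∀ i, ContMDiffAt 𝓘(ℝ, F) 𝓘(ℝ, ℝ) ∞ (c i) q := fun i =>
    contMDiffAt_alongCoeff
      ((smoothHomAt_mfderiv h.smooth_proj q).contMDiffAt_apply (h.smooth_proj q) hYq)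
  have hηY : ContMDiffAt 𝓘(ℝ, F) 𝓘(ℝ, ℝ) ∞ (fun y => η y (Y y)) q :=
    OneForm.contMDiffAt_apply h.smooth_form (m := ⊤) hYq
  have hlift : ∀ i, SmoothFieldOn (fun y => lift y (baseFrame (p q) i (p y)))
      (p ⁻¹' (chartAt E (p q)).source) := fun i =>
    h.smoothFieldOn_lift hO (smoothFieldOn_baseFrame (p q) i)
  have key : ∀ᶠ y in 𝓝 q, ∀ u, h.pullbackConnection nablaM Y y u
      = ∑ i, (c i y • lift y (nablaM (baseFrame (p q) i) (p y) (mfderiv 𝓘(ℝ, F) 𝓘(ℝ, E) p y u))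
          + mvfderiv 𝓘(ℝ, F) (c i) y u • lift y (baseFrame (p q) i (p y)))
        + mvfderiv 𝓘(ℝ, F) (fun y => η y (Y y)) y u • T y := by
    have hcd : ∀ᶠ y in 𝓝 q, ∀ i, MDifferentiableAt 𝓘(ℝ, F) 𝓘(ℝ, ℝ) (c i) y :=
      Filter.eventually_all.2 fun i => ((hc i).of_le (m := 1) (by simp)).eventually_mdifferentiableAt
    filter_upwards [hcd, (hηY.of_le (m := 1) (by simp)).eventually_mdifferentiableAt,
      h.eventually_mem_chart q] with y hcy hηy hy u
    have hly : ∀ i, DiffFieldAt (fun y => lift y (baseFrame (p q) i (p y))) y := fun i =>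
      (hlift i).diffFieldAt hOP hy
    have hs := (h.pullbackConnection nablaM).map_sum Finset.univ (fun i _ => hcy i)
      (fun i _ => hly i) u
    have hT := (h.diffFieldAt_T y).smul hηy
    have hYy : DiffFieldAt Y y := hY.diffFieldAt isOpen_univ (mem_univ y)
    have h1 := (h.pullbackConnection nablaM).map_add hs.1 hT u
    rw [LinearConnection.map_congr (h.pullbackConnection nablaM) hYy
      (by filter_upwards [hOP.mem_nhds hy] with z hz using (h.sum_alongCoeff_lift hz Y).symm),
      hs.2, LinearConnection.map_smul _ hηy (h.diffFieldAt_T y), h.pullbackConnection_T] at h1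
    rw [h1]
    refine congrArg₂ (· + ·) (Finset.sum_congr rfl fun i _ => ?_) ?_
    · rw [h.pullbackConnection_lift (diffFieldAt_baseFrame hy i)]
    · rw [smul_zero]
      exact zero_add _
  have hsm : ContMDiffAt 𝓘(ℝ, F) 𝓘(ℝ, F).tangent ∞
      (fun y => (⟨y, ∑ i, (c i y • lift y (nablaM (baseFrame (p q) i) (p y)
            (mfderiv 𝓘(ℝ, F) 𝓘(ℝ, E) p y (constSection q w y)))
          + mvfderiv 𝓘(ℝ, F) (c i) y (constSection q w y) • lift y (baseFrame (p q) i (p y)))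
        + mvfderiv 𝓘(ℝ, F) (fun y => η y (Y y)) y (constSection q w y) • T y⟩ :
          TangentBundle 𝓘(ℝ, F) P)) q := by
    refine ContMDiffAt.add_section (ContMDiffAt.sum_section fun i _ => ?_) ?_
    · refine ContMDiffAt.add_section (ContMDiffAt.smul_section (hc i) (h.contMDiffAt_lift ?_)) ?_
      · have h1 : SmoothHomAt E (fun x : M => x) (fun x => x) (nablaM (baseFrame (p q) i)) (p q) :=
          ((contMDiffAt_hom_bundle _).1 (LinearConnection.contMDiffAt_hom hn hO hx
            (smoothFieldOn_baseFrame (p q) i))).2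
        exact (SmoothHomAt.comp h1 (h.smooth_proj q)).contMDiffAt_apply (h.smooth_proj q) hpV
      · exact ContMDiffAt.smul_section (contMDiffAt_mvfderiv_apply (hc i) hV)
          ((hlift i).contMDiffAt (hOP.mem_nhds hx))
    · exact ContMDiffAt.smul_section (contMDiffAt_mvfderiv_apply hηY hV) (h.contMDiffAt_T q)
  refine hsm.congr_of_eventuallyEq ?_
  filter_upwards [key] with y hy
  rw [hy]

lemma contMDiffCovariantDerivative_pullbackConnection
    (hn : CovariantDerivative.ContMDiffCovariantDerivative nablaM ∞) :
    CovariantDerivative.ContMDiffCovariantDerivative (h.pullbackConnection nablaM) ∞ where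
  contMDiff := {
    contMDiff := fun {Y} hY q _ => by
      have hY' : SmoothFieldOn Y univ := ContMDiffOn.of_le hY (by simp)
      exact ContMDiffAt.contMDiffWithinAt
        ((contMDiffAt_hom_bundle _).2 ⟨contMDiffAt_id, h.contMDiffAt_pullbackConnection hn hY' q⟩) }

end IsSplitting

end PullbackSmooth

/-! ### The pullback connection is a Tanaka-Webster connection -/

section TanakaWebster

open VectorField

variable {E : Type*} [NormedAddCommGroup E] [NormedSpace ℝ E] [FiniteDimensional ℝ E]
  {M : Type*} [TopologicalSpace M] [ChartedSpace E M] [IsManifold 𝓘(ℝ, E) ∞ M] [T2Space M]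
  {F : Type*} [NormedAddCommGroup F] [NormedSpace ℝ F] [FiniteDimensional ℝ F]
  {P : Type*} [TopologicalSpace P] [ChartedSpace F P] [IsManifold 𝓘(ℝ, F) ∞ P]
  {p : P → M} {η : OneForm F P}
  {lift : ∀ q : P, TangentSpace 𝓘(ℝ, E) (p q) →L[ℝ] TangentSpace 𝓘(ℝ, F) q}
  {T : ∀ q : P, TangentSpace 𝓘(ℝ, F) q}
  {J : ∀ x : M, TangentSpace 𝓘(ℝ, E) x →L[ℝ] TangentSpace 𝓘(ℝ, E) x} {omega : DiffForm E M 2}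
  {q : P} {nablaM : LinearConnection E M} {Y Z : ∀ q : P, TangentSpace 𝓘(ℝ, F) q}

/-- The pullback of the Kähler metric to a degenerate symmetric form on `P`. -/
def pullbackMetric (p : P → M) (J : ∀ x : M, TangentSpace 𝓘(ℝ, E) x →L[ℝ] TangentSpace 𝓘(ℝ, E) x)
    (omega : DiffForm E M 2) (q : P) (u v : TangentSpace 𝓘(ℝ, F) q) : ℝ :=
  kahlerMetric J omega (p q) (mfderiv 𝓘(ℝ, F) 𝓘(ℝ, E) p q u) (mfderiv 𝓘(ℝ, F) 𝓘(ℝ, E) p q v)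

section PullbackMetric

variable {u u' v v' : TangentSpace 𝓘(ℝ, F) q} {a : ℝ}

lemma pullbackMetric_add_left :
    pullbackMetric p J omega q (u + u') v
      = pullbackMetric p J omega q u v + pullbackMetric p J omega q u' v := by
  rw [pullbackMetric, map_add, kahlerMetric_add_left]
  rfl

lemma pullbackMetric_sub_left :
    pullbackMetric p J omega q (u - u') v
      = pullbackMetric p J omega q u v - pullbackMetric p J omega q u' v := by
  rw [pullbackMetric, map_sub, kahlerMetric_sub_left]
  rfl

lemma pullbackMetric_smul_left :
    pullbackMetric p J omega q (a • u) v = a * pullbackMetric p J omega q u v := by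
  rw [pullbackMetric, map_smul, kahlerMetric_smul_left]
  rfl

lemma pullbackMetric_symm (hom : IsKahler J omega) :
    pullbackMetric p J omega q u v = pullbackMetric p J omega q v u :=
  kahlerMetric_symm hom

end PullbackMetric

namespace IsSplitting

variable (h : IsSplitting p η lift T)
include h

/-- The defect is tensorial in `Y`. It vanishes on horizontal lifts because `J` is parallel on `M`,
and on `T` because `T` is parallel and killed by the lifted structure. -/
lemma pullbackConnection_liftEnd (hom : IsKahler J omega)
    (hL : IsLeviCivita (kahlerMetric J omega) nablaM) (hY : DiffFieldAt Y q)
    (u : TangentSpace 𝓘(ℝ, F) q) :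
    h.pullbackConnection nablaM (fun y => liftEnd p lift J y (Y y)) q u
      = liftEnd p lift J q (h.pullbackConnection nablaM Y q u) := by
  let nabla := h.pullbackConnection nablaM
  let Φ : (∀ q : P, TangentSpace 𝓘(ℝ, F) q) → F := fun Y =>
    nabla (fun y => liftEnd p lift J y (Y y)) q u - liftEnd p lift J q (nabla Y q u)
  have hΦ : TensorialAt 𝓘(ℝ, F) F Φ q := by
    constructor
    · intro f V hf hV
      have h1 : (fun y => liftEnd p lift J y ((f • V) y)) = fun y => f y • liftEnd p lift J y (V y) := by
        funext y
        exact map_smul _ _ _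
      have h2 : (f • V) = fun y => f y • V y := rfl
      change nabla (fun y => liftEnd p lift J y ((f • V) y)) q u
        - liftEnd p lift J q (nabla (f • V) q u)
        = f q • (nabla (fun y => liftEnd p lift J y (V y)) q u - liftEnd p lift J q (nabla V q u))
      rw [h1, h2, nabla.map_smul hf (h.diffFieldAt_liftEnd hom.complex hV), nabla.map_smul hf hV,
        map_add, map_smul, map_smul]
      module
    · intro V W hV hW
      have h1 : (fun y => liftEnd p lift J y ((V + W) y))
          = fun y => liftEnd p lift J y (V y) + liftEnd p lift J y (W y) := by
        funext y
        exact map_add _ _ _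
      have h2 : (V + W) = fun y => V y + W y := rfl
      change nabla (fun y => liftEnd p lift J y ((V + W) y)) q u
        - liftEnd p lift J q (nabla (V + W) q u)
        = (nabla (fun y => liftEnd p lift J y (V y)) q u - liftEnd p lift J q (nabla V q u))
          + (nabla (fun y => liftEnd p lift J y (W y)) q u - liftEnd p lift J q (nabla W q u))
      rw [h1, h2, nabla.map_add (h.diffFieldAt_liftEnd hom.complex hV)
        (h.diffFieldAt_liftEnd hom.complex hW), nabla.map_add hV hW, map_add]
      abel
  refine sub_eq_zero.1 (h.eq_zero_of_tensorialAt hΦ ?_ ?_ hY)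
  · intro X hX
    change nabla (fun y => liftEnd p lift J y (lift y (X (p y)))) q u
      - liftEnd p lift J q (nabla (fun y => lift y (X (p y))) q u) = 0
    simp only [h.liftEnd_lift]
    rw [sub_eq_zero]
    refine (h.pullbackConnection_lift (hom.complex.diffFieldAt hX) u).trans ?_
    refine Eq.trans ?_ (congrArg (liftEnd p lift J q) (h.pullbackConnection_lift hX u)).symm
    rw [hL.parallel_J hom hX, h.liftEnd_lift]
  · change nabla (fun y => liftEnd p lift J y (T y)) q u - liftEnd p lift J q (nabla T q u) = 0
    simp only [h.liftEnd_T]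
    have h0 : (fun y : P => (0 : TangentSpace 𝓘(ℝ, F) y)) = 0 := rfl
    have h1 : nabla T q u = 0 := h.pullbackConnection_T u
    rw [h0, CovariantDerivative.zero, h1, map_zero]
    exact sub_zero _

lemma mdifferentiableAt_pullbackMetric (hom : IsKahler J omega) (hY : DiffFieldAt Y q)
    (hZ : DiffFieldAt Z q) :
    MDifferentiableAt 𝓘(ℝ, F) 𝓘(ℝ, ℝ) (fun y => pullbackMetric p J omega y (Y y) (Z y)) q := by
  have hx := mem_chart_source E (p q)
  have hc : ∀ {Y : ∀ q : P, TangentSpace 𝓘(ℝ, F) q}, DiffFieldAt Y q → ∀ i,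
      MDifferentiableAt 𝓘(ℝ, F) 𝓘(ℝ, ℝ)
        (alongCoeff p (p q) (fun y => mfderiv 𝓘(ℝ, F) 𝓘(ℝ, E) p y (Y y)) i) q := fun hY i =>
    mdifferentiableAt_alongCoeff (h.mdifferentiableAt_mfderiv_apply hY)
  have hg : ∀ i j, MDifferentiableAt 𝓘(ℝ, F) 𝓘(ℝ, ℝ) (fun y => kahlerMetric J omega (p y)
      (baseFrame (p q) i (p y)) (baseFrame (p q) j (p y))) q := fun i j =>
    MDifferentiableAt.comp q (DiffFieldAt.mdifferentiableAt_kahlerMetric hom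
      (diffFieldAt_baseFrame hx i) (diffFieldAt_baseFrame hx j)) (h.mdifferentiableAt_proj q)
  have hsum : ∀ {ι : Type} (s : Finset ι) {f : ι → P → ℝ},
      (∀ i ∈ s, MDifferentiableAt 𝓘(ℝ, F) 𝓘(ℝ, ℝ) (f i) q) →
      MDifferentiableAt 𝓘(ℝ, F) 𝓘(ℝ, ℝ) (fun y => ∑ i ∈ s, f i y) q := by
    intro ι s f hf
    classical
    induction s using Finset.induction_on with
    | empty => simpa using mdifferentiableAt_const
    | insert i s hi ih =>
      simp only [Finset.sum_insert hi]
      exact (hf i (Finset.mem_insert_self i s)).add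
        (ih fun j hj => hf j (Finset.mem_insert_of_mem hj))
  refine MDifferentiableAt.congr_of_eventuallyEq (hsum Finset.univ fun i _ =>
    hsum Finset.univ fun j _ => ((hc hY i).mul ((hc hZ j).mul (hg i j)))) ?_
  filter_upwards [h.eventually_mem_chart q] with y hy
  rw [pullbackMetric, sum_alongCoeff hy (fun y => mfderiv 𝓘(ℝ, F) 𝓘(ℝ, E) p y (Y y)),
    sum_alongCoeff hy (fun y => mfderiv 𝓘(ℝ, F) 𝓘(ℝ, E) p y (Z y))]
  let B := kahlerMetricHom J omega (p y)
  have hB : ∀ (a b : Fin (Module.finrank ℝ E) → ℝ) (e : Fin (Module.finrank ℝ E) → E),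
      B (∑ i, a i • e i) (∑ j, b j • e j) = ∑ i, ∑ j, a i * (b j * B (e i) (e j)) := by
    intro a b e
    simp only [map_sum, LinearMap.sum_apply, map_smul, LinearMap.smul_apply, smul_eq_mul,
      Finset.mul_sum]
    rw [Finset.sum_comm]
    exact Finset.sum_congr rfl fun i _ => Finset.sum_congr rfl fun j _ => by ring
  exact hB _ _ _

/-- The defect is tensorial in each field, so it is enough to test on lifts, where it is the metric
property on `M`, and on `T`, which the degenerate metric kills. -/
lemma pullbackConnection_metric (hom : IsKahler J omega)
    (hL : IsLeviCivita (kahlerMetric J omega) nablaM) (hY : DiffFieldAt Y q) (hZ : DiffFieldAt Z q)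
    (u : TangentSpace 𝓘(ℝ, F) q) :
    mvfderiv 𝓘(ℝ, F) (fun y => pullbackMetric p J omega y (Y y) (Z y)) q u
      = pullbackMetric p J omega q (h.pullbackConnection nablaM Y q u) (Z q)
        + pullbackMetric p J omega q (Y q) (h.pullbackConnection nablaM Z q u) := by
  let nabla := h.pullbackConnection nablaM
  let Φ : (∀ q : P, TangentSpace 𝓘(ℝ, F) q) → (∀ q : P, TangentSpace 𝓘(ℝ, F) q) → ℝ := fun Z Y =>
    mvfderiv 𝓘(ℝ, F) (fun y => pullbackMetric p J omega y (Y y) (Z y)) q u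
      - (pullbackMetric p J omega q (nabla Y q u) (Z q)
        + pullbackMetric p J omega q (Y q) (nabla Z q u))
  have hΦ : ∀ {Z}, DiffFieldAt Z q → TensorialAt 𝓘(ℝ, F) F (Φ Z) q := by
    intro Z hZ
    constructor
    · intro f V hf hV
      have h1 : (fun y => pullbackMetric p J omega y ((f • V) y) (Z y))
          = fun y => f y • pullbackMetric p J omega y (V y) (Z y) := by
        funext y
        exact pullbackMetric_smul_left
      have h2 : (f • V) = fun y => f y • V y := rfl
      have h3 : mvfderiv 𝓘(ℝ, F) (fun y => f y • pullbackMetric p J omega y (V y) (Z y)) q u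
          = f q * mvfderiv 𝓘(ℝ, F) (fun y => pullbackMetric p J omega y (V y) (Z y)) q u
            + mvfderiv 𝓘(ℝ, F) f q u * pullbackMetric p J omega q (V q) (Z q) :=
        congr($(mvfderiv_smul hf (h.mdifferentiableAt_pullbackMetric hom hV hZ)) u)
      simp only [Φ]
      rw [h1, h2, h3, nabla.map_smul hf hV, pullbackMetric_add_left, pullbackMetric_smul_left,
        pullbackMetric_smul_left, pullbackMetric_smul_left, smul_eq_mul]
      ring
    · intro V W hV hW
      have h1 : (fun y => pullbackMetric p J omega y ((V + W) y) (Z y))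
          = fun y => pullbackMetric p J omega y (V y) (Z y)
            + pullbackMetric p J omega y (W y) (Z y) := by
        funext y
        exact pullbackMetric_add_left
      have h2 : (V + W) = fun y => V y + W y := rfl
      have h3 : mvfderiv 𝓘(ℝ, F) (fun y => pullbackMetric p J omega y (V y) (Z y)
            + pullbackMetric p J omega y (W y) (Z y)) q u
          = mvfderiv 𝓘(ℝ, F) (fun y => pullbackMetric p J omega y (V y) (Z y)) q u
            + mvfderiv 𝓘(ℝ, F) (fun y => pullbackMetric p J omega y (W y) (Z y)) q u :=
        congr($(mvfderiv_add (h.mdifferentiableAt_pullbackMetric hom hV hZ)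
          (h.mdifferentiableAt_pullbackMetric hom hW hZ)) u)
      simp only [Φ]
      rw [h1, h2, h3, nabla.map_add hV hW, pullbackMetric_add_left, pullbackMetric_add_left]
      ring
  -- Symmetry transfers tensoriality from one slot to the other, so the reduction to lifts can be
  -- made one field at a time.
  have hsymm : ∀ Y Z, Φ Y Z = Φ Z Y := by
    intro Y Z
    simp only [Φ, pullbackMetric_symm (u := Z _) hom,
      pullbackMetric_symm (u := nabla Z q u) hom]
    ring
  have hzero : ∀ {y : P} {v w : TangentSpace 𝓘(ℝ, F) y},
      mfderiv 𝓘(ℝ, F) 𝓘(ℝ, E) p y v = 0 → pullbackMetric p J omega y v w = 0 := by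
    intro y v w hv
    rw [pullbackMetric, hv, kahlerMetric, DiffForm.zero_left₂]
  have hT : ∀ Z, Φ Z T = 0 := by
    intro Z
    have h1 : nabla T q u = 0 := h.pullbackConnection_T u
    have h2 : (fun y => pullbackMetric p J omega y (T y) (Z y)) = fun _ => (0 : ℝ) :=
      funext fun y => hzero (h.proj_T y)
    have h3 : mvfderiv 𝓘(ℝ, F) (fun _ : P => (0 : ℝ)) q u = 0 := congr($(mvfderiv_const (0 : ℝ)) u)
    simp only [Φ]
    rw [h1, h2, h3, hzero (map_zero _), hzero (h.proj_T q)]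
    ring
  have hlift : ∀ {X X' : ∀ x : M, TangentSpace 𝓘(ℝ, E) x}, DiffFieldAt X (p q) →
      DiffFieldAt X' (p q) →
      Φ (fun y => lift y (X (p y))) (fun y => lift y (X' (p y))) = 0 := by
    intro X X' hX hX'
    have h1 : ∀ {X : ∀ x : M, TangentSpace 𝓘(ℝ, E) x}, DiffFieldAt X (p q) →
        nabla (fun y => lift y (X (p y))) q u
        = lift q (nablaM X (p q) (mfderiv 𝓘(ℝ, F) 𝓘(ℝ, E) p q u)) :=
      fun hX => h.pullbackConnection_lift hX u
    simp only [Φ, h1 hX, h1 hX', pullbackMetric, h.proj_lift]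
    rw [mvfderiv_comp' (h := fun x => kahlerMetric J omega x (X' x) (X x))
      (DiffFieldAt.mdifferentiableAt_kahlerMetric hom hX' hX) (h.mdifferentiableAt_proj q),
      hL.metric X' X (p q) hX' hX]
    exact sub_self _
  have key : ∀ {X : ∀ x : M, TangentSpace 𝓘(ℝ, E) x}, DiffFieldAt X (p q) → ∀ {Y},
      DiffFieldAt Y q → Φ (fun y => lift y (X (p y))) Y = 0 := fun hX _ hY =>
    h.eq_zero_of_tensorialAt (hΦ (h.diffFieldAt_lift hX)) (fun X' hX' => hlift hX hX') (hT _) hY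
  exact sub_eq_zero.1 (h.eq_zero_of_tensorialAt (hΦ hZ)
    (fun X hX => (hsymm _ _).trans (key hX hZ)) (hT _) hY)

/-- The projection is the torsion on `M`, which is zero; the `η`-component is `-η` of the bracket of
two lifts, that is, `ω(u, v)`. -/
lemma torsion_pullbackConnection_lift
    (hc : ∀ (q : P) (u v : TangentSpace 𝓘(ℝ, F) q), η.d q ![u, v]
      = omega (p q) ![mfderiv 𝓘(ℝ, F) 𝓘(ℝ, E) p q u, mfderiv 𝓘(ℝ, F) 𝓘(ℝ, E) p q v])
    (hL : IsLeviCivita (kahlerMetric J omega) nablaM) (u v : TangentSpace 𝓘(ℝ, E) (p q)) :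
    (h.pullbackConnection nablaM).torsion q (lift q u) (lift q v) = omega (p q) ![u, v] • T q := by
  let X : ∀ y : M, TangentSpace 𝓘(ℝ, E) y := FiberBundle.extend E u
  let Y : ∀ y : M, TangentSpace 𝓘(ℝ, E) y := FiberBundle.extend E v
  have hX : DiffFieldAt X (p q) := diffFieldAt_extend u
  have hY : DiffFieldAt Y (p q) := diffFieldAt_extend v
  have hXu : X (p q) = u := extend_self u
  have hYv : Y (p q) = v := extend_self v
  have h1 := (h.pullbackConnection nablaM).torsion_apply (h.diffFieldAt_lift hX)
    (h.diffFieldAt_lift hY)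
  rw [h.pullbackConnection_lift hX, h.pullbackConnection_lift hY, h.proj_lift, h.proj_lift, hXu,
    hYv] at h1
  rw [h1, ← sub_eq_zero]
  have h2 := hL.mlieBracket_eq hX hY
  refine h.ext q _ ?_ ?_
  · rw [map_sub, map_sub, map_sub, map_smul, h.proj_lift, h.proj_lift, h.proj_T,
      h.mfderiv_mlieBracket_lift hX hY, h2, hXu, hYv, smul_zero, sub_zero, sub_self]
  · rw [map_sub, map_sub, map_sub, map_smul, h.form_lift, h.form_lift, h.form_T,
      h.form_mlieBracket_lift hc hX hY, hXu, hYv]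
    simp

/-- All three terms vanish: a lift is parallel along the vertical `T`, the field `T` is parallel,
and `T` commutes with lifts. -/
lemma torsion_pullbackConnection_T
    (hc : ∀ (q : P) (u v : TangentSpace 𝓘(ℝ, F) q), η.d q ![u, v]
      = omega (p q) ![mfderiv 𝓘(ℝ, F) 𝓘(ℝ, E) p q u, mfderiv 𝓘(ℝ, F) 𝓘(ℝ, E) p q v])
    (u : TangentSpace 𝓘(ℝ, E) (p q)) :
    (h.pullbackConnection nablaM).torsion q (T q) (lift q u) = 0 := by
  let X : ∀ y : M, TangentSpace 𝓘(ℝ, E) y := FiberBundle.extend E u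
  have hX : DiffFieldAt X (p q) := diffFieldAt_extend u
  have hXu : X (p q) = u := extend_self u
  have h1 := (h.pullbackConnection nablaM).torsion_apply (h.diffFieldAt_T q)
    (h.diffFieldAt_lift hX)
  rw [h.pullbackConnection_lift hX, h.pullbackConnection_T, h.mlieBracket_T_lift hc hX, h.proj_T,
    map_zero, map_zero, hXu] at h1
  rw [h1, sub_zero]
  exact sub_zero _

end IsSplitting

end TanakaWebster

/-! ### The Tanaka-Webster property and uniqueness -/

section TanakaWebsterUnique

open VectorField

variable {E : Type*} [NormedAddCommGroup E] [NormedSpace ℝ E] [FiniteDimensional ℝ E]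
  {M : Type*} [TopologicalSpace M] [ChartedSpace E M] [IsManifold 𝓘(ℝ, E) ∞ M] [T2Space M]
  {F : Type*} [NormedAddCommGroup F] [NormedSpace ℝ F] [FiniteDimensional ℝ F]
  {P : Type*} [TopologicalSpace P] [ChartedSpace F P] [IsManifold 𝓘(ℝ, F) ∞ P]
  {p : P → M} {η : OneForm F P}
  {lift : ∀ q : P, TangentSpace 𝓘(ℝ, E) (p q) →L[ℝ] TangentSpace 𝓘(ℝ, F) q}
  {T : ∀ q : P, TangentSpace 𝓘(ℝ, F) q}
  {J : ∀ x : M, TangentSpace 𝓘(ℝ, E) x →L[ℝ] TangentSpace 𝓘(ℝ, E) x} {omega : DiffForm E M 2}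
  {H : TangentDistribution F P} {JH : EndField H}
  {q : P} {nablaM : LinearConnection E M} {nabla : LinearConnection F P}
  (hH : IsHorizontalCR p η lift J H JH) (h : IsSplitting p η lift T) (hom : IsKahler J omega)
  (hc : ∀ (q : P) (u v : TangentSpace 𝓘(ℝ, F) q), η.d q ![u, v]
    = omega (p q) ![mfderiv 𝓘(ℝ, F) 𝓘(ℝ, E) p q u, mfderiv 𝓘(ℝ, F) 𝓘(ℝ, E) p q v])
  (hL : IsLeviCivita (kahlerMetric J omega) nablaM)
include hH h hom hc hL

namespace IsHorizontalCR

lemma isTanakaWebster : IsTanakaWebster H JH η T (h.pullbackConnection nablaM) where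
  smooth := h.contMDiffCovariantDerivative_pullbackConnection hL.smooth
  preserves Y q hY u := by
    rw [hH.mem_iff, h.form_pullbackConnection]
    have h1 : (fun y => η y (Y y : TangentSpace 𝓘(ℝ, F) y)) = fun _ => 0 :=
      funext fun y => hH.form_apply (Y y)
    rw [h1]
    exact congr($(mvfderiv_const (0 : ℝ)) u)
  parallel_J Y q hY u := by
    rw [hH.coe_apply]
    have h1 : (fun y => (JH y (Y y) : TangentSpace 𝓘(ℝ, F) y))
        = fun y => liftEnd p lift J y (Y y : TangentSpace 𝓘(ℝ, F) y) :=
      funext fun y => hH.coe_apply y (Y y)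
    rw [h1]
    exact h.pullbackConnection_liftEnd hom hL hY u
  parallel_T q u := h.pullbackConnection_T u
  metric Y Z q hY hZ u := by
    simp only [hH.leviForm_eq h hom hc]
    exact h.pullbackConnection_metric hom hL hY hZ u
  torsion_H q u v := by
    have h1 := h.lift_proj (hH.form_apply u)
    have h2 := h.lift_proj (hH.form_apply v)
    have h3 := h.torsion_pullbackConnection_lift hc hL (mfderiv 𝓘(ℝ, F) 𝓘(ℝ, E) p q u)
      (mfderiv 𝓘(ℝ, F) 𝓘(ℝ, E) p q v)
    rw [h1, h2] at h3
    rw [h3, hc]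
  -- Here `Tor(T, ·)` is zero on `H`, so anticommutation with `J` is automatic.
  torsion_T q u := by
    have h0 : ∀ u : H q, (h.pullbackConnection nablaM).torsion q (T q) u = 0 := by
      intro u
      have h1 := h.lift_proj (hH.form_apply u)
      rw [← h1]
      exact h.torsion_pullbackConnection_T hc _
    have h1 : (h.pullbackConnection nablaM).torsion q (T q) u ∈ H q := by
      rw [h0]
      exact (H q).zero_mem
    refine ⟨h1, (h0 (JH q u)).trans ?_⟩
    have h2 : (⟨_, h1⟩ : H q) = 0 := Subtype.ext (h0 u)
    rw [h2, map_zero]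
    exact neg_zero.symm

/-- A Tanaka-Webster connection agrees with the pullback connection on horizontal lifts. -/
lemma apply_lift (hTW : IsTanakaWebster H JH η T nabla) {X : ∀ x : M, TangentSpace 𝓘(ℝ, E) x}
    (hX : DiffFieldAt X (p q)) (u : TangentSpace 𝓘(ℝ, F) q) :
    nabla (fun y => lift y (X (p y))) q u
      = lift q (nablaM X (p q) (mfderiv 𝓘(ℝ, F) 𝓘(ℝ, E) p q u)) := by
  -- `D` is the difference tensor of the given connection and the pullback connection; its first
  -- argument is the differentiated vector, the second the direction.
  let D := IsCovariantDerivativeOn.difference nabla.isCovariantDerivativeOnUniv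
    h.isCovariantDerivativeOn_pullbackCov (cov' := pullbackCov p η lift T nablaM) q
  have hD : ∀ {Y : ∀ q : P, TangentSpace 𝓘(ℝ, F) q}, DiffFieldAt Y q → ∀ u,
      D (Y q) u = nabla Y q u - h.pullbackConnection nablaM Y q u := fun hY u =>
    congr($(IsCovariantDerivativeOn.difference_apply nabla.isCovariantDerivativeOnUniv
      h.isCovariantDerivativeOn_pullbackCov (mem_univ q) hY) u)
  have hTW0 := hH.isTanakaWebster h hom hc hL
  let g := pullbackMetric (F := F) p J omega q
  have hg : ∀ a b, g a b = g b a := fun a b => pullbackMetric_symm hom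
  let ext : TangentSpace 𝓘(ℝ, E) (p q) → ∀ x : M, TangentSpace 𝓘(ℝ, E) x := fun w =>
    FiberBundle.extend E w
  have hext : ∀ w, DiffFieldAt (ext w) (p q) := fun w => diffFieldAt_extend w
  have hextq : ∀ w, ext w (p q) = w := fun w => extend_self w
  have hlift : ∀ w, DiffFieldAt (fun y => lift y (ext w (p y))) q := fun w =>
    h.diffFieldAt_lift (hext w)
  let Y : TangentSpace 𝓘(ℝ, E) (p q) → ∀ y : P, H y := fun w y =>
    ⟨lift y (ext w (p y)), hH.lift_mem h _⟩
  have hDlift : ∀ w u, D (lift q w) u = nabla (fun y => lift y (ext w (p y))) q u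
      - h.pullbackConnection nablaM (fun y => lift y (ext w (p y))) q u := by
    intro w u
    rw [← hD (hlift w) u, hextq]
  have hmem : ∀ w u, η q (D (lift q w) u) = 0 := by
    intro w u
    rw [hDlift, map_sub, hH.mem_iff.1 (hTW.preserves (Y w) q (hlift w) u),
      hH.mem_iff.1 (hTW0.preserves (Y w) q (hlift w) u), sub_zero]
  have hskew : ∀ w z u, g (D (lift q w) u) (lift q z) = -g (D (lift q z) u) (lift q w) := by
    intro w z u
    have h1 := hTW.metric (Y w) (Y z) q (hlift w) (hlift z) u
    have h2 := hTW0.metric (Y w) (Y z) q (hlift w) (hlift z) u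
    rw [h1] at h2
    simp only [hH.leviForm_eq h hom hc] at h2
    change g (nabla (fun y => lift y (ext w (p y))) q u) (lift q (ext z (p q)))
      + g (lift q (ext w (p q))) (nabla (fun y => lift y (ext z (p y))) q u)
      = g (h.pullbackConnection nablaM (fun y => lift y (ext w (p y))) q u) (lift q (ext z (p q)))
      + g (lift q (ext w (p q))) (h.pullbackConnection nablaM (fun y => lift y (ext z (p y))) q u) at h2
    rw [hextq, hextq, hg (lift q w), hg (lift q w)] at h2
    have h3 : ∀ a b c, g (a - b) c = g a c - g b c := fun _ _ _ => pullbackMetric_sub_left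
    rw [hDlift, hDlift, h3, h3]
    linarith
  -- Both connections have the same torsion on `H`, so their difference is symmetric there.
  have hsymm : ∀ w z, D (lift q w) (lift q z) = D (lift q z) (lift q w) := by
    intro w z
    have h1 := hTW.torsion_H q ⟨lift q z, hH.lift_mem h z⟩ ⟨lift q w, hH.lift_mem h w⟩
    rw [← hTW0.torsion_H] at h1
    change nabla.torsion q (lift q z) (lift q w)
      = (h.pullbackConnection nablaM).torsion q (lift q z) (lift q w) at h1
    have h2 := nabla.torsion_apply (hlift z) (hlift w)
    have h3 := (h.pullbackConnection nablaM).torsion_apply (hlift z) (hlift w)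
    rw [hextq, hextq] at h2 h3
    rw [h2, h3, sub_left_inj] at h1
    rw [hDlift, hDlift, sub_eq_sub_iff_sub_eq_sub]
    exact h1
  -- Koszul's argument: a trilinear expression symmetric in one pair of arguments and skew in an
  -- overlapping pair vanishes.
  have hzero : ∀ w z, D (lift q w) (lift q z) = 0 := by
    intro w z
    have h1 : ∀ w z x, g (D (lift q w) (lift q z)) (lift q x) = 0 := by
      intro w z x
      have e1 := hskew z x (lift q w)
      have e2 := hskew x w (lift q z)
      have e3 := hskew w z (lift q x)
      rw [hsymm z w] at e1
      rw [hsymm x z] at e2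
      rw [hsymm w x] at e3
      linarith [hsymm w z]
    refine h.ext q _ (eq_zero_of_kahlerMetric hom fun v => ?_) (hmem _ _)
    have h2 : kahlerMetric J omega (p q) _ (mfderiv 𝓘(ℝ, F) 𝓘(ℝ, E) p q (lift q v)) = 0 := h1 w z v
    rwa [h.proj_lift] at h2
  have hJ : ∀ w u, D (lift q (J (p q) w)) u = liftEnd p lift J q (D (lift q w) u) := by
    intro w u
    have h1 := hTW.parallel_J (Y w) q (hlift w) u
    have h2 := hTW0.parallel_J (Y w) q (hlift w) u
    have h3 : (fun y => (JH y (Y w y) : TangentSpace 𝓘(ℝ, F) y))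
        = fun y => lift y (J (p y) (ext w (p y))) :=
      funext fun y => (hH.coe_apply y (Y w y)).trans (h.liftEnd_lift _)
    rw [hH.coe_apply, h3] at h1 h2
    have h4 := hD (h.diffFieldAt_lift (hom.complex.diffFieldAt (hext w))) u
    rw [hextq, h1, h2] at h4
    rw [h4, hDlift, map_sub]
  have htor : ∀ w, nabla.torsion q (T q) (lift q w) = D (lift q w) (T q) := by
    intro w
    have h1 := nabla.torsion_apply (h.diffFieldAt_T q) (hlift w)
    have h2 := h.pullbackConnection_lift (nablaM := nablaM) (hext w) (T q)
    rw [h.proj_T, map_zero, map_zero] at h2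
    rw [hextq, hTW.parallel_T, h.mlieBracket_T_lift hc (hext w)] at h1
    rw [h1, hDlift, h2, sub_zero]
  -- In the direction `T` the difference is the torsion `Tor(T, ·)`, which anticommutes with `J`,
  -- while `hJ` says that it commutes. So `J` kills its values, and these are horizontal, hence
  -- zero.
  have hzeroT : ∀ w, D (lift q w) (T q) = 0 := by
    intro w
    obtain ⟨h1, h2⟩ := hTW.torsion_T q ⟨lift q w, hH.lift_mem h w⟩
    rw [hH.coe_apply, hH.coe_apply] at h2
    change nabla.torsion q (T q) (liftEnd p lift J q (lift q w))
      = -liftEnd p lift J q (nabla.torsion q (T q) (lift q w)) at h2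
    rw [h.liftEnd_lift, htor, htor, hJ] at h2
    have h3 : liftEnd p lift J q (D (lift q w) (T q)) = 0 := by
      have h5 : (2 : ℝ) • liftEnd p lift J q (D (lift q w) (T q)) = 0 := by
        rw [two_smul]
        nth_rewrite 1 [h2]
        exact neg_add_cancel _
      exact (smul_eq_zero.1 h5).resolve_left two_ne_zero
    have h4 := h.liftEnd_liftEnd hom.complex (D (lift q w) (T q))
    rw [h3, hmem, zero_smul, map_zero] at h4
    exact neg_eq_zero.1 ((h4.trans (add_zero _)).symm)
  have h1 : D (lift q (X (p q))) u = 0 := by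
    rw [h.decomp q u, map_add, map_smul, hzero, hzeroT, smul_zero]
    exact add_zero _
  rw [hD (h.diffFieldAt_lift hX) u, sub_eq_zero] at h1
  rw [h1, h.pullbackConnection_lift hX]

end IsHorizontalCR

end TanakaWebsterUnique

/-! ### Curvature of the pullback connection -/

section ComplexCoframe

/-- Complex coordinates of a real vector space with a complex structure. -/
lemma exists_isComplexCoframe {V : Type*} [AddCommGroup V] [Module ℝ V] [FiniteDimensional ℝ V]
    {J : V →ₗ[ℝ] V} (hJ : ∀ v, J (J v) = -v) {n : ℕ} (hn : Module.finrank ℝ V = 2 * n) :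
    ∃ (κ : V →ₗ[ℝ] (Fin n → ℂ)) (e : Fin n → V), IsComplexCoframe J κ e := by
  have hJ' : (J : Module.End ℝ V) * J = -1 := LinearMap.ext hJ
  -- Letting `i` act by `J` makes `V` a complex vector space of dimension `n`; the coordinates of a
  -- complex basis form the coframe.
  let φ : ℂ →ₐ[ℝ] Module.End ℝ V := Complex.lift ⟨J, hJ'⟩
  have hφI : φ Complex.I = J := Complex.liftAux_apply_I J hJ'
  let _ : Module ℂ V := Module.compHom V φ.toRingHom
  have hsmul : ∀ (z : ℂ) (v : V), z • v = φ z v := fun _ _ => rfl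
  have : IsScalarTower ℝ ℂ V := ⟨fun r z v => by rw [hsmul, hsmul, map_smul]; rfl⟩
  have : Module.Finite ℂ V := Module.Finite.of_restrictScalars_finite ℝ ℂ V
  have hdim : Module.finrank ℂ V = n := by
    have h1 := Module.finrank_mul_finrank ℝ ℂ V
    rw [Complex.finrank_real_complex, hn] at h1
    omega
  let b : Module.Basis (Fin n) ℂ V := Module.finBasisOfFinrankEq ℂ V hdim
  refine ⟨b.equivFun.toLinearMap.restrictScalars ℝ, b, ?_, ?_, ?_⟩
  · intro v
    have h1 : J v = Complex.I • v := by rw [hsmul, hφI]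
    rw [h1]
    exact map_smul b.equivFun _ _
  · intro v hv
    exact b.equivFun.map_eq_zero_iff.1 hv
  · intro α
    change b.equivFun (b α) = _
    funext j
    rw [Module.Basis.equivFun_self, Pi.single_apply]
    simp [eq_comm]

end ComplexCoframe

/-! ### Horizontal curvature and the pseudohermitian scalar curvature -/

section PullbackCurvature

open VectorField

variable {E : Type*} [NormedAddCommGroup E] [NormedSpace ℝ E] [FiniteDimensional ℝ E]
  {M : Type*} [TopologicalSpace M] [ChartedSpace E M] [IsManifold 𝓘(ℝ, E) ∞ M] [T2Space M]
  {F : Type*} [NormedAddCommGroup F] [NormedSpace ℝ F] [FiniteDimensional ℝ F]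
  {P : Type*} [TopologicalSpace P] [ChartedSpace F P] [IsManifold 𝓘(ℝ, F) ∞ P] [T2Space P]
  {p : P → M} {η : OneForm F P}
  {lift : ∀ q : P, TangentSpace 𝓘(ℝ, E) (p q) →L[ℝ] TangentSpace 𝓘(ℝ, F) q}
  {T : ∀ q : P, TangentSpace 𝓘(ℝ, F) q}
  {J : ∀ x : M, TangentSpace 𝓘(ℝ, E) x →L[ℝ] TangentSpace 𝓘(ℝ, E) x} {omega : DiffForm E M 2}
  {H : TangentDistribution F P} {JH : EndField H}
  {q : P} {nablaM : LinearConnection E M} {nabla : LinearConnection F P}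

/-- The curvature may be computed with lifts of fields on `M`. The bracket of two lifts has a
vertical part, but it does not matter: by `hN` the derivative of a lifted field depends only on the
projection of the direction. -/
lemma IsSplitting.curvature_lift (h : IsSplitting p η lift T)
    (hn : CovariantDerivative.ContMDiffCovariantDerivative nabla ∞)
    (hnM : CovariantDerivative.ContMDiffCovariantDerivative nablaM ∞)
    (hN : ∀ (X : ∀ x : M, TangentSpace 𝓘(ℝ, E) x) (q : P), DiffFieldAt X (p q) →
      ∀ u : TangentSpace 𝓘(ℝ, F) q, nabla (fun y => lift y (X (p y))) q u
        = lift q (nablaM X (p q) (mfderiv 𝓘(ℝ, F) 𝓘(ℝ, E) p q u)))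
    (u v w : TangentSpace 𝓘(ℝ, E) (p q)) :
    curvature nabla q (lift q u) (lift q v) (lift q w) = lift q (curvature nablaM (p q) u v w) := by
  have hC := (chartAt E (p q)).open_source
  have hxC := mem_chart_source E (p q)
  let X : ∀ y : M, TangentSpace 𝓘(ℝ, E) y := FiberBundle.extend E u
  let Y : ∀ y : M, TangentSpace 𝓘(ℝ, E) y := FiberBundle.extend E v
  let W : ∀ y : M, TangentSpace 𝓘(ℝ, E) y := FiberBundle.extend E w
  have hX : DiffFieldAt X (p q) := diffFieldAt_extend u
  have hY : DiffFieldAt Y (p q) := diffFieldAt_extend v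
  have hW : SmoothFieldOn W (chartAt E (p q)).source := smoothFieldOn_extend w
  have hO : IsOpen (p ⁻¹' (chartAt E (p q)).source) := hC.preimage h.smooth_proj.continuous
  have h1 := curvature_apply hn hO hxC (h.smoothFieldOn_lift hC hW) (h.diffFieldAt_lift hX)
    (h.diffFieldAt_lift hY)
  rw [show X (p q) = u from extend_self u, show Y (p q) = v from extend_self v,
    show W (p q) = w from extend_self w] at h1
  rw [h1, curvature_eq_curvatureOp_extend]
  change _ = lift q (curvatureOp nablaM X Y W (p q))
  have key : ∀ {Z : ∀ y : M, TangentSpace 𝓘(ℝ, E) y}, DiffFieldAt Z (p q) → ∀ u,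
      nabla (fun y => nabla (fun z => lift z (W (p z))) y (lift y (Z (p y)))) q u
        = lift q (nablaM (fun x => nablaM W x (Z x)) (p q) (mfderiv 𝓘(ℝ, F) 𝓘(ℝ, E) p q u)) := by
    intro Z hZ u
    have h2 := LinearConnection.diffFieldAt_apply hnM hC hxC hW hZ
    rw [← hN _ q h2]
    refine congr($(LinearConnection.map_congr nabla (h.diffFieldAt_lift h2) ?_) u)
    filter_upwards [hO.mem_nhds hxC] with y hy
    rw [hN W y (hW.diffFieldAt hC hy), h.proj_lift]
  simp only [curvatureOp]
  rw [key hX, key hY, hN W q (hW.diffFieldAt hC hxC), h.mfderiv_mlieBracket_lift hX hY,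
    h.proj_lift, h.proj_lift, map_sub, map_sub]

variable (hH : IsHorizontalCR p η lift J H JH) (h : IsSplitting p η lift T) (hom : IsKahler J omega)
include hH h hom

lemma IsHorizontalCR.exists_isAdmissibleCoframeAt {n : ℕ} (hdim : Module.finrank ℝ E = 2 * n)
    (q : P) : ∃ (e : Fin n → H q) (coframe : TangentSpace 𝓘(ℝ, F) q →ₗ[ℝ] (Fin n → ℂ)),
      IsAdmissibleCoframeAt H JH T q e coframe := by
  obtain ⟨κ, e, hκ⟩ := exists_isComplexCoframe (J := complexStructureHom J (p q))
    (hom.complex.sq (p q)) hdim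
  let dp : TangentSpace 𝓘(ℝ, F) q →ₗ[ℝ] E := (mfderiv 𝓘(ℝ, F) 𝓘(ℝ, E) p q).toLinearMap
  have hdplift : ∀ u, dp (lift q u) = u := h.proj_lift q
  refine ⟨fun α => ⟨lift q (e α), hH.lift_mem h _⟩, κ ∘ₗ dp, ?_, ?_, ?_, ?_⟩
  · have h1 : dp (T q) = 0 := h.proj_T q
    change κ (dp (T q)) = 0
    rw [h1, map_zero]
  · intro v
    change κ (dp (JH q v)) = Complex.I • κ (dp v)
    rw [← hκ.map_J, hH.coe_apply]
    exact congrArg κ (h.mfderiv_liftEnd _)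
  · intro v hv
    exact Subtype.ext (h.ext q _ (hκ.injective _ hv) (hH.form_apply v))
  · intro α
    exact (congrArg κ (hdplift (e α))).trans (hκ.dual α)

variable (hc : ∀ (q : P) (u v : TangentSpace 𝓘(ℝ, F) q), η.d q ![u, v]
    = omega (p q) ![mfderiv 𝓘(ℝ, F) 𝓘(ℝ, E) p q u, mfderiv 𝓘(ℝ, F) 𝓘(ℝ, E) p q v])
  (hL : IsLeviCivita (kahlerMetric J omega) nablaM)
include hc hL

/-- Composed with the horizontal lift, an admissible coframe at `q` becomes a complex coframe on the
tangent space of `M` at `p q`. The Levi matrix and the curvature forms become those of the Kähler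
metric, so the contraction on `M` applies. -/
lemma IsHorizontalCR.isPseudohermitianScalarCurvatureAt
    (hTW : IsTanakaWebster H JH η T nabla) {n : ℕ} (hdim : Module.finrank ℝ E = 2 * n) (q : P) :
    IsPseudohermitianScalarCurvatureAt n H JH η T nabla q
      (kahlerScalarCurvature J omega nablaM (p q)) := by
  refine ⟨hH.exists_isAdmissibleCoframeAt h hom hdim q, fun e coframe hco => ?_⟩
  let κ : E →ₗ[ℝ] (Fin n → ℂ) := coframe ∘ₗ (lift q).toLinearMap
  let f : Fin n → E := fun α => mfderiv 𝓘(ℝ, F) 𝓘(ℝ, E) p q (e α)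
  have hf : ∀ α, lift q (f α) = e α := fun α => h.lift_proj (hH.form_apply (e α))
  have hJf : ∀ α, lift q (J (p q) (f α)) = (JH q (e α) : TangentSpace 𝓘(ℝ, F) q) := fun α => by
    rw [hH.coe_apply]
    rfl
  have hκ : IsComplexCoframe (V := E) (complexStructureHom J (p q)) κ f := by
    refine ⟨fun v => ?_, fun v hv => ?_, fun α => ?_⟩
    · have h1 := hco.map_J ⟨lift q v, hH.lift_mem h v⟩
      rw [hH.coe_apply] at h1
      exact (congrArg coframe (h.liftEnd_lift v)).symm.trans h1
    · have h1 := hco.injective ⟨lift q v, hH.lift_mem h v⟩ hv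
      have h2 : lift q v = 0 := congrArg Subtype.val h1
      have h3 := h.proj_lift q v
      rw [h2, map_zero] at h3
      exact h3.symm
    · change coframe (lift q (f α)) = _
      rw [hf]
      exact hco.dual α
  have hcurv := fun u v w => h.curvature_lift (q := q) hTW.smooth hL.smooth
    (fun X q hX u => hH.apply_lift h hom hc hL hTW hX u) u v w
  have e1 : ∀ α, mfderiv 𝓘(ℝ, F) 𝓘(ℝ, E) p q (((1 / 2 : ℝ) • e α : H q) : TangentSpace 𝓘(ℝ, F) q)
      = (1 / 2 : ℝ) • f α := fun α => map_smul _ _ _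
  have e2 : ∀ α, mfderiv 𝓘(ℝ, F) 𝓘(ℝ, E) p q
      (((1 / 2 : ℝ) • JH q (e α) : H q) : TangentSpace 𝓘(ℝ, F) q)
      = (1 / 2 : ℝ) • J (p q) (f α) := fun α => by
    refine (map_smul _ _ _).trans (congrArg ((1 / 2 : ℝ) • ·) ?_)
    rw [← hJf, h.proj_lift]
  have e3 : ∀ α, mfderiv 𝓘(ℝ, F) 𝓘(ℝ, E) p q
      ((-((1 / 2 : ℝ) • JH q (e α)) : H q) : TangentSpace 𝓘(ℝ, F) q)
      = -((1 / 2 : ℝ) • J (p q) (f α)) := fun α =>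
    (map_neg _ _).trans (congrArg Neg.neg (e2 α))
  -- A form on `H` that factors through `p_*` has the same complex extension as its counterpart on
  -- the base, evaluated at the projected frame.
  have hext : ∀ (B : H q → H q → ℂ) (B' : E → E → ℂ),
      (∀ v w : H q, B v w
        = B' (mfderiv 𝓘(ℝ, F) 𝓘(ℝ, E) p q v) (mfderiv 𝓘(ℝ, F) 𝓘(ℝ, E) p q w)) → ∀ ρ σ,
      complexExtend B (frameZ JH e ρ) (frameZbar JH e σ)
        = complexExtend B' ((1 / 2 : ℝ) • f ρ, -((1 / 2 : ℝ) • J (p q) (f ρ)))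
          ((1 / 2 : ℝ) • f σ, (1 / 2 : ℝ) • J (p q) (f σ)) := by
    intro B B' hB ρ σ
    simp only [complexExtend, frameZ, frameZbar, hB, e1, e2, e3]
  refine hL.contraction hom (p q) hκ (fun ρ σ => ?_) fun ρ σ => ?_
  · refine Eq.trans (Matrix.of_apply _ _ _) (hext _ _ (fun v w => ?_) ρ σ)
    rw [hH.leviForm_eq h hom hc]
  · refine Eq.trans (Matrix.of_apply _ _ _)
      (Finset.sum_congr rfl fun α _ => hext _ _ (fun v w => ?_) ρ σ)
    have c1 : ∀ z : H q, curvature nabla q v w z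
        = lift q (curvature nablaM (p q) (mfderiv 𝓘(ℝ, F) 𝓘(ℝ, E) p q v)
          (mfderiv 𝓘(ℝ, F) 𝓘(ℝ, E) p q w) (mfderiv 𝓘(ℝ, F) 𝓘(ℝ, E) p q z)) := by
      intro z
      rw [← hcurv, h.lift_proj (hH.form_apply v), h.lift_proj (hH.form_apply w),
        h.lift_proj (hH.form_apply z)]
    rw [curvatureForm, c1, c1]
    simp only [frameZ, e1, e3]
    rfl

end PullbackCurvature

end

/-! ### The theorem -/

theorem proposition2p2 (n : ℕ)
    {M : Type*} [TopologicalSpace M] [T2Space M] [SecondCountableTopology M]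
    [ChartedSpace (EuclideanSpace ℝ (Fin (2 * n))) M] [IsManifold (𝓡 (2 * n)) ∞ M]
    {P : Type*} [TopologicalSpace P] [T2Space P] [SecondCountableTopology P]
    [ChartedSpace (EuclideanSpace ℝ (Fin (2 * n + 1))) P] [IsManifold (𝓡 (2 * n + 1)) ∞ P]
    [MulAction Circle P]
    (J : ∀ x : M, TangentSpace (𝓡 (2 * n)) x →L[ℝ] TangentSpace (𝓡 (2 * n)) x)
    (omega : DiffForm (EuclideanSpace ℝ (Fin (2 * n))) M 2) (hom : IsKahler J omega)
    (p : P → M)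
    (hp : IsPrincipalCircleBundle (E := EuclideanSpace ℝ (Fin (2 * n)))
      (F := EuclideanSpace ℝ (Fin (2 * n + 1))) p)
    (θ : OneForm (EuclideanSpace ℝ (Fin (2 * n + 1))) P) (hθ : IsPrincipalConnection θ)
    (hcurv : ∀ (q : P) (u v : TangentSpace (𝓡 (2 * n + 1)) q),
      θ.d q ![u, v] / (2 * Real.pi)
        = omega (p q) ![mfderiv (𝓡 (2 * n + 1)) (𝓡 (2 * n)) p q u,
            mfderiv (𝓡 (2 * n + 1)) (𝓡 (2 * n)) p q v])
    (η : OneForm (EuclideanSpace ℝ (Fin (2 * n + 1))) P)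
    (hη : ∀ q : P, η q = (1 / (2 * Real.pi)) • θ q) :
    (∀ q : P, (horizontalProj (EuclideanSpace ℝ (Fin (2 * n))) p θ q).IsInvertible) ∧
    IsStronglyPseudoconvexCR (horizontal θ) (liftedJ p θ J) ∧
    IsPseudohermitian (horizontal θ) (liftedJ p θ J) θ ∧
    IsPseudohermitian (horizontal θ) (liftedJ p θ J) η ∧
    (∃! T : ∀ q : P, TangentSpace (𝓡 (2 * n + 1)) q, IsReebField η T) ∧
    ∀ T : ∀ q : P, TangentSpace (𝓡 (2 * n + 1)) q, IsReebField η T →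
      ∀ nablaM : LinearConnection (EuclideanSpace ℝ (Fin (2 * n))) M,
        IsLeviCivita (kahlerMetric J omega) nablaM →
          (∃ nabla : LinearConnection (EuclideanSpace ℝ (Fin (2 * n + 1))) P,
            IsTanakaWebster (horizontal θ) (liftedJ p θ J) η T nabla) ∧
          ∀ nabla : LinearConnection (EuclideanSpace ℝ (Fin (2 * n + 1))) P,
            IsTanakaWebster (horizontal θ) (liftedJ p θ J) η T nabla →
              IsPullbackConnection p θ nablaM nabla ∧
              ∀ q : P, IsPseudohermitianScalarCurvatureAt n (horizontal θ) (liftedJ p θ J) η T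
                nabla q (kahlerScalarCurvature J omega nablaM (p q)) := by
  have hdimE : Module.finrank ℝ (EuclideanSpace ℝ (Fin (2 * n))) = 2 * n := finrank_euclideanSpace_fin
  have hdim : Module.finrank ℝ (EuclideanSpace ℝ (Fin (2 * n + 1)))
      = Module.finrank ℝ (EuclideanSpace ℝ (Fin (2 * n))) + 1 := by
    rw [hdimE, finrank_euclideanSpace_fin]
  have hpos : 0 < 1 / (2 * Real.pi) := by positivity
  -- The factor `1/2π` in `η` is absorbed here once and for all: `dη = p^*ω` with no constant.
  have hc : ∀ (q : P) (u v : TangentSpace (𝓡 (2 * n + 1)) q), η.d q ![u, v]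
      = omega (p q) ![mfderiv (𝓡 (2 * n + 1)) (𝓡 (2 * n)) p q u,
          mfderiv (𝓡 (2 * n + 1)) (𝓡 (2 * n)) p q v] := by
    intro q u v
    rw [← hcurv, OneForm.d_smul hη]
    change 1 / (2 * Real.pi) * θ.d q ![u, v] = _
    rw [one_div_mul_eq_div]
  obtain ⟨T₀, h⟩ := exists_isSplitting hp hθ hdim hpos.ne' hη
  have hH : IsHorizontalCR p η (fun q => (horizontal θ q).subtypeL.comp (horizontalLift p θ q)) J
      (horizontal θ) (liftedJ p θ J) := by
    refine ⟨fun q => ?_, fun q v => rfl⟩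
    ext v
    rw [hη]
    change (1 / (2 * Real.pi)) • θ q v = 0 ↔ θ q v = 0
    rw [smul_eq_zero, or_iff_right hpos.ne']
  have hη' := hH.isPseudohermitian h hom hc
  have hθ' := hη'.smul hpos hη hθ.smooth
  refine ⟨isInvertible_horizontalProj hp hθ hdim, ⟨hη'.cr, η, hη'⟩, hθ', hη',
    ⟨T₀, h.isReebField hc, fun T hT => h.eq_of_isReebField hc hom hT⟩, ?_⟩
  intro T hT nablaM hL
  -- Uniqueness of the Reeb field identifies the given `T` with the vertical field of the splitting.
  obtain rfl : T = T₀ := h.eq_of_isReebField hc hom hT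
  refine ⟨⟨_, hH.isTanakaWebster h hom hc hL⟩, fun nabla hTW => ⟨fun Y q hY v => ?_, fun q => ?_⟩⟩
  · exact hH.apply_lift h hom hc hL hTW hY v
  · exact hH.isPseudohermitianScalarCurvatureAt h hom hc hL hTW hdimE q
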